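/- Let $n,m\ge 1$, put $N=2^{n-1}$ and $h=h(n,m)=2^{n-1}m$. Let $$A_n=\mathbb{Z}_{(2)}[\gamma^i t_k : k\ge 1,\ 0\le i<N]$$ with the action of $C_{2^n}=\langle\gamma\rangle$ given by $\gamma(\gamma^i t_k)=\gamma^{i+1}t_k$ for $i<N-1$ and $\gamma(\gamma^{N-1}t_k)=-t_k$ (this is $\pi^e_*\mathrm{BP}^{((C_{2^n}))}$), and let $\mathcal F$ be its universal $2$-typical formal group law: the unique formal group law over $A_n$ whose logarithm over $A_n\otimes\mathbb{Q}$ is $\sum_{k\ge0}\ell_kx^{2^k}$ with $\ell_0=1$, where $\gamma^{N}\ell_k=-\ell_k$ for $k\ge1$ and $\psi_\gamma(x)=x+_{\mathcal F^\gamma}\sum^{\mathcal F^\gamma}_{i\ge1}t_ix^{2^i}$ is a strict isomorphism $\mathcal F\to\mathcal F^\gamma$. For a field $k$ algebraic over $\mathbb{F}_2$ let $$R_n(k,m)=W(k)[C_{2^n}\cdot t_1,\dots,C_{2^n}\cdot t_{m-1},C_{2^n}\cdot u][C_{2^n}\cdot u^{-1}]^\wedge_{\mathfrak m},\qquad \mathfrak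 m=(C_{2^n}\cdot t_1,\dots,C_{2^n}\cdot t_{m-1},C_{2^n}\cdot(u-\gamma u)),$$ where each $C_{2^n}\cdot y$ consists of $N$ variables $y,\gamma y,\dots,\gamma^{N-1}y$ with $\gamma^N y=-y$. Let $\Gamma_h$ be the image of $\mathcal F$ over $K_n(k,m)=R_n(k,m)/\mathfrak m=k[u^{\pm1}]$ under the $C_{2^n}$-equivariant map $A_n\to R_n(k,m)$ with $t_i\mapsto t_i$ for $i<m$, $t_m\mapsto u^{2^m-1}$ and $t_i\mapsto0$ for $i>m$; it carries the $C_{2^n}$-action generated by $x+_{\Gamma_h}u^{2^m-1}x^{2^m}$. Regard $\Gamma_h$ as a formal group law over $k=K_n(k,m)_0$ via $u\,\Gamma_h(u^{-1}x,u^{-1}y)$ (equivalently, set $u=1$). Say that the pair $(k,\Gamma_h)$ has all automorphisms if extension of scalars $\mathrm{Aut}_k(\Gamma_h)\to\mathrm{Aut}_{\overline{\mathbb F}_2}(\Gamma_h)$ is bijective, i.e. every automorphism of $\Gamma_h$ over $\overline{\mathbb F}_2$ has coefficients in $k$. Then: 1. if $n=1$, the pair $(\mathbb{F}_{2^h},\Gamma_h)$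 has all automorphisms; 2. if $n=2$, the pair $(\mathbb{F}_{2^{2h}},\Gamma_h)$ has all automorphisms; 3. if $n>2$, there is no finite $r$ such that the pair $(\mathbb{F}_{2^r},\Gamma_h)$ has all automorphisms. -/

import Mathlib

namespace RealBordism
open MvPowerSeries Finset

/-! ### The functional equation lemma in two variables -/

section FE
variable {E : Type*} [CommRing E]

/-- Power series in two variables all of whose coefficients in total degree `< r` lie in `A`. -/
def truncSubring (A : Subring E) (r : ℕ) : Subring (MvPowerSeries (Fin 2) E) where
  carrier := {h | ∀ d : Fin 2 →₀ ℕ, d.degree < r → coeff d h ∈ A}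
  mul_mem' := by
    intro a b ha hb d hd
    rw [coeff_mul]
    refine sum_mem fun p hp => ?_
    have h := congrArg Finsupp.degree (mem_antidiagonal.1 hp)
    rw [map_add] at h
    exact A.mul_mem (ha _ (by omega)) (hb _ (by omega))
  one_mem' := by
    intro d hd
    rw [coeff_one]
    split_ifs
    exacts [A.one_mem, A.zero_mem]
  add_mem' := by
    intro a b ha hb d hd
    rw [map_add]; exact A.add_mem (ha d hd) (hb d hd)
  zero_mem' := by
    intro d hd
    simp [A.zero_mem]
  neg_mem' := by
    intro a ha d hd
    rw [map_neg]; exact A.neg_mem (ha d hd)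

variable {A : Subring E}

lemma mem_truncSubring {r : ℕ} {h : MvPowerSeries (Fin 2) E} :
    h ∈ truncSubring A r ↔ ∀ d : Fin 2 →₀ ℕ, d.degree < r → coeff d h ∈ A := Iff.rfl

lemma truncSubring_anti {r s : ℕ} (hrs : r ≤ s) {h : MvPowerSeries (Fin 2) E}
    (hh : h ∈ truncSubring A s) : h ∈ truncSubring A r :=
  fun d hd => hh d (by omega)

lemma mem_of_le_order {r : ℕ} {h : MvPowerSeries (Fin 2) E} (hh : (r : ℕ∞) ≤ h.order) :
    h ∈ truncSubring A r := fun d hd => by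
  rw [coeff_of_lt_order (lt_of_lt_of_le (by exact_mod_cast hd) hh)]
  exact A.zero_mem

lemma C_mem {r : ℕ} {a : E} (ha : a ∈ A) : C a ∈ truncSubring A r := fun d _ => by
  classical
  rw [coeff_C]
  split_ifs
  exacts [ha, A.zero_mem]

lemma X_mem {r : ℕ} (i : Fin 2) : (X i : MvPowerSeries (Fin 2) E) ∈ truncSubring A r :=
  fun d _ => by
  classical
  rw [coeff_X]
  split_ifs
  exacts [A.one_mem, A.zero_mem]

/-- Apply `σ` to the coefficients and substitute the squares of the variables. -/
noncomputable def frobLift (σ : E →+* E) :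
    MvPowerSeries (Fin 2) E →+* MvPowerSeries (Fin 2) E :=
  (expand 2 two_ne_zero).toRingHom.comp (MvPowerSeries.map σ)

variable {σ : E →+* E}

lemma frobLift_apply (h : MvPowerSeries (Fin 2) E) :
    frobLift σ h = expand 2 two_ne_zero (MvPowerSeries.map σ h) := rfl

lemma le_order_map {h : MvPowerSeries (Fin 2) E} {r : ℕ∞} (hh : r ≤ h.order) :
    r ≤ (MvPowerSeries.map σ h).order :=
  le_order fun d hd => by
    rw [coeff_map, coeff_of_lt_order (lt_of_lt_of_le hd hh), map_zero]

lemma le_order_frobLift {h : MvPowerSeries (Fin 2) E} {r : ℕ} (hh : (r : ℕ∞) ≤ h.order) :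
    ((2 * r : ℕ) : ℕ∞) ≤ (frobLift σ h).order := by
  rw [frobLift_apply, order_expand]
  have := le_order_map (σ := σ) hh
  rw [nsmul_eq_mul]
  push_cast
  gcongr

lemma le_order_frobLift_pow (a : ℕ) {h : MvPowerSeries (Fin 2) E} {r : ℕ}
    (hh : (r : ℕ∞) ≤ h.order) :
    ((2 ^ a * r : ℕ) : ℕ∞) ≤ ((frobLift σ ^ a) h).order := by
  induction a with
  | zero => simpa using hh
  | succ a ih =>
    rw [pow_succ' (frobLift σ), RingHom.mul_def, RingHom.comp_apply, pow_succ', mul_assoc]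
    exact le_order_frobLift ih

lemma frobLift_C (c : E) : frobLift σ (C c) = C (σ c) := by
  rw [frobLift_apply, map_C, expand_C]

lemma frobLift_pow_C (a : ℕ) (c : E) : (frobLift σ ^ a) (C c) = C ((σ ^ a) c) := by
  induction a with
  | zero => rfl
  | succ a ih => rw [pow_succ', RingHom.mul_def, RingHom.comp_apply, ih, frobLift_C, pow_succ' σ]; rfl

lemma constantCoeff_frobLift {h : MvPowerSeries (Fin 2) E} (hh : constantCoeff h = 0) :
    constantCoeff (frobLift σ h) = 0 := by
  rw [frobLift_apply, constantCoeff_expand, constantCoeff_map, hh, map_zero]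

lemma constantCoeff_frobLift_pow (a : ℕ) {h : MvPowerSeries (Fin 2) E}
    (hh : constantCoeff h = 0) : constantCoeff ((frobLift σ ^ a) h) = 0 := by
  induction a with
  | zero => exact hh
  | succ a ih => rw [pow_succ', RingHom.mul_def, RingHom.comp_apply, constantCoeff_frobLift ih]

lemma sigma_mem (hσ : ∀ a ∈ A, ∃ b ∈ A, σ a = a ^ 2 + 2 * b)
    {a : E} (ha : a ∈ A) : σ a ∈ A := by
  obtain ⟨b, hb, h⟩ := hσ a ha
  rw [h]
  exact A.add_mem (A.pow_mem ha 2) (A.mul_mem (ofNat_mem A 2) hb)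

lemma sigma_pow_mem (hσ : ∀ a ∈ A, ∃ b ∈ A, σ a = a ^ 2 + 2 * b)
    (i : ℕ) {a : E} (ha : a ∈ A) : (σ ^ i) a ∈ A := by
  induction i with
  | zero => exact ha
  | succ i ih => rw [pow_succ']; exact sigma_mem hσ ih

lemma frobLift_mem (hσ : ∀ a ∈ A, ∃ b ∈ A, σ a = a ^ 2 + 2 * b)
    {r : ℕ} {h : MvPowerSeries (Fin 2) E} (hh : h ∈ truncSubring A r) :
    frobLift σ h ∈ truncSubring A (2 * r) := by
  intro d hd
  rw [frobLift_apply]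
  by_cases hdv : ∀ i, 2 ∣ d i
  · obtain ⟨e, rfl⟩ : ∃ e : Fin 2 →₀ ℕ, 2 • e = d :=
      ⟨d.mapRange (fun a ↦ a / 2) (by simp), by ext i; simp [(Nat.mul_div_cancel' (hdv i))]⟩
    rw [coeff_expand_smul, coeff_map]
    refine sigma_mem hσ (hh e ?_)
    rw [map_nsmul, smul_eq_mul] at hd
    omega
  · push Not at hdv
    obtain ⟨i, hi⟩ := hdv
    rw [coeff_expand_of_not_dvd _ _ _ hi]
    exact A.zero_mem

lemma sq_eq_frobLift_add (hσ : ∀ a ∈ A, ∃ b ∈ A, σ a = a ^ 2 + 2 * b)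
    {u : E} (hu : 2 * u = 1) {r : ℕ} (hr : 1 ≤ r)
    {h : MvPowerSeries (Fin 2) E} (hh : h ∈ truncSubring A r) (h0 : constantCoeff h = 0) :
    ∃ c ∈ truncSubring A (r + 1), h ^ 2 = frobLift σ h + 2 * c := by
  classical
  -- finite sums of integral monomials
  have key : ∀ S : Finset (Fin 2 →₀ ℕ), (∀ d ∈ S, coeff d h ∈ A) →
      ∃ c ∈ truncSubring A (r + 1), (∑ d ∈ S, monomial d (coeff d h)) ^ 2
        = frobLift σ (∑ d ∈ S, monomial d (coeff d h)) + 2 * c := by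
    have hmon : ∀ (d : Fin 2 →₀ ℕ) (a : E) (s : ℕ), a ∈ A →
        (monomial d a : MvPowerSeries (Fin 2) E) ∈ truncSubring A s := by
      intro d a s ha e _
      rw [coeff_monomial]
      split_ifs
      exacts [ha, A.zero_mem]
    intro S
    induction S using Finset.induction_on with
    | empty => intro _; exact ⟨0, zero_mem _, by simp⟩
    | insert d S hd ih =>
      intro hS
      obtain ⟨c, hc, e⟩ := ih fun d hd => hS d (mem_insert_of_mem hd)
      obtain ⟨b, hb, eb⟩ := hσ _ (hS d (mem_insert_self _ _))
      refine ⟨c - monomial (2 • d) b + monomial d (coeff d h) * ∑ d ∈ S, monomial d (coeff d h),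
        add_mem (sub_mem hc (hmon _ _ _ hb)) (mul_mem (hmon _ _ _ (hS d (mem_insert_self _ _)))
          (sum_mem fun e he => hmon _ _ _ (hS e (mem_insert_of_mem he)))), ?_⟩
      rw [sum_insert hd, map_add, add_sq, e, frobLift_apply (monomial d _), map_monomial,
        expand_monomial, eb, map_add]
      have h1 : (monomial d (coeff d h) : MvPowerSeries (Fin 2) E) ^ 2
          = monomial (2 • d) (coeff d h ^ 2) := by
        rw [sq, monomial_mul_monomial, sq, two_smul]
      have h2 : (monomial (2 • d) (2 * b) : MvPowerSeries (Fin 2) E)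
          = 2 * monomial (2 • d) b := by
        rw [two_mul, map_add, two_mul]
      rw [h1, h2]
      ring
  have hfin : {d : Fin 2 →₀ ℕ | d.degree < r}.Finite := by
    refine (Set.finite_Iic (Finsupp.equivFunOnFinite.symm fun _ : Fin 2 => r)).subset ?_
    intro d hd i
    have : d i ≤ d.degree := Finsupp.le_degree i d
    simp only [Set.mem_ofPred_eq] at hd
    simp
    omega
  set G : MvPowerSeries (Fin 2) E := ∑ d ∈ hfin.toFinset, monomial d (coeff d h) with hG
  have hGc : ∀ d : Fin 2 →₀ ℕ, d.degree < r → coeff d G = coeff d h := by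
    intro d hd
    rw [hG, map_sum, sum_eq_single d]
    · simp
    · intro b _ hb
      rw [coeff_monomial, if_neg hb.symm]
    · intro hd'
      simp [hd] at hd'
  obtain ⟨c, hc, e⟩ := key hfin.toFinset (fun d hd => hh d (by simpa using hd))
  rw [← hG] at e
  have hH : (r : ℕ∞) ≤ (h - G).order := le_order fun d hd => by
    rw [map_sub, hGc d (by exact_mod_cast hd), sub_self]
  have hG0 : constantCoeff G = 0 := by
    rw [← coeff_zero_eq_constantCoeff_apply, hGc 0 (by simp; omega),
      coeff_zero_eq_constantCoeff_apply, h0]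
  have h1 : ((r + 1 : ℕ) : ℕ∞) ≤ ((h + G) * (h - G)).order := by
    refine le_trans ?_ le_order_mul
    have : (1 : ℕ∞) ≤ (h + G).order := by
      rw [one_le_order_iff_constCoeff_eq_zero, map_add, h0, hG0, add_zero]
    push_cast
    rw [add_comm]
    exact add_le_add this hH
  have h2 : ((r + 1 : ℕ) : ℕ∞) ≤ (frobLift σ (h - G)).order :=
    le_trans (by exact_mod_cast (by omega : r + 1 ≤ 2 * r)) (le_order_frobLift hH)
  have h3 : ((r + 1 : ℕ) : ℕ∞) ≤ (C u * ((h + G) * (h - G) - frobLift σ (h - G))).order := by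
    refine le_trans (le_trans ?_ le_order_mul) le_rfl
    refine le_trans ?_ (le_add_of_nonneg_left zero_le)
    exact le_order fun d hd => by
      rw [map_sub, coeff_of_lt_order (lt_of_lt_of_le hd h1),
        coeff_of_lt_order (lt_of_lt_of_le hd h2), sub_zero]
  refine ⟨c + C u * ((h + G) * (h - G) - frobLift σ (h - G)),
    add_mem hc (mem_of_le_order h3), ?_⟩
  have hu' : (2 : MvPowerSeries (Fin 2) E) * C u = 1 := by
    have := congrArg (C (σ := Fin 2)) hu
    rwa [map_mul, map_ofNat, map_one] at this
  rw [map_sub]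
  linear_combination e + ((h + G) * (h - G) - (frobLift σ h - frobLift σ G)) * (-hu')

lemma pow_sub_frobLift (hσ : ∀ a ∈ A, ∃ b ∈ A, σ a = a ^ 2 + 2 * b)
    {u : E} (hu : 2 * u = 1) {r : ℕ} (hr : 1 ≤ r)
    {h : MvPowerSeries (Fin 2) E} (hh : h ∈ truncSubring A r) (h0 : constantCoeff h = 0) (a : ℕ) :
    (frobLift σ ^ (a + 1)) h ∈ truncSubring A (r + 1) ∧ ∃ c ∈ truncSubring A (r + 1),
      h ^ 2 ^ (a + 1) = (frobLift σ ^ (a + 1)) h + 2 * c := by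
  induction a with
  | zero =>
    refine ⟨?_, ?_⟩
    · rw [zero_add, pow_one]
      exact truncSubring_anti (by omega) (frobLift_mem hσ hh)
    · simpa using sq_eq_frobLift_add hσ hu hr hh h0
  | succ a ih =>
    obtain ⟨hm, c, hc, e⟩ := ih
    refine ⟨?_, ?_⟩
    · rw [pow_succ', RingHom.mul_def, RingHom.comp_apply]
      exact truncSubring_anti (by omega) (frobLift_mem hσ hm)
    · obtain ⟨c', hc', e'⟩ := sq_eq_frobLift_add hσ hu (by omega : 1 ≤ r + 1) hm
        (constantCoeff_frobLift_pow (a + 1) h0)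
      refine ⟨c' + 2 * c * (frobLift σ ^ (a + 1)) h + 2 * c ^ 2, ?_, ?_⟩
      · have h2 : (2 : MvPowerSeries (Fin 2) E) ∈ truncSubring A (r + 1) := ofNat_mem _ 2
        exact add_mem (add_mem (truncSubring_anti (by omega) hc')
          (mul_mem (mul_mem h2 hc) hm)) (mul_mem h2 (pow_mem hc 2))
      · rw [pow_succ 2 (a + 1), pow_mul, e, pow_succ' (frobLift σ) (a + 1), RingHom.mul_def,
          RingHom.comp_apply]
        linear_combination e'

/-- The univariate power series `∑ ℓ k • x ^ (2 ^ k)`. -/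
noncomputable def typicalSeries (l : ℕ → E) : PowerSeries E :=
  PowerSeries.mk fun d => if 2 ^ Nat.log 2 d = d then l (Nat.log 2 d) else 0

lemma le_order_subst_typicalSeries (l : ℕ → E) (K : ℕ) {h : MvPowerSeries (Fin 2) E}
    (h0 : constantCoeff h = 0) :
    ((2 ^ K : ℕ) : ℕ∞) ≤
      ((typicalSeries l).subst h - ∑ k ∈ range K, C (l k) * h ^ 2 ^ k).order := by
  have hs : PowerSeries.HasSubst h := PowerSeries.HasSubst.of_constantCoeff_zero h0
  obtain ⟨g, hg⟩ : (PowerSeries.X : PowerSeries E) ^ 2 ^ K ∣ typicalSeries l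
      - ∑ k ∈ range K, PowerSeries.C (l k) * PowerSeries.X ^ 2 ^ k := by
    rw [PowerSeries.X_pow_dvd_iff]
    intro d hd
    rw [map_sub, map_sum, typicalSeries, PowerSeries.coeff_mk]
    simp only [PowerSeries.coeff_C_mul, PowerSeries.coeff_X_pow, mul_ite, mul_one, mul_zero]
    split_ifs with h1
    · rw [sum_eq_single (Nat.log 2 d), if_pos h1.symm, sub_self]
      · intro b _ hb
        rw [if_neg]
        rintro rfl
        exact hb (by rw [Nat.log_pow one_lt_two])
      · intro hk
        rw [← h1] at hd
        exact absurd ((Nat.pow_lt_pow_iff_right one_lt_two).1 hd) (by simpa using hk)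
    · rw [sum_eq_zero, sub_zero]
      intro b _
      rw [if_neg]
      rintro rfl
      exact h1 (by rw [Nat.log_pow one_lt_two])
  have e : (typicalSeries l).subst h - ∑ k ∈ range K, C (l k) * h ^ 2 ^ k
      = h ^ 2 ^ K * g.subst h := by
    have := congrArg (PowerSeries.substAlgHom hs) hg
    simp only [map_sub, map_sum, map_mul, map_pow, PowerSeries.coe_substAlgHom,
      PowerSeries.subst_X hs] at this
    rw [← this]
    congr 1
    refine sum_congr rfl fun k _ => ?_
    rw [PowerSeries.subst_C]
  rw [e]
  refine le_trans ?_ le_order_mul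
  refine le_trans ?_ (le_add_of_nonneg_right zero_le)
  refine le_trans ?_ (le_order_pow (2 ^ K))
  have h1 : (1 : ℕ∞) ≤ h.order := by rwa [one_le_order_iff_constCoeff_eq_zero]
  rw [nsmul_eq_mul]
  calc ((2 ^ K : ℕ) : ℕ∞) = ((2 ^ K : ℕ) : ℕ∞) * 1 := (mul_one _).symm
    _ ≤ _ := by gcongr

lemma funEq_aux (hσ : ∀ a ∈ A, ∃ b ∈ A, σ a = a ^ 2 + 2 * b) {u : E} (hu : 2 * u = 1)
    {l s q : ℕ → E} (hs : ∀ a, 2 * s a ∈ A) (hl : ∀ k, 2 ^ k * l k ∈ A)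
    (hFE : ∀ k, ∑ p ∈ antidiagonal k, s p.1 * (σ ^ p.1) (l p.2) = q k)
    {r K : ℕ} (hr : 1 ≤ r) (hK : r + 1 ≤ 2 ^ K)
    {h : MvPowerSeries (Fin 2) E} (hh : h ∈ truncSubring A r) (h0 : constantCoeff h = 0) :
    ∑ k ∈ range K, C (q k) * h ^ 2 ^ k
      - ∑ a ∈ range K, C (s a) * (frobLift σ ^ a) ((typicalSeries l).subst h)
      ∈ truncSubring A (r + 1) := by
  have e1 : ∑ k ∈ range K, C (q k) * h ^ 2 ^ k
      = ∑ a ∈ range K, ∑ b ∈ range (K - a),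
        C (s a * (σ ^ a) (l b)) * (h ^ 2 ^ a) ^ 2 ^ b := by
    rw [← sum_range_diag_flip K fun a b => C (s a * (σ ^ a) (l b)) * (h ^ 2 ^ a) ^ 2 ^ b]
    refine sum_congr rfl fun k _ => ?_
    rw [← hFE k, map_sum, sum_mul, Finset.Nat.sum_antidiagonal_eq_sum_range_succ_mk]
    refine sum_congr rfl fun a ha => ?_
    have : a ≤ k := by simpa [Nat.lt_succ_iff] using ha
    rw [← pow_mul, ← pow_add, Nat.add_sub_cancel' this]
  rw [e1, ← sum_sub_distrib]
  refine sum_mem fun a ha => ?_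
  have haK : a < K := by simpa using ha
  have e2 : ∑ b ∈ range (K - a), C (s a * (σ ^ a) (l b)) * (h ^ 2 ^ a) ^ 2 ^ b
      - C (s a) * (frobLift σ ^ a) ((typicalSeries l).subst h)
      = ∑ b ∈ range (K - a), C (s a * (σ ^ a) (l b)) *
          ((h ^ 2 ^ a) ^ 2 ^ b - ((frobLift σ ^ a) h) ^ 2 ^ b)
        - C (s a) * (frobLift σ ^ a) ((typicalSeries l).subst h
          - ∑ b ∈ range (K - a), C (l b) * h ^ 2 ^ b) := by
    simp only [map_sub, map_sum, map_mul, map_pow, frobLift_pow_C, mul_sub, sum_sub_distrib,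
      mul_sum, mul_assoc]
    ring
  rw [e2]
  refine sub_mem (sum_mem fun b _ => ?_) (mem_of_le_order ?_)
  · rcases a with _ | a
    · simp
    · obtain ⟨hm, c, hc, e⟩ := pow_sub_frobLift hσ hu hr hh h0 a
      have hm' : h ^ 2 ^ (a + 1) ∈ truncSubring A (r + 1) := by
        rw [e]; exact add_mem hm (mul_mem (ofNat_mem _ 2) hc)
      have hd : ((2 : ℕ) : truncSubring A (r + 1)) ∣ (⟨_, hm'⟩ : truncSubring A (r + 1)) - ⟨_, hm⟩ :=
        ⟨⟨c, hc⟩, Subtype.ext (by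
          change h ^ 2 ^ (a + 1) - _ = (((2 : ℕ) : MvPowerSeries (Fin 2) E)) * c
          rw [e, Nat.cast_ofNat, add_sub_cancel_left])⟩
      obtain ⟨⟨c', hc'⟩, e'⟩ := dvd_sub_pow_of_dvd_sub hd b
      have e'' : (h ^ 2 ^ (a + 1)) ^ 2 ^ b - ((frobLift σ ^ (a + 1)) h) ^ 2 ^ b
          = 2 ^ (b + 1) * c' := by
        have e3 := congrArg Subtype.val e'
        change _ = (((2 : ℕ) : MvPowerSeries (Fin 2) E)) ^ (b + 1) * c' at e3
        rw [Nat.cast_ofNat] at e3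
        exact e3
      have hc2 : (2 : MvPowerSeries (Fin 2) E) ^ (b + 1) = C (2 ^ (b + 1)) := by
        rw [map_pow, map_ofNat]
      rw [e'', hc2, ← mul_assoc, ← map_mul]
      refine mul_mem (C_mem ?_) hc'
      have : s (a + 1) * (σ ^ (a + 1)) (l b) * 2 ^ (b + 1)
          = (2 * s (a + 1)) * (σ ^ (a + 1)) (2 ^ b * l b) := by
        rw [map_mul, map_pow, map_ofNat]; ring
      rw [this]
      exact A.mul_mem (hs _) (sigma_pow_mem hσ _ (hl b))
  · refine le_trans ?_ le_order_mul
    refine le_trans ?_ (le_add_of_nonneg_left zero_le)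
    refine le_trans ?_ (le_order_frobLift_pow a (le_order_subst_typicalSeries l (K - a) h0))
    rw [← pow_add, Nat.add_sub_cancel' haK.le]
    exact_mod_cast hK

lemma coeff_mem_of_funEq (hσ : ∀ a ∈ A, ∃ b ∈ A, σ a = a ^ 2 + 2 * b) {u : E} (hu : 2 * u = 1)
    {l s q : ℕ → E} (hs : ∀ a, 2 * s a ∈ A) (hl : ∀ k, 2 ^ k * l k ∈ A)
    (hFE : ∀ k, ∑ p ∈ antidiagonal k, s p.1 * (σ ^ p.1) (l p.2) = q k)
    (hq : ∀ k, q k ∈ A) (hq0 : q 0 = 1)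
    {F : MvPowerSeries (Fin 2) E} (h0 : constantCoeff F = 0)
    (hF : (typicalSeries l).subst F = (typicalSeries l).subst (X 0 : MvPowerSeries (Fin 2) E)
      + (typicalSeries l).subst (X 1 : MvPowerSeries (Fin 2) E)) (d : Fin 2 →₀ ℕ) :
    coeff d F ∈ A := by
  have main : ∀ r, F ∈ truncSubring A (r + 1) := by
    intro r
    induction r with
    | zero =>
      intro d hd
      have : d = 0 := by
        rw [← Finsupp.degree_eq_zero_iff]; omega
      rw [this, coeff_zero_eq_constantCoeff_apply, h0]
      exact A.zero_mem
    | succ r ih =>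
      obtain ⟨K, hK⟩ : ∃ K, r + 1 + 1 ≤ 2 ^ (K + 1) :=
        ⟨r + 1, (Nat.lt_two_pow_self (n := r + 1 + 1)).le⟩
      have hX : ∀ i, ∑ k ∈ range (K + 1), C (q k) * (X i : MvPowerSeries (Fin 2) E) ^ 2 ^ k
          ∈ truncSubring A (r + 1 + 1) := fun i =>
        sum_mem fun k _ => mul_mem (C_mem (hq k)) (pow_mem (X_mem i) _)
      have a0 := sub_mem (hX 0) (funEq_aux hσ hu hs hl hFE (by omega) hK (X_mem 0)
        (constantCoeff_X 0))
      have a1 := sub_mem (hX 1) (funEq_aux hσ hu hs hl hFE (by omega) hK (X_mem 1)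
        (constantCoeff_X 1))
      have a2 := funEq_aux hσ hu hs hl hFE (by omega) hK ih h0
      rw [sub_sub_cancel] at a0 a1
      have a3 := add_mem a2 (add_mem a0 a1)
      rw [hF] at a3
      simp only [map_add, mul_add, sum_add_distrib, sub_add_cancel] at a3
      rw [sum_range_succ'] at a3
      have a4 : ∑ k ∈ range K, C (q (k + 1)) * F ^ 2 ^ (k + 1) ∈ truncSubring A (r + 1 + 1) := by
        refine sum_mem fun k _ => mul_mem (C_mem (hq _)) ?_
        obtain ⟨hm, c, hc, e⟩ := pow_sub_frobLift hσ hu (by omega) ih h0 k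
        rw [e]
        exact add_mem hm (mul_mem (ofNat_mem _ 2) hc)
      have a5 := sub_mem a3 a4
      rw [add_sub_cancel_left, hq0] at a5
      simpa using a5
  exact main d.degree d (by omega)

end FE

/-! ### Twisted convolution of sequences -/

section Twisted
variable {E : Type*} [CommRing E] (σ : E →+* E)

/-- The product of `∑ a i T ^ i` and `∑ b j T ^ j`, where `T c = σ c T`. -/
def twMul (a b : ℕ → E) (k : ℕ) : E := ∑ p ∈ antidiagonal k, a p.1 * (σ ^ p.1) (b p.2)

lemma twMul_assoc (a b c : ℕ → E) : twMul σ (twMul σ a b) c = twMul σ a (twMul σ b c) := by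
  funext k
  simp only [twMul, sum_mul, map_sum, mul_sum]
  rw [Finset.sum_sigma', Finset.sum_sigma']
  refine Finset.sum_nbij' (fun x => ⟨(x.2.1, x.2.2 + x.1.2), (x.2.2, x.1.2)⟩)
    (fun x => ⟨(x.1.1 + x.2.1, x.2.2), (x.1.1, x.2.1)⟩) ?_ ?_ ?_ ?_ ?_
  · rintro ⟨⟨i, j⟩, ⟨i', j'⟩⟩ h
    simp only [mem_sigma, HasAntidiagonal.mem_antidiagonal] at h ⊢
    obtain ⟨h1, h2⟩ := h
    constructor
    · omega
    · trivial
  · rintro ⟨⟨i, j⟩, ⟨i', j'⟩⟩ h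
    simp only [mem_sigma, HasAntidiagonal.mem_antidiagonal] at h ⊢
    obtain ⟨h1, h2⟩ := h
    constructor
    · omega
    · trivial
  · rintro ⟨⟨i, j⟩, ⟨i', j'⟩⟩ h
    simp only [mem_sigma, HasAntidiagonal.mem_antidiagonal] at h
    obtain ⟨h1, h2⟩ := h
    subst h2
    rfl
  · rintro ⟨⟨i, j⟩, ⟨i', j'⟩⟩ h
    simp only [mem_sigma, HasAntidiagonal.mem_antidiagonal] at h
    obtain ⟨h1, h2⟩ := h
    subst h2
    rfl
  · rintro ⟨⟨i, j⟩, ⟨i', j'⟩⟩ h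
    simp only [mem_sigma, HasAntidiagonal.mem_antidiagonal] at h
    obtain ⟨h1, h2⟩ := h
    subst h2
    simp only [map_mul, mul_assoc, pow_add, RingHom.mul_def, RingHom.comp_apply]

lemma twMul_zero_apply (a b : ℕ → E) : twMul σ a b 0 = a 0 * b 0 := by
  simp [twMul]

/-- The unit for `twMul`. -/
def twOne : ℕ → E := fun k => if k = 0 then 1 else 0

lemma twMul_one (a : ℕ → E) : twMul σ a twOne = a := by
  funext k
  rw [twMul, sum_eq_single (k, 0)]
  · simp [twOne]
  · rintro ⟨i, j⟩ h hne
    have : j ≠ 0 := by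
      rintro rfl
      simp only [HasAntidiagonal.mem_antidiagonal, add_zero] at h
      exact hne (by rw [h])
    simp [twOne, this]
  · intro h; simp at h

lemma one_twMul (a : ℕ → E) : twMul σ twOne a = a := by
  funext k
  rw [twMul, sum_eq_single (0, k)]
  · simp [twOne]
  · rintro ⟨i, j⟩ h hne
    have : i ≠ 0 := by
      rintro rfl
      simp only [HasAntidiagonal.mem_antidiagonal, zero_add] at h
      exact hne (by rw [h])
    simp [twOne, this]
  · intro h; simp at h

lemma twMul_right_cancel {w x y : ℕ → E} (hw : w 0 = 1) (h : twMul σ x w = twMul σ y w) :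
    x = y := by
  funext k
  induction k using Nat.strong_induction_on with
  | _ k ih =>
    have hk := congrFun h k
    simp only [twMul] at hk
    rw [← Finset.sum_erase_add _ _ (show (k, 0) ∈ antidiagonal k by simp),
      ← Finset.sum_erase_add (a := (k, 0)) _ _ (show (k, 0) ∈ antidiagonal k by simp)] at hk
    have e : ∑ p ∈ (antidiagonal k).erase (k, 0), x p.1 * (σ ^ p.1) (w p.2)
        = ∑ p ∈ (antidiagonal k).erase (k, 0), y p.1 * (σ ^ p.1) (w p.2) := by
      refine sum_congr rfl fun p hp => ?_
      obtain ⟨hne, hp⟩ := mem_erase.1 hp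
      rw [HasAntidiagonal.mem_antidiagonal] at hp
      have : p.1 < k := by
        rcases Nat.lt_or_ge p.1 k with h | h
        · exact h
        · exact absurd (Prod.ext (by simp; omega) (by simp; omega)) hne
      rw [ih _ this]
    rw [e, add_left_cancel_iff] at hk
    simpa [hw] using hk

/-- If `λ + λ q = 2 q` with `q` integral of constant term one and `w = (1 + q) / 2`, then
`w λ = q`, and the denominators of `λ` are bounded. -/
lemma twMul_funEq {A : Subring E} (hA : ∀ a ∈ A, ∀ i, (σ ^ i) a ∈ A) {u : E} (hu : 2 * u = 1)
    {l q : ℕ → E} (hq : ∀ k, q k ∈ A) (hq0 : q 0 = 1)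
    (h : ∀ k, l k + twMul σ l q k = 2 * q k) :
    ∃ s : ℕ → E, (∀ a, 2 * s a ∈ A) ∧ (∀ k, twMul σ s l k = q k) ∧ ∀ k, 2 ^ k * l k ∈ A := by
  have hu1 : ∀ x y : E, 2 * x = 2 * y → x = y := fun x y hxy => by
    linear_combination u * hxy - (x - y) * hu
  have hσu : ∀ i, (σ ^ i) u = u := fun i => hu1 _ _ (by
    rw [hu, ← map_ofNat (σ ^ i) 2, ← map_mul, hu, map_one])
  set s : ℕ → E := fun k => u * (twOne k + q k) with hs
  have hs0 : s 0 = 1 := by simp only [hs, twOne, hq0, if_true]; linear_combination hu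
  have hsq : ∀ k, q k = 2 * s k - twOne k := fun k => by
    simp only [hs]; linear_combination (- (twOne k + q k)) * hu
  have hlin : ∀ (x : ℕ → E) k, twMul σ x q k = 2 * twMul σ x s k - x k := fun x k => by
    conv_rhs => rw [← congrFun (twMul_one σ x) k]
    simp only [twMul, mul_sum, ← sum_sub_distrib]
    refine sum_congr rfl fun p _ => ?_
    rw [hsq p.2, map_sub, map_mul, map_ofNat]; ring
  have hlin' : ∀ (x : ℕ → E) k, twMul σ q x k = 2 * twMul σ s x k - x k := fun x k => by
    conv_rhs => rw [← congrFun (one_twMul σ x) k, one_twMul]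
    conv_rhs => rw [← congrFun (one_twMul σ x) k]
    simp only [twMul, mul_sum, ← sum_sub_distrib]
    refine sum_congr rfl fun p _ => ?_
    rw [hsq p.1]; ring
  have hls : twMul σ l s = q := by
    funext k
    refine hu1 _ _ ?_
    linear_combination h k - hlin l k
  have hsl : twMul σ s l = q := by
    refine twMul_right_cancel σ hs0 ?_
    rw [twMul_assoc, hls]
    funext k
    rw [hlin s k, hlin' s k]
  have hs2 : ∀ a, 2 * s a ∈ A := fun a => by
    have : 2 * s a = twOne a + q a := by rw [hsq a]; ring
    rw [this, twOne]
    split_ifs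
    exacts [A.add_mem A.one_mem (hq a), A.add_mem A.zero_mem (hq a)]
  refine ⟨s, hs2, fun k => congrFun hsl k, fun k => ?_⟩
  induction k using Nat.strong_induction_on with
  | _ k ih =>
    have hk := congrFun hsl k
    rw [twMul, ← Finset.sum_erase_add _ _ (show (0, k) ∈ antidiagonal k by simp)] at hk
    have e : 2 ^ k * l k = 2 ^ k * q k
        - ∑ p ∈ (antidiagonal k).erase (0, k), 2 ^ k * (s p.1 * (σ ^ p.1) (l p.2)) := by
      rw [← mul_sum, ← hk, hs0]
      simp
      ring
    rw [e]
    refine A.sub_mem (A.mul_mem (A.pow_mem (ofNat_mem A 2) k) (hq k)) (sum_mem fun p hp => ?_)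
    obtain ⟨hne, hp⟩ := mem_erase.1 hp
    rw [HasAntidiagonal.mem_antidiagonal] at hp
    have h1 : p.1 ≠ 0 := fun h => hne (Prod.ext h (by simp; omega))
    obtain ⟨i, hi⟩ := Nat.exists_eq_succ_of_ne_zero h1
    have hki : k = i + 1 + p.2 := by omega
    have : (2 : E) ^ k * (s p.1 * (σ ^ p.1) (l p.2))
        = 2 ^ i * ((2 * s p.1) * (σ ^ p.1) (2 ^ p.2 * l p.2)) := by
      rw [map_mul, map_pow, map_ofNat, hki]; ring
    rw [this]
    exact A.mul_mem (A.pow_mem (ofNat_mem A 2) i)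
      (A.mul_mem (hs2 _) (hA _ (ih _ (by omega)) _))

end Twisted

/-! ### The formal group law with a given logarithm -/

section Log
variable {R E : Type*} [CommRing R] [CommRing E]

lemma coeff_one_typicalSeries (l : ℕ → E) : (typicalSeries l).coeff 1 = l 0 := by
  simp [typicalSeries]

lemma constantCoeff_typicalSeries (l : ℕ → E) : (typicalSeries l).constantCoeff = 0 := by
  rw [← PowerSeries.coeff_zero_eq_constantCoeff_apply, typicalSeries, PowerSeries.coeff_mk,
    if_neg]
  simp

/-- `f` is a logarithm of `F` after extension of scalars along `φ`:
`f (F (x, y)) = f x + f y`. -/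
def IsLog (φ : R →+* E) (F : FormalGroup R) (f : PowerSeries E) : Prop :=
  f.subst (F.map φ).toPowerSeries = f.subst (X 0 : MvPowerSeries (Fin 2) E)
    + f.subst (X 1 : MvPowerSeries (Fin 2) E)

lemma subst_injective_of_log {τ : Type*} {f : PowerSeries E} (hf0 : f.constantCoeff = 0)
    (hf1 : f.coeff 1 = 1) {a b : MvPowerSeries τ E} (ha : constantCoeff a = 0)
    (hb : constantCoeff b = 0) (h : f.subst a = f.subst b) : a = b := by
  let _ : Invertible (f.coeff 1) := hf1 ▸ invertibleOne
  have hf : PowerSeries.HasSubst f := PowerSeries.HasSubst.of_constantCoeff_zero' hf0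
  have key : ∀ c : MvPowerSeries τ E, constantCoeff c = 0 →
      (f.substInv).subst (f.subst c) = c := fun c hc => by
    have hc' := PowerSeries.HasSubst.of_constantCoeff_zero hc
    rw [← PowerSeries.subst_comp_subst_apply hf hc', PowerSeries.subst_substInv_left f hf0,
      PowerSeries.subst_X hc']
  rw [← key a ha, ← key b hb, h]

lemma exists_of_log (f : PowerSeries E) (hf0 : f.constantCoeff = 0)
    (hf1 : f.coeff 1 = 1) : ∃ F : MvPowerSeries (Fin 2) E, constantCoeff F = 0 ∧
      coeff (Finsupp.single 0 1) F = 1 ∧ coeff (Finsupp.single 1 1) F = 1 ∧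
      f.subst F = f.subst (X 0 : MvPowerSeries (Fin 2) E)
        + f.subst (X 1 : MvPowerSeries (Fin 2) E) := by
  let _ : Invertible (f.coeff 1) := hf1 ▸ invertibleOne
  set D : MvPowerSeries (Fin 2) E := f.subst (X 0 : MvPowerSeries (Fin 2) E)
        + f.subst (X 1 : MvPowerSeries (Fin 2) E) with hD
  have hXc : ∀ i : Fin 2, constantCoeff (f.subst (X i : MvPowerSeries (Fin 2) E)) = 0 :=
    fun i => PowerSeries.constantCoeff_subst_eq_zero (constantCoeff_X i) f hf0
  have hD0 : constantCoeff D = 0 := by rw [hD, map_add, hXc, hXc, add_zero]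
  have hDs := PowerSeries.HasSubst.of_constantCoeff_zero hD0
  have hg0 : f.substInv.constantCoeff = 0 := PowerSeries.constantCoeff_substInv f
  have hgs := PowerSeries.HasSubst.of_constantCoeff_zero' hg0
  have hlin : ∀ (g : PowerSeries E) (a : MvPowerSeries (Fin 2) E) (i : Fin 2),
      constantCoeff a = 0 → coeff (Finsupp.single i 1) (g.subst a)
        = g.coeff 1 * coeff (Finsupp.single i 1) a := by
    intro g a i ha
    have has := PowerSeries.HasSubst.of_constantCoeff_zero ha
    rw [PowerSeries.coeff_subst has, finsum_eq_single _ 1]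
    · simp
    · intro n hn
      rcases n with _ | _ | n
      · simp [coeff_one]
      · exact absurd rfl hn
      · rw [coeff_of_lt_order, smul_zero]
        refine lt_of_lt_of_le ?_ (le_order_pow (n + 2))
        have h1 : (1 : ℕ∞) ≤ a.order := by rwa [one_le_order_iff_constCoeff_eq_zero]
        rw [nsmul_eq_mul]
        calc _ < (((n + 2 : ℕ) : ℕ∞)) * 1 := by
                rw [mul_one, Finsupp.degree_single]; exact_mod_cast (by omega)
          _ ≤ _ := by gcongr
  have hDl : ∀ i, coeff (Finsupp.single i 1) D = 1 := by
    intro i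
    rw [hD, map_add, hlin _ _ _ (constantCoeff_X _), hlin _ _ _ (constantCoeff_X _), hf1,
      coeff_index_single_X, coeff_index_single_X]
    fin_cases i <;> simp
  have hg1 : f.substInv.coeff 1 = 1 := by
    rw [PowerSeries.coeff_one_substInv]
    exact (invOf_eq_right_inv (by rw [hf1, one_mul]))
  refine ⟨f.substInv.subst D, PowerSeries.constantCoeff_subst_eq_zero hD0 _ hg0, ?_, ?_, ?_⟩
  · rw [hlin _ _ _ hD0, hDl, hg1, one_mul]
  · rw [hlin _ _ _ hD0, hDl, hg1, one_mul]
  · rw [← PowerSeries.subst_comp_subst_apply hgs hDs, PowerSeries.subst_substInv_right f hf0,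
      PowerSeries.subst_X hDs]

lemma map_injective_of_injective {τ : Type*} {φ : R →+* E} (hφ : Function.Injective φ) :
    Function.Injective (MvPowerSeries.map (σ := τ) φ) := fun a b h => by
  ext d
  exact hφ (by simpa using congrArg (coeff d) h)

lemma existsUnique_isLog {φ : R →+* E} (hφ : Function.Injective φ) (f : PowerSeries E)
    (hf0 : f.constantCoeff = 0) (hf1 : f.coeff 1 = 1)
    (hint : ∀ F : MvPowerSeries (Fin 2) E, constantCoeff F = 0 →
      f.subst F = f.subst (X 0 : MvPowerSeries (Fin 2) E)
        + f.subst (X 1 : MvPowerSeries (Fin 2) E) → ∀ d, coeff d F ∈ φ.range) :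
    ∃! F : FormalGroup R, IsLog φ F f := by
  obtain ⟨F, h0, hX, hY, hF⟩ := exists_of_log f hf0 hf1
  choose c hc using hint F h0 hF
  set G : MvPowerSeries (Fin 2) R := c with hG
  have hGF : MvPowerSeries.map φ G = F := by
    ext d
    rw [coeff_map]
    exact hc d
  have hadd : ∀ a b : MvPowerSeries (Fin 3) E, constantCoeff a = 0 → constantCoeff b = 0 →
      constantCoeff (F.subst ![a, b]) = 0 ∧
      f.subst (F.subst ![a, b]) = f.subst a + f.subst b := by
    intro a b ha hb
    have hab : HasSubst ![a, b] := hasSubst_of_constantCoeff_zero fun s => by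
      fin_cases s <;> simpa
    have hFs := PowerSeries.HasSubst.of_constantCoeff_zero h0
    have hsub : ∀ i : Fin 2, (f.subst (X i : MvPowerSeries (Fin 2) E)).subst ![a, b]
        = f.subst (![a, b] i) := fun i => by
      rw [PowerSeries.subst, subst_comp_subst_apply
        (PowerSeries.HasSubst.of_constantCoeff_zero (constantCoeff_X i)).const hab]
      simp only [subst_X hab]
      rfl
    refine ⟨constantCoeff_subst_eq_zero hab (fun s => by fin_cases s <;> simpa) h0, ?_⟩
    have h1 : f.subst (F.subst ![a, b]) = (f.subst F).subst ![a, b] := by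
      rw [PowerSeries.subst, PowerSeries.subst, subst_comp_subst_apply hFs.const hab]
    rw [h1, hF, subst_add hab, hsub, hsub]
    rfl
  have hassoc : F.subst ![F.subst ![(X 0 : MvPowerSeries (Fin 3) E), X 1], X 2]
      = F.subst ![(X 0 : MvPowerSeries (Fin 3) E), F.subst ![(X 1 : MvPowerSeries (Fin 3) E), X 2]] := by
    have c0 := constantCoeff_X (R := E) (0 : Fin 3)
    have c1 := constantCoeff_X (R := E) (1 : Fin 3)
    have c2 := constantCoeff_X (R := E) (2 : Fin 3)
    obtain ⟨a1, a2⟩ := hadd _ _ c0 c1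
    obtain ⟨b1, b2⟩ := hadd _ _ c1 c2
    obtain ⟨d1, d2⟩ := hadd _ _ a1 c2
    obtain ⟨e1, e2⟩ := hadd _ _ c0 b1
    refine subst_injective_of_log hf0 hf1 d1 e1 ?_
    rw [d2, e2, a2, b2, add_assoc]
  have hG0 : constantCoeff G = 0 := hφ (by rw [← constantCoeff_map, hGF, h0, map_zero])
  refine ⟨⟨G, hG0, hφ ?_, hφ ?_, map_injective_of_injective hφ ?_⟩, ?_, ?_⟩
  · rw [← coeff_map, hGF, hX, map_one]
  · rw [← coeff_map, hGF, hY, map_one]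
  · have hv : ∀ g₁ g₂ : MvPowerSeries (Fin 3) R,
        (fun i => MvPowerSeries.map φ (![g₁, g₂] i)) = ![g₁.map φ, g₂.map φ] := fun g₁ g₂ => by
      funext i; fin_cases i <;> rfl
    rw [map_subst (HasSubst.cons_subst_zero_left (0 : Fin 3) 1 2 hG0),
      map_subst (HasSubst.cons_subst_zero_right (0 : Fin 3) 1 2 hG0), hv, hv,
      map_subst HasSubst.X_X, map_subst HasSubst.X_X, hv, hv, hGF]
    simpa using hassoc
  · change f.subst (MvPowerSeries.map φ G) = _
    rw [hGF, hF]
  · intro F' hF'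
    have h' : constantCoeff (F'.map φ).toPowerSeries = 0 := (F'.map φ).zero_constantCoeff
    have := subst_injective_of_log hf0 hf1 h' h0 (hF'.trans hF.symm)
    refine FormalGroup.ext (map_injective_of_injective hφ ?_)
    change (F'.map φ).toPowerSeries = _
    rw [this, hGF]

end Log

/-! ### Underlying homotopy of the norm of the Real Brown-Peterson spectrum -/

instance isPrime_span_two : (Ideal.span {(2 : ℤ)}).IsPrime :=
  (Ideal.span_singleton_prime two_ne_zero).2 Int.prime_two

/-- The integers localized at the prime `2`. -/
abbrev ZLoc2 : Type := Localization.AtPrime (Ideal.span {(2 : ℤ)})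

lemma isUnit_cast_of_primeCompl (y : (Ideal.span {(2 : ℤ)}).primeCompl) :
    IsUnit (Int.castRingHom ℚ y) := by
  have h : (y : ℤ) ≠ 0 := fun h => y.2 (by rw [h]; exact Ideal.zero_mem _)
  simpa using h

/-- The inclusion of `ZLoc2` into the rational numbers. -/
noncomputable def ZLoc2.toRat : ZLoc2 →+* ℚ := IsLocalization.lift isUnit_cast_of_primeCompl

lemma ZLoc2.toRat_injective : Function.Injective ZLoc2.toRat := by
  refine (IsLocalization.lift_injective_iff _).2 fun x y => ?_
  have h : (Ideal.span {(2 : ℤ)}).primeCompl ≤ nonZeroDivisors ℤ :=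
    le_nonZeroDivisors_of_noZeroDivisors (fun h => h (Ideal.zero_mem _))
  rw [(IsLocalization.injective ZLoc2 h).eq_iff]
  simp

/-- The number `2 ^ (n - 1)` of generators in an orbit `C_{2 ^ n} ⬝ x`. -/
abbrev orb (n : ℕ) : ℕ := 2 ^ (n - 1)

lemma orb_pos (n : ℕ) : 0 < orb n := by positivity

/-- The action of the generator `γ` of `C_{2 ^ n}` on a polynomial ring on orbits of generators:
the variable `(x, i)` stands for `γ ^ i x` with `0 ≤ i < 2 ^ (n - 1)`, and
`γ (γ ^ (2 ^ (n - 1) - 1) x) = - x`. -/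
noncomputable def gammaHom (R : Type*) [CommRing R] (ι : Type*) (n : ℕ) :
    MvPolynomial (ι × Fin (orb n)) R →ₐ[R] MvPolynomial (ι × Fin (orb n)) R :=
  MvPolynomial.aeval fun p =>
    if h : p.2.val + 1 < orb n then MvPolynomial.X (p.1, ⟨p.2.val + 1, h⟩)
    else - MvPolynomial.X (p.1, ⟨0, orb_pos n⟩)

/-- The underlying homotopy ring `ℤ_(2)[C_{2 ^ n} ⬝ t_1, C_{2 ^ n} ⬝ t_2, …]` of the norm
`BP^((C_{2 ^ n}))` of the Real Brown-Peterson spectrum; the variable `(k, i)` is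
`γ ^ i t_{k + 1}`. -/
abbrev BPRing (n : ℕ) : Type := MvPolynomial (ℕ × Fin (orb n)) ZLoc2

/-- The rationalization of `BPRing n`. -/
abbrev BPRat (n : ℕ) : Type := MvPolynomial (ℕ × Fin (orb n)) ℚ

/-- The inclusion of `BPRing n` into its rationalization. -/
noncomputable def BPRing.toRat (n : ℕ) : BPRing n →+* BPRat n := MvPolynomial.map ZLoc2.toRat

/-- The generator `t_k`, with `t_0 = 1`. -/
noncomputable def tGen (n : ℕ) : ℕ → BPRat n
  | 0 => 1
  | k + 1 => MvPolynomial.X (k, ⟨0, orb_pos n⟩)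

/-- The coefficients of the logarithm `log_F (x) = ∑ ℓ_k x ^ (2 ^ k)` of the universal
`2`-typical formal group law `F` with `C_{2 ^ n}`-action. They are pinned down by
`logCoeff_eq` (which says that `ψ_γ (x) = x +_{F^γ} ∑^{F^γ} t_i x ^ (2 ^ i)` is a strict
isomorphism from `F` to `F^γ`) and `gamma_pow_logCoeff` (the subgroup `C_2` acts by `-1` on
`ℓ_k`, which has degree `2 (2 ^ k - 1)`). Together these two give
`2 ℓ_k = ∑_{s < 2 ^ (n - 1)} γ ^ s (ℓ_k - γ ℓ_k)`, which is the recursion used here. -/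
noncomputable def logCoeff (n : ℕ) : ℕ → BPRat n
  | 0 => 1
  | k + 1 => MvPolynomial.C (1 / 2) * ∑ s ∈ range (orb n), (gammaHom ℚ ℕ n ^ s)
      (∑ j : Fin (k + 1), gammaHom ℚ ℕ n (logCoeff n j) * tGen n (k + 1 - j) ^ 2 ^ (j : ℕ))

section
variable (n : ℕ)

local notation "γ" => gammaHom ℚ ℕ n

lemma gamma_pow_X (k i : ℕ) (hi : i < orb n) :
    (γ ^ i) (MvPolynomial.X (k, ⟨0, orb_pos n⟩)) = MvPolynomial.X (k, ⟨i, hi⟩) := by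
  induction i with
  | zero => rfl
  | succ i ih =>
    rw [pow_succ', AlgHom.mul_apply, ih (by omega), gammaHom, MvPolynomial.aeval_X, dif_pos]

lemma gamma_pow_orb_X (k : ℕ) : (γ ^ orb n) (MvPolynomial.X (k, ⟨0, orb_pos n⟩))
    = - MvPolynomial.X (k, ⟨0, orb_pos n⟩) := by
  have hpos := orb_pos n
  obtain ⟨N, hN⟩ : ∃ N, orb n = N + 1 := ⟨orb n - 1, by omega⟩
  have h : (γ ^ orb n) = (γ ^ (N + 1)) := congrArg (γ ^ ·) hN
  rw [h, pow_succ', AlgHom.mul_apply, gamma_pow_X n k N (by omega), gammaHom,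
    MvPolynomial.aeval_X, dif_neg (by simp only; omega)]

/-- `a_k = ∑_{j < k} γ(ℓ_j) t_{k-j} ^ (2 ^ j)`. -/
noncomputable def logDiff (k : ℕ) : BPRat n :=
  ∑ j ∈ range k, γ (logCoeff n j) * tGen n (k - j) ^ 2 ^ j

lemma logCoeff_succ (k : ℕ) : logCoeff n (k + 1)
    = MvPolynomial.C (1 / 2) * ∑ s ∈ range (orb n), (γ ^ s) (logDiff n (k + 1)) := by
  rw [logCoeff, logDiff]
  congr 1
  refine sum_congr rfl fun s _ => ?_
  rw [← Fin.sum_univ_eq_sum_range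
    (fun j => γ (logCoeff n j) * tGen n (k + 1 - j) ^ 2 ^ j) (k + 1)]

lemma gamma_pow_comm (s : ℕ) (x : BPRat n) : (γ ^ s) (γ x) = γ ((γ ^ s) x) := by
  rw [← AlgHom.mul_apply, ← AlgHom.mul_apply, ← pow_succ, ← pow_succ']

lemma gamma_pow_add (s t : ℕ) (x : BPRat n) : (γ ^ s) ((γ ^ t) x) = (γ ^ (s + t)) x := by
  rw [pow_add, AlgHom.mul_apply]

lemma gamma_pow_logDiff (k : ℕ)
    (h : ∀ j < k + 1, 1 ≤ j → (γ ^ orb n) (logCoeff n j) = - logCoeff n j) :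
    (γ ^ orb n) (logDiff n (k + 1)) = - logDiff n (k + 1) := by
  rw [logDiff, map_sum, ← sum_neg_distrib]
  refine sum_congr rfl fun j hj => ?_
  have hj' : j < k + 1 := by simpa using hj
  obtain ⟨i, hi⟩ : ∃ i, k + 1 - j = i + 1 := ⟨k - j, by omega⟩
  rw [map_mul, map_pow, gamma_pow_comm, hi, tGen, gamma_pow_orb_X]
  rcases j with _ | j
  · simp [logCoeff]
  · rw [h _ hj' (by omega), map_neg, Even.neg_pow (by simp [pow_succ])]
    ring

/-- The subgroup `C_2` of `C_{2 ^ n}` acts on `ℓ_k`, `k ≥ 1`, by the sign `-1`. -/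
lemma gamma_pow_logCoeff (k : ℕ) :
    (γ ^ orb n) (logCoeff n (k + 1)) = - logCoeff n (k + 1) := by
  induction k using Nat.strong_induction_on with
  | _ k ih =>
    have hd := gamma_pow_logDiff n k fun j hj h1 => by
      obtain ⟨i, rfl⟩ := Nat.exists_eq_succ_of_ne_zero (by omega : j ≠ 0)
      exact ih i (by omega)
    rw [logCoeff_succ, map_mul, MvPolynomial.algHom_C, map_sum, ← mul_neg, ← sum_neg_distrib]
    congr 1
    refine sum_congr rfl fun s _ => ?_
    rw [gamma_pow_add, add_comm, ← gamma_pow_add, hd, map_neg]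

lemma logCoeff_sub (k : ℕ) :
    logCoeff n (k + 1) - γ (logCoeff n (k + 1)) = logDiff n (k + 1) := by
  have hd := gamma_pow_logDiff n k fun j hj h1 => by
    obtain ⟨i, rfl⟩ := Nat.exists_eq_succ_of_ne_zero (by omega : j ≠ 0)
    exact gamma_pow_logCoeff n i
  have e : ∑ s ∈ range (orb n), ((γ ^ s) (logDiff n (k + 1)) - (γ ^ (s + 1)) (logDiff n (k + 1)))
      = 2 * logDiff n (k + 1) := by
    rw [sum_range_sub', hd, pow_zero, AlgHom.one_apply]; ring
  have h2 : (MvPolynomial.C (1 / 2 : ℚ) : BPRat n) * 2 = 1 := by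
    rw [← map_ofNat MvPolynomial.C 2, ← map_mul]; norm_num
  rw [logCoeff_succ, map_mul, MvPolynomial.algHom_C, map_sum, MvPolynomial.algebraMap_eq,
    ← mul_sub, ← sum_sub_distrib]
  have e' : ∑ s ∈ range (orb n), ((γ ^ s) (logDiff n (k + 1)) - γ ((γ ^ s) (logDiff n (k + 1))))
      = 2 * logDiff n (k + 1) := by
    rw [← e]
    refine sum_congr rfl fun s _ => ?_
    rw [pow_succ', AlgHom.mul_apply]
  rw [e', ← mul_assoc, h2, one_mul]

/-- `log_F = log_{F^γ} ∘ ψ_γ`, coefficientwise. -/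
lemma logCoeff_eq (k : ℕ) : logCoeff n k
    = ∑ p ∈ antidiagonal k, γ (logCoeff n p.1) * tGen n p.2 ^ 2 ^ p.1 := by
  rw [Finset.Nat.sum_antidiagonal_eq_sum_range_succ_mk, sum_range_succ]
  rcases k with _ | k
  · simp [logCoeff, tGen]
  · have := logCoeff_sub n k
    rw [logDiff] at this
    have ht : tGen n 0 = 1 := rfl
    rw [Nat.sub_self, ht, one_pow, mul_one]
    linear_combination this

/-- The endomorphism of the rational ring that squares every generator. -/
noncomputable def sq : BPRat n →+* BPRat n := (MvPolynomial.expand 2).toRingHom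

lemma sq_pow_X (i : ℕ) (p : ℕ × Fin (orb n)) :
    (sq n ^ i) (MvPolynomial.X p) = MvPolynomial.X p ^ 2 ^ i := by
  induction i with
  | zero => simp
  | succ i ih =>
    rw [pow_succ', RingHom.mul_def, RingHom.comp_apply, ih, map_pow]
    change MvPolynomial.expand 2 _ ^ _ = _
    rw [MvPolynomial.expand_X, ← pow_mul, pow_succ']

lemma exists_sq (x : BPRing n) : ∃ b, MvPolynomial.expand 2 x = x ^ 2 + 2 * b := by
  induction x using MvPolynomial.induction_on with
  | C a =>
    obtain ⟨c, hc⟩ : ∃ c, a = a ^ 2 + 2 * c := by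
      obtain ⟨x, s, rfl⟩ := IsLocalization.exists_mk'_eq (Ideal.span {(2 : ℤ)}).primeCompl a
      have hs : ¬ (2 : ℤ) ∣ s := fun h => s.2 (Ideal.mem_span_singleton.2 h)
      obtain ⟨y, hy⟩ : ∃ y : ℤ, x * s - x ^ 2 = 2 * y := by
        have h1 : Odd (s : ℤ) := by rwa [← Int.not_even_iff_odd, even_iff_two_dvd]
        rcases Int.even_or_odd x with h | h
        · exact (((h.mul_right _).sub (by simpa [pow_two] using h.mul_right x))).two_dvd
        · exact ((h.mul h1).sub_odd (h.pow)).two_dvd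
      refine ⟨IsLocalization.mk' ZLoc2 y (s * s), ?_⟩
      set ι := algebraMap ℤ ZLoc2
      have hu : IsUnit (ι s) := IsLocalization.map_units ZLoc2 s
      have e1 : IsLocalization.mk' ZLoc2 x s * ι s = ι x := IsLocalization.mk'_spec _ _ _
      have e2 : IsLocalization.mk' ZLoc2 y (s * s) * ι (s * s : ℤ) = ι y :=
        IsLocalization.mk'_spec ZLoc2 y (s * s)
      have e3 : ι x * ι s - ι x ^ 2 = 2 * ι y := by
        rw [← map_mul, ← map_pow, ← map_sub, hy, map_mul, map_ofNat]
      rw [map_mul] at e2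
      refine (hu.mul hu).mul_right_cancel ?_
      linear_combination (ι s - IsLocalization.mk' ZLoc2 x s * ι s - ι x) * e1 - 2 * e2 + e3
    refine ⟨MvPolynomial.C c, ?_⟩
    rw [MvPolynomial.expand_C, ← map_ofNat MvPolynomial.C 2, ← map_pow, ← map_mul, ← map_add, ← hc]
  | add p q hp hq =>
    obtain ⟨b, hb⟩ := hp
    obtain ⟨c, hc⟩ := hq
    refine ⟨b + c - p * q, ?_⟩
    rw [map_add, hb, hc]; ring
  | mul_X p i hp =>
    obtain ⟨b, hb⟩ := hp
    refine ⟨b * MvPolynomial.X i ^ 2, ?_⟩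
    rw [map_mul, hb, MvPolynomial.expand_X]; ring

lemma sq_lift (a : BPRat n) (ha : a ∈ (BPRing.toRat n).range) :
    ∃ b ∈ (BPRing.toRat n).range, sq n a = a ^ 2 + 2 * b := by
  obtain ⟨x, rfl⟩ := ha
  obtain ⟨b, hb⟩ := exists_sq n x
  refine ⟨_, ⟨b, rfl⟩, ?_⟩
  change MvPolynomial.expand 2 (MvPolynomial.map _ x) = _
  rw [← MvPolynomial.map_expand, hb, map_add, map_mul, map_pow, map_ofNat]
  rfl

/-- `γ ^ i t_k`, with `t_0 = 1`. -/
noncomputable def tConj (i : ℕ) (k : ℕ) : BPRat n := (γ ^ i) (tGen n k)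

/-- The coefficients of the product `τ_{i-1} ⋯ τ_1 τ_0`. -/
noncomputable def tProd : ℕ → ℕ → BPRat n
  | 0 => twOne
  | i + 1 => twMul (sq n) (tConj n i) (tProd i)

lemma sq_pow_tConj (i j k : ℕ) (hi : i < orb n) :
    (sq n ^ j) (tConj n i k) = tConj n i k ^ 2 ^ j := by
  rcases k with _ | k
  · simp [tConj, tGen]
  · rw [tConj, tGen, gamma_pow_X n k i hi, sq_pow_X]

lemma logCoeff_eq_twMul (i : ℕ) (hi : i ≤ orb n) :
    logCoeff n = twMul (sq n) (fun k => (γ ^ i) (logCoeff n k)) (tProd n i) := by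
  induction i with
  | zero => simp [tProd, twMul_one]
  | succ i ih =>
    have e : (fun k => (γ ^ i) (logCoeff n k))
        = twMul (sq n) (fun k => (γ ^ (i + 1)) (logCoeff n k)) (tConj n i) := by
      funext k
      conv_lhs => rw [logCoeff_eq n k]
      simp only [map_sum, map_mul, map_pow, twMul]
      refine sum_congr rfl fun p _ => ?_
      rw [sq_pow_tConj n _ _ _ (by omega), pow_succ, AlgHom.mul_apply]
      rfl
    exact (ih (by omega)).trans (by rw [e, twMul_assoc, tProd])

lemma tProd_zero (i : ℕ) : tProd n i 0 = 1 := by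
  induction i with
  | zero => rfl
  | succ i ih => rw [tProd, twMul_zero_apply, ih]; simp [tConj, tGen]

lemma tProd_mem (i k : ℕ) (hi : i ≤ orb n) : tProd n i k ∈ (BPRing.toRat n).range := by
  induction i generalizing k with
  | zero =>
    rw [tProd, twOne]
    split_ifs
    exacts [one_mem _, zero_mem _]
  | succ i ih =>
    rw [tProd, twMul]
    refine sum_mem fun p _ => mul_mem ?_ (sigma_pow_mem (sq_lift n) _ (ih _ (by omega)))
    rcases p.1 with _ | k
    · simp [tConj, tGen, one_mem]
    · rw [tConj, tGen, gamma_pow_X n k i (by omega)]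
      exact ⟨MvPolynomial.X (k, ⟨i, by omega⟩), by simp [BPRing.toRat]⟩

lemma logCoeff_add (k : ℕ) : logCoeff n k + twMul (sq n) (logCoeff n) (tProd n (orb n)) k
    = 2 * tProd n (orb n) k := by
  have h := congrFun (logCoeff_eq_twMul n (orb n) le_rfl) k
  conv_lhs => rw [h]
  simp only [twMul, ← sum_add_distrib, ← add_mul]
  rw [sum_eq_single (0, k)]
  · simp [logCoeff, one_add_one_eq_two]
  · rintro ⟨i, j⟩ hp hne
    rcases i with _ | i
    · rw [HasAntidiagonal.mem_antidiagonal] at hp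
      exact absurd (by rw [show j = k by simpa using hp]) hne
    · simp [gamma_pow_logCoeff]
  · intro h; simp at h

end

lemma BPRing.toRat_injective (n : ℕ) : Function.Injective (BPRing.toRat n) :=
  MvPolynomial.map_injective _ ZLoc2.toRat_injective

/-- There is exactly one formal group law over `ℤ_(2)[C_{2 ^ n} ⬝ t_1, …]` with logarithm
`∑ ℓ_k x ^ (2 ^ k)`. -/
theorem existsUnique_universalFGL (n : ℕ) : ∃! F : FormalGroup (BPRing n),
    IsLog (BPRing.toRat n) F (typicalSeries (logCoeff n)) := by
  have hu : (2 : BPRat n) * MvPolynomial.C (1 / 2) = 1 := by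
    rw [← map_ofNat MvPolynomial.C 2, ← map_mul]; norm_num
  obtain ⟨s, h1, h2, h3⟩ := twMul_funEq (sq n) (A := (BPRing.toRat n).range)
    (fun a ha i => sigma_pow_mem (sq_lift n) i ha) hu (fun k => tProd_mem n (orb n) k le_rfl)
    (tProd_zero n _) (logCoeff_add n)
  refine existsUnique_isLog (BPRing.toRat_injective n) _ (constantCoeff_typicalSeries _)
    (by rw [coeff_one_typicalSeries, logCoeff]) fun F h0 hF d => ?_
  exact coeff_mem_of_funEq (sq_lift n) hu h1 h3 h2 (fun k => tProd_mem n (orb n) k le_rfl)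
    (tProd_zero n _) h0 hF d

/-- The `2`-typical formal group law `F` over the underlying homotopy of `BP^((C_{2 ^ n}))`: it is
the formal group law over `ℤ_(2)[C_{2 ^ n} ⬝ t_1, …]` with logarithm `∑ ℓ_k x ^ (2 ^ k)`, the one
for which `ψ_γ (x) = x +_{F^γ} ∑^{F^γ} t_i x ^ (2 ^ i)` is a strict isomorphism from `F` to
`F^γ`, and `γ ^ (2 ^ (n - 1))` is the conjugation `F^c (x, y) = - F (- x, - y)`. -/
noncomputable def universalFGL (n : ℕ) : FormalGroup (BPRing n) :=
  (existsUnique_universalFGL n).choose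

theorem universalFGL_isLog (n : ℕ) :
    IsLog (BPRing.toRat n) (universalFGL n) (typicalSeries (logCoeff n)) :=
  (existsUnique_universalFGL n).choose_spec.1

/-! ### The rings `R_n(k, m)` and `K_n(k, m)` -/

section Residue
variable (k : Type*) [Field k] [CharP k 2] (n m : ℕ)

/-- `W(k)[C_{2 ^ n} ⬝ t_1, …, C_{2 ^ n} ⬝ t_{m - 1}, C_{2 ^ n} ⬝ u]`: the variable `(some j, i)` is
`γ ^ i t_{j + 1}` and the variable `(none, i)` is `γ ^ i u`. -/
abbrev RPoly : Type _ := MvPolynomial (Option (Fin (m - 1)) × Fin (orb n)) (WittVector 2 k)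

/-- The product of the elements of the orbit `C_{2 ^ n} ⬝ u`. -/
noncomputable def uNorm : RPoly k n m := ∏ i : Fin (orb n), MvPolynomial.X (none, i)

/-- `W(k)[C_{2 ^ n} ⬝ t_1, …, C_{2 ^ n} ⬝ t_{m - 1}, C_{2 ^ n} ⬝ u][C_{2 ^ n} ⬝ u⁻¹]`. -/
abbrev RLoc : Type _ := Localization.Away (uNorm k n m)

/-- The generator `γ ^ i t_{j + 1}` (for `x = some j`) or `γ ^ i u` (for `x = none`). -/
noncomputable def RLoc.gen (x : Option (Fin (m - 1))) (i : Fin (orb n)) : RLoc k n m :=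
  algebraMap (RPoly k n m) _ (MvPolynomial.X (x, i))

/-- The ideal `𝔪 = (C_{2 ^ n} ⬝ t_1, …, C_{2 ^ n} ⬝ t_{m - 1}, C_{2 ^ n} ⬝ (u - γ u))`, before
completion. -/
noncomputable def maxIdeal : Ideal (RLoc k n m) :=
  Ideal.map (algebraMap (RPoly k n m) (RLoc k n m)) (Ideal.span
    ({x | ∃ (i : ℕ) (j : Fin (m - 1)), x = (gammaHom (WittVector 2 k) _ n ^ i)
        (MvPolynomial.X (some j, ⟨0, orb_pos n⟩))} ∪
      {x | ∃ i : ℕ, x = (gammaHom (WittVector 2 k) _ n ^ i)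
        (MvPolynomial.X (none, ⟨0, orb_pos n⟩)
          - gammaHom (WittVector 2 k) _ n (MvPolynomial.X (none, ⟨0, orb_pos n⟩)))}))

/-- `R_n(k, m)`, the `𝔪`-adic completion of `RLoc k n m`. -/
abbrev RRing : Type _ := AdicCompletion (maxIdeal k n m) (RLoc k n m)

/-- The residue ring `K_n(k, m) = R_n(k, m) / 𝔪`, which is `k[u, u⁻¹]`. -/
abbrev KRing : Type _ :=
  RRing k n m ⧸ (maxIdeal k n m).map (algebraMap (RLoc k n m) (RRing k n m))

lemma isUnit_cast_witt (y : (Ideal.span {(2 : ℤ)}).primeCompl) :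
    IsUnit (Int.castRingHom (WittVector 2 k) y) := by
  refine WittVector.isUnit_of_coeff_zero_ne_zero _ ?_
  have h : ((WittVector.constantCoeff : WittVector 2 k →+* k) (Int.castRingHom _ (y : ℤ))) ≠ 0 := by
    rw [eq_intCast, map_intCast, Ne, CharP.intCast_eq_zero_iff k 2]
    exact fun h => y.2 (Ideal.mem_span_singleton.2 h)
  exact h

/-- The structure map from `ℤ_(2)` to the Witt vectors of `k`. -/
noncomputable def ZLoc2.toWitt : ZLoc2 →+* WittVector 2 k :=
  IsLocalization.lift (isUnit_cast_witt k)

/-- The images of the generators of `π_* BP^((C_{2 ^ n}))` in `RLoc k n m`: here `p = (a, i)`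
stands for `γ ^ i t_{a + 1}`, which goes to `γ ^ i t_{a + 1}` if `a + 1 < m`, to
`(γ ^ i u) ^ (2 ^ m - 1)` if `a + 1 = m`, and to `0` if `a + 1 > m`. -/
noncomputable def genImage (p : ℕ × Fin (orb n)) : RLoc k n m :=
  if h : p.1 < m - 1 then RLoc.gen k n m (some ⟨p.1, h⟩) p.2
  else if p.1 + 1 = m then RLoc.gen k n m none p.2 ^ (2 ^ m - 1)
  else 0

/-- The equivariant ring map from `π_* BP^((C_{2 ^ n}))` to `R_n(k, m)`. -/
noncomputable def orientation : BPRing n →+* RRing k n m :=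
  (algebraMap (RLoc k n m) (RRing k n m)).comp
    (MvPolynomial.eval₂Hom
      ((algebraMap (RPoly k n m) (RLoc k n m)).comp (MvPolynomial.C.comp (ZLoc2.toWitt k)))
      (genImage k n m))

/-- The formal group law `F_h` over `R_n(k, m)`. -/
noncomputable def deformationFGL : FormalGroup (RRing k n m) :=
  (universalFGL n).map (orientation k n m)

/-- The formal group law `Γ_h` over the graded ring `K_n(k, m) = k[u, u⁻¹]`. -/
noncomputable def gradedGammaFGL : FormalGroup (KRing k n m) :=
  (deformationFGL k n m).map (Ideal.Quotient.mk _)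

/-- Evaluation of polynomials at `γ ^ i t_j = 0`, `γ ^ i u = 1`, with reduction `W(k) → k`. -/
noncomputable def evalPoly : RPoly k n m →+* k :=
  MvPolynomial.eval₂Hom WittVector.constantCoeff fun p => if p.1 = none then 1 else 0

/-- The map `RLoc k n m → k` with `γ ^ i t_j ↦ 0` and `γ ^ i u ↦ 1`. -/
noncomputable def evalLoc : RLoc k n m →+* k :=
  IsLocalization.Away.lift (uNorm k n m) (g := evalPoly k n m) (by simp [uNorm, evalPoly])

lemma evalPoly_gamma (p : RPoly k n m) :
    evalPoly k n m (gammaHom (WittVector 2 k) _ n p) = evalPoly k n m p := by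
  have h : (evalPoly k n m).comp (gammaHom (WittVector 2 k) _ n).toRingHom = evalPoly k n m := by
    refine MvPolynomial.ringHom_ext (fun r => ?_) fun i => ?_
    · simp [evalPoly, MvPolynomial.algebraMap_eq]
    · simp only [AlgHom.toRingHom_eq_coe, RingHom.coe_comp, RingHom.coe_coe, Function.comp_apply,
        gammaHom, MvPolynomial.aeval_X]
      split_ifs with h
      · simp [evalPoly]
      · simp only [evalPoly, map_neg, MvPolynomial.coe_eval₂Hom, MvPolynomial.eval₂_X]
        exact CharTwo.neg_eq _
  exact congrArg (· p) (congrArg DFunLike.coe h)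

lemma evalPoly_gamma_pow (i : ℕ) (p : RPoly k n m) :
    evalPoly k n m ((gammaHom (WittVector 2 k) _ n ^ i) p) = evalPoly k n m p := by
  induction i with
  | zero => rfl
  | succ i ih => rw [pow_succ', AlgHom.mul_apply, evalPoly_gamma, ih]

lemma maxIdeal_le_ker : maxIdeal k n m ≤ RingHom.ker (evalLoc k n m) := by
  rw [maxIdeal, Ideal.map_le_iff_le_comap, Ideal.span_le]
  have hl : ∀ p, evalLoc k n m (algebraMap _ _ p) = evalPoly k n m p := fun p =>
    IsLocalization.Away.lift_eq _ _ _
  rintro x (⟨i, j, rfl⟩ | ⟨i, rfl⟩)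
  · simp only [SetLike.mem_coe, Ideal.mem_comap, RingHom.mem_ker, hl, evalPoly_gamma_pow]
    simp [evalPoly]
  · simp only [SetLike.mem_coe, Ideal.mem_comap, RingHom.mem_ker, hl, evalPoly_gamma_pow, map_sub,
      evalPoly_gamma, sub_self]

/-- The induced map `R_n(k, m) → k`. -/
noncomputable def evalRing : RRing k n m →+* k :=
  (Ideal.Quotient.lift (maxIdeal k n m ^ 1) (evalLoc k n m) fun a ha =>
    maxIdeal_le_ker k n m (by simpa using ha)).comp
    (AdicCompletion.evalₐ (maxIdeal k n m) 1).toRingHom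

lemma evalRing_algebraMap (x : RLoc k n m) :
    evalRing k n m (algebraMap _ (RRing k n m) x) = evalLoc k n m x := by
  simp only [evalRing, RingHom.comp_apply]
  change Ideal.Quotient.lift _ _ _ (AdicCompletion.evalₐ (maxIdeal k n m) 1
    (algebraMap _ (RRing k n m) x)) = _
  rw [AlgHom.commutes]
  rfl

/-- The retraction `K_n(k, m) = k[u, u⁻¹] → k` with `u ↦ 1`. It restricts to the identification of
the degree zero part `K_n(k, m)_0` with `k`. -/
noncomputable def evalK : KRing k n m →+* k :=
  Ideal.Quotient.lift _ (evalRing k n m) fun a ha => by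
    have h : (maxIdeal k n m).map (algebraMap (RLoc k n m) (RRing k n m))
        ≤ RingHom.ker (evalRing k n m) := by
      rw [Ideal.map_le_iff_le_comap]
      intro x hx
      rw [Ideal.mem_comap, RingHom.mem_ker, evalRing_algebraMap]
      exact maxIdeal_le_ker k n m hx
    exact h ha

/-- The formal group law `Γ_h` of the pair `(k, Γ_h)`, over the field `k = K_n(k, m)_0`. In the
even periodic setting it is `u Γ_h (u⁻¹ x, u⁻¹ y)`, with coefficients in degree zero; since these
coefficients are `u ^ (1 - i - j)` times those of `Γ_h`, the identification of `K_n(k, m)_0` with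
`k` takes it to the image of the graded `Γ_h` under `u ↦ 1`. -/
noncomputable def gammaFGL : FormalGroup k := (gradedGammaFGL k n m).map (evalK k n m)

end Residue

/-! ### Automorphisms of formal group laws -/

section Automorphisms

/-- An automorphism of a formal group law `F` over `R`: an invertible power series `φ` over `R`,
without constant term, such that `φ (F (x, y)) = F (φ x, φ y)`. -/
structure FGLAut {R : Type*} [CommRing R] (F : FormalGroup R) where
  /-- The underlying power series. -/
  series : PowerSeries R
  constantCoeff_series : series.constantCoeff = 0
  isUnit_coeff_one : IsUnit (series.coeff 1)
  subst_series : series.subst F.toPowerSeries =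
    F.toPowerSeries.subst ![series.subst (X 0 : MvPowerSeries (Fin 2) R),
      series.subst (X 1 : MvPowerSeries (Fin 2) R)]

/-- Extension of scalars of automorphisms of formal group laws. -/
noncomputable def FGLAut.baseChange {R S : Type*} [CommRing R] [CommRing S] (f : R →+* S)
    {F : FormalGroup R} (φ : FGLAut F) : FGLAut (F.map f) where
  series := PowerSeries.map f φ.series
  constantCoeff_series := by
    rw [← PowerSeries.coeff_zero_eq_constantCoeff_apply, PowerSeries.coeff_map,
      PowerSeries.coeff_zero_eq_constantCoeff_apply, φ.constantCoeff_series, map_zero]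
  isUnit_coeff_one := by
    rw [PowerSeries.coeff_map]; exact φ.isUnit_coeff_one.map f
  subst_series := by
    have hX : ∀ i : Fin 2, PowerSeries.HasSubst (X i : MvPowerSeries (Fin 2) R) :=
      fun i => PowerSeries.HasSubst.X i
    have hF := PowerSeries.HasSubst.of_constantCoeff_zero F.zero_constantCoeff
    have h0 : ∀ i : Fin 2, constantCoeff (φ.series.subst (X i : MvPowerSeries (Fin 2) R)) = 0 :=
      fun i => PowerSeries.constantCoeff_subst_eq_zero (constantCoeff_X i) _ φ.constantCoeff_series
    have hs : HasSubst ![φ.series.subst (X 0 : MvPowerSeries (Fin 2) R),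
        φ.series.subst (X 1 : MvPowerSeries (Fin 2) R)] :=
      hasSubst_of_constantCoeff_zero fun s => by fin_cases s <;> simp [h0]
    have h := congrArg (MvPowerSeries.map f) φ.subst_series
    rw [PowerSeries.map_subst hF, map_subst hs] at h
    refine h.trans ?_
    congr 1
    funext i
    fin_cases i
    · simp [PowerSeries.map_subst (hX 0)]
    · simp [PowerSeries.map_subst (hX 1)]

/-- The formal group law `F` over the field `k` has all of its automorphisms over `k`: extension
of scalars identifies `Aut_k (F)` with the automorphisms of `F` over an algebraic closure of `k`. -/
def HasAllAutomorphisms {k : Type*} [Field k] (F : FormalGroup k) : Prop :=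
  Function.Bijective
    (FGLAut.baseChange (algebraMap k (AlgebraicClosure k)) : FGLAut F → FGLAut _)

end Automorphisms

/-- The height `h(n, m) = 2 ^ (n - 1) m`. -/
def height (n m : ℕ) : ℕ := 2 ^ (n - 1) * m

end RealBordism

set_option linter.unusedSectionVars false

namespace RealBordism
open MvPowerSeries Finset

/-! ### Integrality of power series through their logarithms -/

section Series
variable {E : Type*} [CommRing E] {A : Subring E} {σ : E →+* E}

/-! Setting `u = 1`, the law `Γ_h` becomes the reduction mod 2 of the law over `ℤ_(2)` with every `γ
^ i t_m = 1` and all other `γ ^ i t_j = 0`. It is defined over the prime field, so `S : x ↦ x ^ 2`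
is an additive endomorphism of its points. Put `N = 2 ^ (n - 1)`, `h = N m`, `q = (1 + T ^ m) ^ N`.
The logarithm `λ` satisfies `λ + λ q = 2 q`, that is `w λ = q` with `w = (1 + q) / 2` (a special
element in the sense of Honda). Since `2 w λ = 2 q` is divisible by 2, reduction mod 2 gives `1 + (1
+ S ^ m) ^ N = 0` (`aeval_pointFrob_relationPoly`). Thus `1 + S ^ m` behaves like a root of unity
`ζ` of order `2 ^ n`, and `S ^ m` like `ζ - 1`.

An automorphism commutes with `S ^ r` exactly when its coefficients are fixed by `x ↦ x ^ (2 ^ r)`,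
which over a field with `2 ^ r` elements means that it is defined there (`commute_iff_coeff_pow`,
`commute_of_coeff_pow`, `hasAllAutomorphisms_iff`). For `n = 1` one has `S ^ h = -2`, and for `n =
2` one has `S ^ (2 h) = -4`, as `(i - 1) ^ 4 = -4`. Integers are central, so both positive
statements follow.

For `n > 2` no positive power of `ζ - 1` is an integer (`not_dvd_X_pow_sub_C`). If all automorphisms
were defined over a field with `2 ^ r` elements, they would commute with a positive power of `S ^
m`. Modulo the relation, this power is `a + 2 ^ e A` with `a` an integer and `A = S ^ (m i) + ⋯`,
where `0 < i < N`. There is no 2-torsion, so on the coordinate every automorphism commutes with `A`.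
Comparing coefficients in degree `2 ^ (m i)` puts its linear coefficient in the field with `2 ^ (m
i)` elements (`exists_pow_eq_of_commute`). On the other hand, every nonzero element of `𝔽_{2 ^ h}`
is the linear coefficient of an automorphism (`exists_endomorphism`, obtained by solving `w c = φ ^
h (c) w` over the Witt vectors), and `m i < h`: a contradiction. -/

lemma le_order_sub {τ : Type*} {r : ℕ∞} {a b : MvPowerSeries τ E} (ha : r ≤ a.order)
    (hb : r ≤ b.order) : r ≤ (a - b).order :=
  le_order fun d hd => by
    rw [map_sub, coeff_of_lt_order (lt_of_lt_of_le hd ha),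
      coeff_of_lt_order (lt_of_lt_of_le hd hb), sub_zero]

lemma le_order_sum {τ ι : Type*} {r : ℕ∞} (s : Finset ι) {a : ι → MvPowerSeries τ E}
    (ha : ∀ i ∈ s, r ≤ (a i).order) : r ≤ (∑ i ∈ s, a i).order :=
  le_order fun d hd => by
    rw [map_sum]
    exact sum_eq_zero fun i hi => coeff_of_lt_order (lt_of_lt_of_le hd (ha i hi))

lemma le_order_mul_left {τ : Type*} {r : ℕ∞} (b : MvPowerSeries τ E) {a : MvPowerSeries τ E}
    (ha : r ≤ a.order) : r ≤ (b * a).order :=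
  (ha.trans (le_add_of_nonneg_left zero_le)).trans le_order_mul

/-- A series `h` without constant term is integral if `s * f (h)` is, where `s * f = q` with `q`
integral. -/
lemma mem_truncSubring_of_log (hσ : ∀ a ∈ A, ∃ b ∈ A, σ a = a ^ 2 + 2 * b) {u : E} (hu : 2 * u = 1)
    {l s q : ℕ → E} (hs : ∀ a, 2 * s a ∈ A) (hl : ∀ k, 2 ^ k * l k ∈ A)
    (hFE : ∀ k, twMul σ s l k = q k) (hq : ∀ k, q k ∈ A) (hq0 : q 0 = 1)
    {h : MvPowerSeries (Fin 2) E} (h0 : constantCoeff h = 0)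
    (hint : ∀ r K, r ≤ 2 ^ K → ∑ a ∈ range K, C (s a) * (frobLift σ ^ a)
      ((typicalSeries l).subst h) ∈ truncSubring A r) (r : ℕ) : h ∈ truncSubring A r := by
  suffices main : ∀ r, h ∈ truncSubring A (r + 1) from truncSubring_anti (Nat.le_succ r) (main r)
  intro r
  induction r with
  | zero =>
    intro d hd
    have : d = 0 := by
      rw [← Finsupp.degree_eq_zero_iff]; omega
    rw [this, coeff_zero_eq_constantCoeff_apply, h0]
    exact A.zero_mem
  | succ r ih =>
    obtain ⟨K, hK⟩ : ∃ K, r + 1 + 1 ≤ 2 ^ (K + 1) :=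
      ⟨r + 1, (Nat.lt_two_pow_self (n := r + 1 + 1)).le⟩
    -- Up to integral terms `s * f (h)` is `∑ q_k h ^ (2 ^ k)`. In the next degree the powers with
    -- `k ≥ 1` are already integral, so the term `k = 0`, which is `h` itself, is integral as well.
    have a3 := add_mem (funEq_aux hσ hu hs hl hFE (by omega) hK ih h0) (hint _ _ hK)
    rw [sub_add_cancel, sum_range_succ'] at a3
    have a4 : ∑ k ∈ range K, C (q (k + 1)) * h ^ 2 ^ (k + 1) ∈ truncSubring A (r + 1 + 1) := by
      refine sum_mem fun k _ => mul_mem (C_mem (hq _)) ?_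
      obtain ⟨hm, c, hc, e⟩ := pow_sub_frobLift hσ hu (by omega) ih h0 k
      rw [e]
      exact add_mem hm (mul_mem (ofNat_mem _ 2) hc)
    have a5 := sub_mem a3 a4
    rw [add_sub_cancel_left, hq0] at a5
    simpa using a5

lemma frobLift_X (i : Fin 2) : frobLift σ (X i : MvPowerSeries (Fin 2) E) = X i ^ 2 := by
  rw [frobLift_apply, map_X, expand_X]

lemma frobLift_pow_X (i : Fin 2) (a : ℕ) :
    (frobLift σ ^ a) (X i : MvPowerSeries (Fin 2) E) = X i ^ 2 ^ a := by
  induction a with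
  | zero => simp
  | succ a ih =>
    rw [pow_succ', RingHom.mul_def, RingHom.comp_apply, ih, map_pow, frobLift_X, ← pow_mul, pow_succ']

/-- On a variable, `frobLift ^ a` sends `c x ^ (2 ^ b)` to `σ ^ a (c) x ^ (2 ^ (a + b))`, which is
the multiplication rule of `twMul`. The error comes only from cutting the sum at `K`. -/
lemma le_order_twisted_typicalSeries (s l : ℕ → E) (i : Fin 2) (K : ℕ) :
    ((2 ^ K : ℕ) : ℕ∞) ≤ (∑ a ∈ range K, C (s a) * (frobLift σ ^ a)
        ((typicalSeries l).subst (X i : MvPowerSeries (Fin 2) E))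
      - (typicalSeries (twMul σ s l)).subst (X i : MvPowerSeries (Fin 2) E)).order := by
  have h1 : ((2 ^ K : ℕ) : ℕ∞) ≤ (∑ a ∈ range K, C (s a) * (frobLift σ ^ a)
      ((typicalSeries l).subst (X i : MvPowerSeries (Fin 2) E)
        - ∑ b ∈ range (K - a), C (l b) * (X i) ^ 2 ^ b)).order := by
    refine le_order_sum _ fun a ha => le_order_mul_left _ ?_
    have haK : a < K := by simpa using ha
    refine le_trans ?_ (le_order_frobLift_pow a
      (le_order_subst_typicalSeries l (K - a) (constantCoeff_X i)))
    rw [← pow_add, Nat.add_sub_cancel' haK.le]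
  have h2 := le_order_subst_typicalSeries (twMul σ s l) K (constantCoeff_X (R := E) i)
  have h3 := le_order_sub h1 h2
  have e1 : ∑ k ∈ range K, C (twMul σ s l k) * (X i : MvPowerSeries (Fin 2) E) ^ 2 ^ k
      = ∑ a ∈ range K, C (s a) * (frobLift σ ^ a)
        (∑ b ∈ range (K - a), C (l b) * (X i) ^ 2 ^ b) := by
    have : ∀ a, C (s a) * (frobLift σ ^ a)
        (∑ b ∈ range (K - a), C (l b) * (X i : MvPowerSeries (Fin 2) E) ^ 2 ^ b)
        = ∑ b ∈ range (K - a), C (s a * (σ ^ a) (l b)) * (X i ^ 2 ^ a) ^ 2 ^ b := fun a => by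
      simp only [map_sum, mul_sum, map_mul, map_pow, frobLift_pow_C, frobLift_pow_X, mul_assoc]
    simp only [this]
    rw [← sum_range_diag_flip K fun a b => C (s a * (σ ^ a) (l b)) *
      ((X i : MvPowerSeries (Fin 2) E) ^ 2 ^ a) ^ 2 ^ b]
    refine sum_congr rfl fun k _ => ?_
    rw [twMul, map_sum, sum_mul, Finset.Nat.sum_antidiagonal_eq_sum_range_succ_mk]
    refine sum_congr rfl fun a ha => ?_
    have : a ≤ k := by simpa [Nat.lt_succ_iff] using ha
    rw [← pow_mul, ← pow_add, Nat.add_sub_cancel' this]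
  convert h3 using 2
  rw [e1]
  simp only [map_sub, mul_sub, sum_sub_distrib]
  ring

lemma typicalSeries_subst_mem {l : ℕ → E} (hl : ∀ k, l k ∈ A) {h : MvPowerSeries (Fin 2) E}
    (h0 : constantCoeff h = 0) (hh : ∀ r, h ∈ truncSubring A r) (r : ℕ) :
    (typicalSeries l).subst h ∈ truncSubring A r := by
  have h1 : (∑ k ∈ range r, C (l k) * h ^ 2 ^ k) ∈ truncSubring A r :=
    sum_mem fun k _ => mul_mem (C_mem (hl k)) (pow_mem (hh r) _)
  have h2 := le_order_subst_typicalSeries l r h0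
  have h3 := add_mem (mem_of_le_order (A := A) (le_trans (by exact_mod_cast
    (Nat.lt_two_pow_self (n := r)).le) h2)) h1
  rwa [sub_add_cancel] at h3

/-- Without constant terms, a coefficient of degree `r` of the product involves only coefficients of
the factors of degree below `r`. -/
lemma mul_mem_truncSubring_succ {r : ℕ} {a b : MvPowerSeries (Fin 2) E}
    (ha : a ∈ truncSubring A r) (hb : b ∈ truncSubring A r)
    (ha0 : constantCoeff a = 0) (hb0 : constantCoeff b = 0) : a * b ∈ truncSubring A (r + 1) := by
  classical
  intro d hd
  rw [coeff_mul]
  refine sum_mem fun p hp => ?_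
  have h := congrArg Finsupp.degree (mem_antidiagonal.1 hp)
  rw [map_add] at h
  rcases eq_or_ne p.1 0 with h1 | h1
  · rw [h1, coeff_zero_eq_constantCoeff_apply, ha0, zero_mul]; exact A.zero_mem
  rcases eq_or_ne p.2 0 with h2 | h2
  · rw [h2, coeff_zero_eq_constantCoeff_apply, hb0, mul_zero]; exact A.zero_mem
  rw [Ne, ← Finsupp.degree_eq_zero_iff] at h1 h2
  exact A.mul_mem (ha _ (by omega)) (hb _ (by omega))

/-- If `f (a)` and `f (b)` are congruent modulo `2`, so are `a` and `b`. -/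
lemma half_sub_mem_of_log {u : E} (hu : 2 * u = 1)
    {l : ℕ → E} (hl : ∀ k, 2 ^ k * l k ∈ A) (hl0 : l 0 = 1)
    {a b : MvPowerSeries (Fin 2) E} (ha0 : constantCoeff a = 0) (hb0 : constantCoeff b = 0)
    (hb : ∀ r, b ∈ truncSubring A r)
    (h : ∀ r, C u * ((typicalSeries l).subst a - (typicalSeries l).subst b) ∈ truncSubring A r)
    (r : ℕ) : C u * (a - b) ∈ truncSubring A r := by
  suffices main : ∀ r, C u * (a - b) ∈ truncSubring A (r + 1) from
    truncSubring_anti (Nat.le_succ r) (main r)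
  have hu' : (2 : MvPowerSeries (Fin 2) E) * C u = 1 := by
    have := congrArg (C (σ := Fin 2)) hu
    rwa [map_mul, map_ofNat, map_one] at this
  set e := C u * (a - b) with he
  have he0 : constantCoeff e = 0 := by rw [he, map_mul, map_sub, ha0, hb0, sub_zero, mul_zero]
  have hae : a = b + 2 * e := by rw [he, ← mul_assoc, hu']; ring
  intro r
  induction r with
  | zero =>
    intro d hd
    have : d = 0 := by
      rw [← Finsupp.degree_eq_zero_iff]; omega
    rw [this, coeff_zero_eq_constantCoeff_apply, he0]
    exact A.zero_mem
  | succ r ih =>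
    -- From `a = b + 2 e`, each squaring gains a factor 2. The resulting `2 ^ (k + 2)` absorbs the
    -- denominator `2 ^ (k + 1)` of `l (k + 1)` and the factor `1 / 2`, and `c` is integral one
    -- degree beyond `e`.
    have hpow : ∀ k, ∃ c ∈ truncSubring A (r + 1 + 1),
        a ^ 2 ^ (k + 1) - b ^ 2 ^ (k + 1) = 2 ^ (k + 2) * c := by
      intro k
      induction k with
      | zero =>
        refine ⟨b * e + e * e, add_mem (mul_mem_truncSubring_succ (hb _) ih hb0 he0)
          (mul_mem_truncSubring_succ ih ih he0 he0), ?_⟩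
        rw [hae]; ring
      | succ k ihk =>
        obtain ⟨c, hc, e1⟩ := ihk
        refine ⟨c * b ^ 2 ^ (k + 1) + 2 ^ (k + 1) * c ^ 2,
          add_mem (mul_mem hc (pow_mem (hb _) _))
            (mul_mem (pow_mem (ofNat_mem _ 2) _) (pow_mem hc 2)), ?_⟩
        have e2 : a ^ 2 ^ (k + 1) = b ^ 2 ^ (k + 1) + 2 ^ (k + 2) * c := by rw [← e1]; ring
        rw [pow_succ 2 (k + 1), pow_mul, e2, pow_mul]
        ring
    have hX : ∀ x : MvPowerSeries (Fin 2) E, constantCoeff x = 0 →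
        ((r + 1 + 1 : ℕ) : ℕ∞) ≤ (C u * ((typicalSeries l).subst x
          - ∑ k ∈ range (r + 1 + 1), C (l k) * x ^ 2 ^ k)).order := fun x hx =>
      le_order_mul_left _ (le_trans (by exact_mod_cast
        (Nat.lt_two_pow_self (n := r + 1 + 1)).le) (le_order_subst_typicalSeries l _ hx))
    have h1 := sub_mem (h (r + 1 + 1)) (mem_of_le_order (A := A) (le_order_sub (hX a ha0) (hX b hb0)))
    have h2 : C u * ∑ k ∈ range (r + 1), C (l (k + 1)) * (a ^ 2 ^ (k + 1) - b ^ 2 ^ (k + 1))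
        ∈ truncSubring A (r + 1 + 1) := by
      rw [mul_sum]
      refine sum_mem fun k _ => ?_
      obtain ⟨c, hc, e1⟩ := hpow k
      have : C u * (C (l (k + 1)) * (a ^ 2 ^ (k + 1) - b ^ 2 ^ (k + 1)))
          = C (2 ^ (k + 1) * l (k + 1)) * c := by
        rw [e1, map_mul, map_pow, map_ofNat]
        linear_combination (C (l (k + 1)) * 2 ^ (k + 1) * c) * hu'
      rw [this]
      exact mul_mem (C_mem (hl _)) hc
    have h3 := sub_mem h1 h2
    convert h3 using 1
    simp only [sum_range_succ' _ (r + 1), hl0, map_one, pow_zero, pow_one, mul_sub, sum_sub_distrib]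
    rw [he]
    ring

/-- If `f (F (x, y)) = f x + f y` and `g = c * f`, then `g (F (x, y))` and `g x + g y` are congruent
modulo `2`. -/
lemma half_twisted_log_mem (hσ : ∀ a ∈ A, ∃ b ∈ A, σ a = a ^ 2 + 2 * b) {u : E} (hu : 2 * u = 1)
    {l c : ℕ → E} (hc : ∀ a, c a ∈ A) (hl : ∀ k, 2 ^ k * l k ∈ A)
    {F : MvPowerSeries (Fin 2) E} (h0 : constantCoeff F = 0) (hFA : ∀ r, F ∈ truncSubring A r)
    (hF : (typicalSeries l).subst F = (typicalSeries l).subst (X 0 : MvPowerSeries (Fin 2) E)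
      + (typicalSeries l).subst (X 1 : MvPowerSeries (Fin 2) E)) (r : ℕ) :
    C u * ((typicalSeries (twMul σ c l)).subst F
      - ((typicalSeries (twMul σ c l)).subst (X 0 : MvPowerSeries (Fin 2) E)
      + (typicalSeries (twMul σ c l)).subst (X 1 : MvPowerSeries (Fin 2) E)))
      ∈ truncSubring A r := by
  refine truncSubring_anti (by omega : r ≤ r + 1 + 1) ?_
  -- The congruence `funEq_aux` is used with `s = c / 2`: it requires only `2 s` to be integral, and
  -- nothing of the product `s * l`.
  have hs : ∀ a, 2 * (u * c a) ∈ A := fun a => by rw [← mul_assoc, hu, one_mul]; exact hc a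
  have hK : r + 1 + 1 ≤ 2 ^ (r + 1 + 1) := (Nat.lt_two_pow_self (n := r + 1 + 1)).le
  have hFE : ∀ k, ∑ p ∈ antidiagonal k, (u * c p.1) * (σ ^ p.1) (l p.2)
      = u * twMul σ c l k := fun k => by
    rw [twMul, mul_sum]; exact sum_congr rfl fun p _ => by ring
  have key : ∀ h : MvPowerSeries (Fin 2) E, constantCoeff h = 0 → (∀ r, h ∈ truncSubring A r) →
      C u * (typicalSeries (twMul σ c l)).subst h - ∑ a ∈ range (r + 1 + 1), C (u * c a) *
        (frobLift σ ^ a) ((typicalSeries l).subst h) ∈ truncSubring A (r + 1 + 1) := by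
    intro h h0 hh
    have h1 := funEq_aux hσ hu hs hl hFE (by omega) hK (hh (r + 1)) h0
    have h2 := mem_of_le_order (A := A) (le_order_mul_left (C u) (le_trans (by exact_mod_cast hK)
      (le_order_subst_typicalSeries (twMul σ c l) (r + 1 + 1) h0)))
    convert add_mem h1 h2 using 1
    simp only [mul_sub, mul_sum, map_mul, mul_assoc]
    ring
  -- The sums `∑ s_a φ ^ a (f (-))` are additive in `f (-)`, so they cancel between `F`, `x` and
  -- `y`.
  have h1 := sub_mem (sub_mem (key F h0 hFA) (key (X 0) (constantCoeff_X 0) fun r => X_mem 0))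
    (key (X 1) (constantCoeff_X 1) fun r => X_mem 1)
  convert h1 using 1
  rw [hF]
  simp only [map_add, mul_add, sum_add_distrib]
  ring

end Series

lemma coeff_one_subst {R : Type*} [CommRing R] (f : PowerSeries R) {a : PowerSeries R}
    (ha : a.constantCoeff = 0) :
    PowerSeries.coeff 1 (f.subst a) = f.coeff 1 * a.coeff 1 := by
  have has := PowerSeries.HasSubst.of_constantCoeff_zero' ha
  rw [PowerSeries.coeff_subst' has, finsum_eq_single _ 1]
  · simp
  · intro n hn
    rcases n with _ | _ | n
    · simp [PowerSeries.coeff_one]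
    · exact absurd rfl hn
    · have h1 : (PowerSeries.X : PowerSeries R) ^ (n + 2) ∣ a ^ (n + 2) :=
        pow_dvd_pow_of_dvd (PowerSeries.X_dvd_iff.2 ha) _
      rw [PowerSeries.X_pow_dvd_iff.1 h1 1 (by omega), smul_zero]

/-! ### The specialization `t_m = 1` and its logarithm -/

section Evaluation
variable (n m : ℕ)

/-- The evaluation `γ ^ i t_m ↦ 1` and `γ ^ i t_j ↦ 0` for `j ≠ m`. -/
noncomputable def evalT {S R : Type*} [CommRing S] [CommRing R] (j : S →+* R) :
    MvPolynomial (ℕ × Fin (orb n)) S →+* R :=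
  MvPolynomial.eval₂Hom j fun p => if p.1 + 1 = m then 1 else 0

variable {n m} in
lemma evalT_X {S R : Type*} [CommRing S] [CommRing R] (j : S →+* R) (p : ℕ × Fin (orb n)) :
    evalT n m j (MvPolynomial.X p) = if p.1 + 1 = m then 1 else 0 := by
  simp [evalT]

variable {n m} in
lemma evalT_C {S R : Type*} [CommRing S] [CommRing R] (j : S →+* R) (a : S) :
    evalT n m j (MvPolynomial.C a) = j a := by
  simp [evalT]

lemma comp_evalT {S R T : Type*} [CommRing S] [CommRing R] [CommRing T] (j : S →+* R)
    (f : R →+* T) : f.comp (evalT n m j) = evalT n m (f.comp j) := by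
  refine MvPolynomial.ringHom_ext (fun a => ?_) fun p => ?_
  · simp [evalT_C]
  · simp only [RingHom.comp_apply, evalT_X]
    split_ifs <;> simp

/-- This makes the specialized law independent of the structure map. Over a field of characteristic
2 it is therefore fixed by Frobenius. -/
instance subsingleton_zLoc2_ringHom {R : Type*} [CommRing R] : Subsingleton (ZLoc2 →+* R) :=
  ⟨fun _ _ => IsLocalization.ringHom_ext (Ideal.span {(2 : ℤ)}).primeCompl
    (RingHom.ext_int _ _)⟩

/-- The formal group law with `γ ^ i t_m = 1` and `γ ^ i t_j = 0` for `j ≠ m`. -/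
noncomputable def specialFGL {R : Type*} [CommRing R] (j : ZLoc2 →+* R) : FormalGroup R :=
  (universalFGL n).map (evalT n m j)

lemma map_map_formalGroup {R S T : Type*} [CommRing R] [CommRing S] [CommRing T]
    (F : FormalGroup R) (f : R →+* S) (g : S →+* T) : (F.map f).map g = F.map (g.comp f) := by
  ext; simp

lemma specialFGL_map {R S : Type*} [CommRing R] [CommRing S] (j : ZLoc2 →+* R) (f : R →+* S) :
    (specialFGL n m j).map f = specialFGL n m (f.comp j) := by
  rw [specialFGL, map_map_formalGroup, comp_evalT, specialFGL]

/-- At `u = 1` the image `u ^ (2 ^ m - 1)` of `t_m` is 1, and the other `t_j` vanish modulo `𝔪` or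
already in the orientation. Localization, completion and quotient therefore collapse to a single
evaluation. -/
lemma gammaFGL_eq (k : Type*) [Field k] [CharP k 2] (hm : 1 ≤ m) :
    gammaFGL k n m = specialFGL n m (WittVector.constantCoeff.comp (ZLoc2.toWitt k)) := by
  rw [gammaFGL, gradedGammaFGL, deformationFGL, map_map_formalGroup, map_map_formalGroup,
    specialFGL]
  congr 1
  have h1 : ∀ x : RLoc k n m, evalK k n m (Ideal.Quotient.mk _
      (algebraMap _ (RRing k n m) x)) = evalLoc k n m x := fun x =>
    evalRing_algebraMap k n m x
  have h2 : ∀ p, evalLoc k n m (algebraMap _ _ p) = evalPoly k n m p := fun p =>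
    IsLocalization.Away.lift_eq _ _ _
  refine MvPolynomial.ringHom_ext (fun a => ?_) fun p => ?_
  · simp only [RingHom.comp_apply, evalT_C, orientation, MvPolynomial.coe_eval₂Hom,
      MvPolynomial.eval₂_C, h1, h2]
    simp [evalPoly]
  · simp only [RingHom.comp_apply, evalT_X, orientation, MvPolynomial.coe_eval₂Hom,
      MvPolynomial.eval₂_X, h1, genImage]
    split_ifs with h3 h4 h4
    · omega
    · simp [RLoc.gen, h2, evalPoly]
    · simp [RLoc.gen, h2, evalPoly]
    · simp

/-- The numbers `ℓ_k` for `γ ^ i t_m = 1` and `γ ^ i t_j = 0`, `j ≠ m`. -/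
noncomputable def logEval (k : ℕ) : ℚ := evalT n m (RingHom.id ℚ) (logCoeff n k)

/-- The coefficients of `(1 + T ^ m) ^ i`. -/
noncomputable def binomCoeff (m i k : ℕ) : ℕ := ((1 + Polynomial.X ^ m) ^ i : Polynomial ℕ).coeff k

/-- The generators take the values 0 and 1, which are their own squares. After evaluation the twist
disappears and `twMul` becomes ordinary convolution. -/
lemma evalT_sq (x : BPRat n) :
    evalT n m (RingHom.id ℚ) (sq n x) = evalT n m (RingHom.id ℚ) x := by
  have : (evalT n m (RingHom.id ℚ)).comp (sq n) = evalT n m (RingHom.id ℚ) := by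
    refine MvPolynomial.ringHom_ext (fun a => ?_) fun p => ?_
    · simp [sq, evalT_C]
    · have := sq_pow_X n 1 p
      rw [pow_one, pow_one] at this
      rw [RingHom.comp_apply, this, map_pow, evalT_X]
      split_ifs <;> simp
  exact congrArg (· x) (congrArg DFunLike.coe this)

lemma evalT_sq_pow (i : ℕ) (x : BPRat n) :
    evalT n m (RingHom.id ℚ) ((sq n ^ i) x) = evalT n m (RingHom.id ℚ) x := by
  induction i with
  | zero => rfl
  | succ i ih => rw [pow_succ', RingHom.mul_def, RingHom.comp_apply, evalT_sq, ih]

/-- Each conjugate `γ ^ i t`, for `i < N`, evaluates to `1 + T ^ m`. -/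
lemma evalT_tProd (hm : 1 ≤ m) (i k : ℕ) (hi : i ≤ orb n) :
    evalT n m (RingHom.id ℚ) (tProd n i k) = binomCoeff m i k := by
  induction i generalizing k with
  | zero =>
    rw [tProd, twOne, binomCoeff, pow_zero, Polynomial.coeff_one]
    split_ifs <;> simp
  | succ i ih =>
    rw [tProd, twMul, map_sum, binomCoeff, pow_succ', Polynomial.coeff_mul, Nat.cast_sum]
    refine sum_congr rfl fun p _ => ?_
    rw [map_mul, evalT_sq_pow, ih _ (by omega), Nat.cast_mul, binomCoeff]
    congr 1
    rcases p.1 with _ | j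
    · have : m ≠ 0 := by omega
      simp [tConj, tGen, Polynomial.coeff_X_pow, this.symm]
    · rw [tConj, tGen, gamma_pow_X n j i (by omega), evalT_X]
      simp [Polynomial.coeff_X_pow, Polynomial.coeff_one]

lemma logEval_zero : logEval n m 0 = 1 := by simp [logEval, logCoeff]

/-- The relation `λ + λ q = 2 q` with `q = (1 + T ^ m) ^ N`, from which everything about the
logarithm is derived. -/
lemma logEval_add (hm : 1 ≤ m) (k : ℕ) :
    logEval n m k + ∑ p ∈ antidiagonal k, logEval n m p.1 * binomCoeff m (orb n) p.2
      = 2 * binomCoeff m (orb n) k := by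
  have h := congrArg (evalT n m (RingHom.id ℚ)) (logCoeff_add n k)
  rw [map_add, map_mul, map_ofNat, evalT_tProd n m hm _ _ le_rfl, twMul, map_sum] at h
  rw [← h, logEval]
  congr 1
  refine sum_congr rfl fun p _ => ?_
  rw [map_mul, evalT_sq_pow, evalT_tProd n m hm _ _ le_rfl, logEval]

lemma map_typicalSeries {R S : Type*} [CommRing R] [CommRing S] (f : R →+* S) (l : ℕ → R) :
    PowerSeries.map f (typicalSeries l) = typicalSeries fun k => f (l k) := by
  ext d
  simp only [typicalSeries, PowerSeries.coeff_map, PowerSeries.coeff_mk]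
  split_ifs <;> simp

/-- The logarithm of the specialized formal group law over a field of characteristic zero. -/
lemma specialFGL_log {E : Type*} [Field E] [CharZero E] (j : ZLoc2 →+* E) :
    (typicalSeries fun k => (logEval n m k : E)).subst (specialFGL n m j).toPowerSeries
      = (typicalSeries fun k => (logEval n m k : E)).subst (X 0 : MvPowerSeries (Fin 2) E)
      + (typicalSeries fun k => (logEval n m k : E)).subst (X 1 : MvPowerSeries (Fin 2) E) := by
  have h := congrArg (MvPowerSeries.map (evalT n m (algebraMap ℚ E))) (universalFGL_isLog n)
  have hX : ∀ i : Fin 2, PowerSeries.HasSubst (X i : MvPowerSeries (Fin 2) (BPRat n)) :=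
    fun i => PowerSeries.HasSubst.X i
  have hF := PowerSeries.HasSubst.of_constantCoeff_zero
    ((universalFGL n).map (BPRing.toRat n)).zero_constantCoeff
  rw [map_add, PowerSeries.map_subst hF, PowerSeries.map_subst (hX 0),
    PowerSeries.map_subst (hX 1), map_X, map_X, map_typicalSeries] at h
  have e1 : (evalT n m (algebraMap ℚ E)).comp (BPRing.toRat n) = evalT n m j := by
    refine MvPolynomial.ringHom_ext (fun a => ?_) fun p => ?_
    · have := congrArg (· a) (congrArg DFunLike.coe
        (Subsingleton.elim ((algebraMap ℚ E).comp ZLoc2.toRat) j))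
      simpa [BPRing.toRat, evalT_C] using this
    · simp [BPRing.toRat, evalT_X]
  have e2 : MvPowerSeries.map (evalT n m (algebraMap ℚ E))
      ((universalFGL n).map (BPRing.toRat n)).toPowerSeries = (specialFGL n m j).toPowerSeries := by
    change (((universalFGL n).map (BPRing.toRat n)).map _).toPowerSeries = _
    rw [map_map_formalGroup, e1, specialFGL]
  have e3 : (fun k => evalT n m (algebraMap ℚ E) (logCoeff n k))
      = fun k => (logEval n m k : E) := by
    funext k
    have := comp_evalT n m (RingHom.id ℚ) (algebraMap ℚ E)
    rw [RingHom.comp_id] at this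
    rw [← this, RingHom.comp_apply, logEval, eq_ratCast]
  rwa [e2, e3] at h

end Evaluation

/-! ### Witt vectors of an algebraically closed field and their Frobenius -/

section Witt
lemma exists_sub_pow_eq {K : Type*} [Field K] [IsAlgClosed K] {q : ℕ} (hq : 1 < q) (b : K) :
    ∃ x : K, x - x ^ q = b := by
  have hd : (Polynomial.X ^ q - (Polynomial.X - Polynomial.C b) : Polynomial K).degree ≠ 0 := by
    have h1 : (Polynomial.X - Polynomial.C b : Polynomial K).degree
        < (Polynomial.X ^ q : Polynomial K).degree := by
      rw [Polynomial.degree_X_pow, Polynomial.degree_X_sub_C]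
      exact_mod_cast hq
    rw [Polynomial.degree_sub_eq_left_of_degree_lt h1, Polynomial.degree_X_pow]
    exact_mod_cast (by omega : q ≠ 0)
  obtain ⟨x, hx⟩ := IsAlgClosed.exists_root _ hd
  refine ⟨x, ?_⟩
  simp only [Polynomial.IsRoot, Polynomial.eval_sub, Polynomial.eval_pow, Polynomial.eval_X,
    Polynomial.eval_C] at hx
  linear_combination -hx

variable {K : Type*} [Field K] [CharP K 2]

lemma constantCoeff_two_mul (y : WittVector 2 K) : WittVector.constantCoeff (2 * y) = 0 := by
  rw [map_mul, map_ofNat, CharTwo.two_eq_zero, zero_mul]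

lemma constantCoeff_frobenius_pow (i : ℕ) (x : WittVector 2 K) :
    WittVector.constantCoeff ((WittVector.frobenius ^ i) x)
      = WittVector.constantCoeff x ^ 2 ^ i := by
  induction i with
  | zero => simp
  | succ i ih =>
    rw [pow_succ', RingHom.mul_def, RingHom.comp_apply]
    have := WittVector.coeff_frobenius_charP (p := 2) ((WittVector.frobenius ^ i) x) 0
    rw [pow_succ, pow_mul, ← ih]
    exact this

lemma charZero_fractionRing_witt : CharZero (FractionRing (WittVector 2 K)) := by
  have h2 : (2 : WittVector 2 K) ≠ 0 := by exact_mod_cast WittVector.p_nonzero 2 K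
  have : CharZero (WittVector 2 K) := by
    refine charZero_of_inj_zero fun n hn => ?_
    by_contra h0
    -- Powers of 2 are nonzero in a domain where 2 is nonzero, and odd integers are nonzero already
    -- in the residue field.
    obtain ⟨a, b, hb, rfl⟩ := Nat.exists_eq_two_pow_mul_odd h0
    rw [Nat.cast_mul, Nat.cast_pow, Nat.cast_ofNat] at hn
    have h3 := (mul_eq_zero.1 hn).resolve_left (pow_ne_zero _ h2)
    have h4 := congrArg (WittVector.constantCoeff : WittVector 2 K →+* K) h3
    rw [map_natCast, map_zero, CharP.cast_eq_zero_iff K 2] at h4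
    exact (Nat.not_even_iff_odd.2 hb) (even_iff_two_dvd.2 h4)
  exact charZero_of_injective_algebraMap (IsFractionRing.injective (WittVector 2 K) _)

variable (K) [IsAlgClosed K]

/-- The Frobenius on the fraction field of the Witt vectors. -/
noncomputable abbrev wittFrob : FractionRing (WittVector 2 K) →+* FractionRing (WittVector 2 K) :=
  WittVector.FractionRing.frobeniusRingHom 2 K

/-- The Witt vectors inside their fraction field. -/
noncomputable abbrev wittInt : Subring (FractionRing (WittVector 2 K)) :=
  (algebraMap (WittVector 2 K) (FractionRing (WittVector 2 K))).range

variable {K}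

lemma wittFrob_algebraMap (x : WittVector 2 K) :
    wittFrob K (algebraMap _ _ x) = algebraMap _ _ (WittVector.frobenius x) := by
  exact IsFractionRing.ringEquivOfRingEquiv_algebraMap _ x

lemma wittFrob_pow_algebraMap (i : ℕ) (x : WittVector 2 K) :
    (wittFrob K ^ i) (algebraMap _ _ x) = algebraMap _ _ ((WittVector.frobenius ^ i) x) := by
  induction i with
  | zero => rfl
  | succ i ih =>
    rw [pow_succ', RingHom.mul_def, RingHom.comp_apply, ih, wittFrob_algebraMap, pow_succ',
      RingHom.mul_def, RingHom.comp_apply]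

lemma exists_eq_two_mul_of_constantCoeff {x : WittVector 2 K}
    (hx : WittVector.constantCoeff x = 0) : ∃ y, x = 2 * y := by
  have := (WittVector.mem_span_p_iff_coeff_zero_eq_zero x).2 hx
  rw [Ideal.mem_span_singleton] at this
  obtain ⟨y, hy⟩ := this
  exact ⟨y, by exact_mod_cast hy⟩

/-- Frobenius lifts squaring modulo 2: this is the hypothesis under which the functional equation
arguments apply to `W(K)`. -/
lemma wittFrob_spec : ∀ a ∈ wittInt K, ∃ b ∈ wittInt K, wittFrob K a = a ^ 2 + 2 * b := by
  rintro _ ⟨x, rfl⟩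
  obtain ⟨y, hy⟩ := exists_eq_two_mul_of_constantCoeff (K := K)
    (x := WittVector.frobenius x - x ^ 2) (by
      have := constantCoeff_frobenius_pow 1 x
      rw [pow_one, pow_one] at this
      rw [map_sub, map_pow, this, sub_self])
  refine ⟨_, ⟨y, rfl⟩, ?_⟩
  have e : WittVector.frobenius x = x ^ 2 + 2 * y := by rw [← hy]; ring
  rw [wittFrob_algebraMap, e, map_add, map_mul, map_pow, map_ofNat]

/-- `1 - φ ^ h` is surjective on the Witt vectors of an algebraically closed field. -/
lemma surjective_sub_frobenius_pow {h : ℕ} (hh : 1 ≤ h) (b : WittVector 2 K) :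
    ∃ x, x - (WittVector.frobenius ^ h) x = b := by
  set φ : WittVector 2 K →+* WittVector 2 K := WittVector.frobenius ^ h with hφ
  -- Modulo 2 the equation is `x - x ^ (2 ^ h) = b`, solvable in `K`. A lift of the solution leaves
  -- a remainder divisible by 2.
  have step : ∀ b : WittVector 2 K, ∃ p : WittVector 2 K × WittVector 2 K,
      b = (p.1 - φ p.1) + 2 * p.2 := by
    intro b
    obtain ⟨x, hx⟩ := exists_sub_pow_eq (Nat.one_lt_two_pow (by omega : h ≠ 0))
      (WittVector.constantCoeff b)
    obtain ⟨z, rfl⟩ := WittVector.constantCoeff_surjective 2 x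
    obtain ⟨y, hy⟩ := exists_eq_two_mul_of_constantCoeff (K := K) (x := b - (z - φ z)) (by
      rw [map_sub, map_sub, hφ, constantCoeff_frobenius_pow, hx, sub_self])
    exact ⟨(z, y), by rw [← hy]; ring⟩
  choose p hp using step
  -- `B n` is the remainder after `n` corrections divided by `2 ^ n`, and `S n` is the sum of these
  -- corrections; it converges 2-adically to the solution.
  set B : ℕ → WittVector 2 K := fun n => (fun b => (p b).2)^[n] b with hB
  set S : ℕ → WittVector 2 K := fun n => ∑ j ∈ range n, 2 ^ j * (p (B j)).1 with hS
  have hSB : ∀ n, b = (S n - φ (S n)) + 2 ^ n * B n := by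
    intro n
    induction n with
    | zero => simp [hS, hB]
    | succ n ih =>
      have e1 : B (n + 1) = (p (B n)).2 := Function.iterate_succ_apply' _ _ _
      have e2 := hp (B n)
      have e3 : S (n + 1) = S n + 2 ^ n * (p (B n)).1 := sum_range_succ _ _
      rw [e3, map_add, map_mul, map_pow, map_ofNat, e1]
      linear_combination ih + 2 ^ n * e2
  have hmem : ∀ n (x : WittVector 2 K),
      x ∈ (Ideal.span {((2 : ℕ) : WittVector 2 K)} ^ n • (⊤ : Ideal (WittVector 2 K)))
        ↔ ∃ y, x = 2 ^ n * y := by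
    intro n x
    rw [smul_eq_mul, Ideal.mul_top, Ideal.span_singleton_pow, Ideal.mem_span_singleton,
      Nat.cast_ofNat]
    rfl
  obtain ⟨L, hL⟩ := IsPrecomplete.prec (I := Ideal.span {((2 : ℕ) : WittVector 2 K)})
    (M := WittVector 2 K) inferInstance (f := S) (by
      intro i n hin
      rw [SModEq.sub_mem, hmem]
      obtain ⟨d, rfl⟩ := Nat.exists_eq_add_of_le hin
      refine ⟨- ∑ j ∈ range d, 2 ^ j * (p (B (i + j))).1, ?_⟩
      simp only [hS, sum_range_add, mul_neg, mul_sum, pow_add, mul_assoc]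
      ring)
  refine ⟨L, sub_eq_zero.1 (IsHausdorff.haus (I := Ideal.span {((2 : ℕ) : WittVector 2 K)})
    inferInstance _ fun n => ?_)⟩
  rw [SModEq.zero, hmem]
  have h1 := hL n
  rw [SModEq.sub_mem, hmem] at h1
  obtain ⟨y, hy⟩ := h1
  refine ⟨-y + φ y - B n, ?_⟩
  have e : L = S n - 2 ^ n * y := by rw [← hy]; ring
  have := hSB n
  rw [e, map_sub, map_mul, map_pow, map_ofNat]
  linear_combination -this

end Witt

/-! ### The coefficients of `(1 + T ^ m) ^ i` -/

section BinomCoeff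

lemma binomCoeff_eq {m : ℕ} (hm : 1 ≤ m) (i k : ℕ) :
    binomCoeff m i k = if m ∣ k then i.choose (k / m) else 0 := by
  have : ((1 + Polynomial.X ^ m) ^ i : Polynomial ℕ)
      = Polynomial.expand ℕ m ((1 + Polynomial.X) ^ i) := by
    simp
  rw [binomCoeff, this, Polynomial.coeff_expand hm, Polynomial.coeff_one_add_X_pow]
  simp

lemma binomCoeff_zero {m : ℕ} (hm : 1 ≤ m) (i : ℕ) : binomCoeff m i 0 = 1 := by
  simp [binomCoeff_eq hm]

lemma binomCoeff_top {m : ℕ} (hm : 1 ≤ m) (i : ℕ) : binomCoeff m i (i * m) = 1 := by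
  rw [binomCoeff_eq hm, if_pos (dvd_mul_left _ _), Nat.mul_div_cancel _ (by omega),
    Nat.choose_self]

lemma binomCoeff_of_lt {m : ℕ} (hm : 1 ≤ m) {i k : ℕ} (h : i * m < k) : binomCoeff m i k = 0 := by
  rw [binomCoeff_eq hm]
  split_ifs with h1
  · obtain ⟨c, rfl⟩ := h1
    rw [Nat.mul_div_cancel_left _ (by omega)]
    refine Nat.choose_eq_zero_of_lt ?_
    by_contra hc
    have := Nat.mul_le_mul_left m (not_lt.1 hc)
    rw [mul_comm i m] at h
    omega
  · rfl

/-- Modulo 2, `(1 + T ^ m) ^ (2 ^ e) = 1 + T ^ (2 ^ e m)`. Hence `(1 + q) / 2` is integral except in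
degree `h`. -/
lemma two_dvd_binomCoeff {m : ℕ} (hm : 1 ≤ m) {e k : ℕ} (h0 : k ≠ 0) (h : k ≠ 2 ^ e * m) :
    2 ∣ binomCoeff m (2 ^ e) k := by
  rw [binomCoeff_eq hm]
  split_ifs with h1
  · obtain ⟨c, rfl⟩ := h1
    rw [Nat.mul_div_cancel_left _ (by omega)]
    refine Nat.prime_two.dvd_choose_pow ?_ ?_
    · rintro rfl; simp at h0
    · rintro rfl; exact h (mul_comm _ _)
  · exact dvd_zero _

end BinomCoeff

/-! ### Reduction modulo 2 -/

section Integral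
variable {K : Type*} [Field K] [CharP K 2] [IsAlgClosed K]

local notation "ι" => algebraMap (WittVector 2 K) (FractionRing (WittVector 2 K))

lemma map_mem_truncSubring (h : MvPowerSeries (Fin 2) (WittVector 2 K)) (r : ℕ) :
    MvPowerSeries.map ι h ∈ truncSubring (wittInt K) r := fun d _ => by
  rw [coeff_map]; exact ⟨_, rfl⟩

/-- An integral half means that the coefficients differ by elements of `2 W(K)`, which reduction
kills. Identities over `K` are thus proved by congruences in the fraction field. -/
lemma map_constantCoeff_eq_of_half_sub_mem {u : FractionRing (WittVector 2 K)} (hu : 2 * u = 1)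
    {a b : MvPowerSeries (Fin 2) (WittVector 2 K)}
    (h : ∀ r, C u * (MvPowerSeries.map ι a - MvPowerSeries.map ι b) ∈ truncSubring (wittInt K) r) :
    MvPowerSeries.map (WittVector.constantCoeff : WittVector 2 K →+* K) a
      = MvPowerSeries.map WittVector.constantCoeff b := by
  ext d
  obtain ⟨y, hy⟩ := h (d.degree + 1) d (by omega)
  rw [coeff_C_mul, map_sub, coeff_map, coeff_map] at hy
  have : coeff d a - coeff d b = 2 * y := by
    refine IsFractionRing.injective (WittVector 2 K) (FractionRing (WittVector 2 K)) ?_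
    rw [map_sub, map_mul, map_ofNat, hy, ← mul_assoc, hu, one_mul]
  rw [coeff_map, coeff_map, ← sub_eq_zero, ← map_sub, this, constantCoeff_two_mul]

end Integral

/-! ### Constructing endomorphisms from twisted commutation relations -/

section Lift
variable (n m : ℕ) (K : Type*) [Field K] [CharP K 2] [IsAlgClosed K]

local notation "𝔼" => FractionRing (WittVector 2 K)
local notation "ι" => algebraMap (WittVector 2 K) (FractionRing (WittVector 2 K))

/-- The logarithm coefficients in the fraction field of the Witt vectors. -/
noncomputable def wittLog (k : ℕ) : 𝔼 := (logEval n m k : 𝔼)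

/-- `(1 + (1 + T ^ m) ^ N) / 2`. -/
noncomputable def wittSpecial (k : ℕ) : 𝔼 := 2⁻¹ * (twOne k + (binomCoeff m (orb n) k : 𝔼))

variable {n m K}

lemma two_mul_half : (2 : 𝔼) * 2⁻¹ = 1 := by
  have := charZero_fractionRing_witt (K := K)
  exact mul_inv_cancel₀ two_ne_zero

lemma pow_ratCast (i : ℕ) (x : ℚ) : (wittFrob K ^ i) (x : 𝔼) = x := by
  induction i with
  | zero => rfl
  | succ i ih => rw [pow_succ', RingHom.mul_def, RingHom.comp_apply, ih, map_ratCast]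

/-- Used for rational coefficients: Frobenius fixes them, so rational sequences multiply by
commutative convolution. -/
lemma twMul_of_fixed {σ : 𝔼 →+* 𝔼} {a b : ℕ → 𝔼} (hb : ∀ i k, (σ ^ i) (b k) = b k) (k : ℕ) :
    twMul σ a b k = ∑ p ∈ antidiagonal k, a p.1 * b p.2 :=
  sum_congr rfl fun p _ => by rw [hb]

lemma wittLog_zero : wittLog n m K 0 = 1 := by
  rw [wittLog, logEval_zero, Rat.cast_one]

lemma twMul_wittLog_add (hm : 1 ≤ m) (k : ℕ) : wittLog n m K k
    + twMul (wittFrob K) (wittLog n m K) (fun k => (binomCoeff m (orb n) k : 𝔼)) k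
      = 2 * (binomCoeff m (orb n) k : 𝔼) := by
  have := charZero_fractionRing_witt (K := K)
  have h := congrArg (fun x : ℚ => (x : 𝔼)) (logEval_add n m hm k)
  rw [twMul_of_fixed fun i k => map_natCast _ _]
  simp only [Rat.cast_add, Rat.cast_mul, Rat.cast_sum, Rat.cast_natCast, Rat.cast_ofNat] at h
  exact h

/-- `λ` and `q` are rational and so commute; `λ + λ q = 2 q` becomes `(1 + q) λ = 2 q`. -/
lemma twMul_wittSpecial (hm : 1 ≤ m) (k : ℕ) :
    twMul (wittFrob K) (wittSpecial n m K) (wittLog n m K) k = (binomCoeff m (orb n) k : 𝔼) := by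
  have h := twMul_wittLog_add (n := n) (K := K) hm k
  have h1 : twMul (wittFrob K) (wittLog n m K) (fun k => (binomCoeff m (orb n) k : 𝔼)) k
      = twMul (wittFrob K) (fun k => (binomCoeff m (orb n) k : 𝔼)) (wittLog n m K) k := by
    rw [twMul_of_fixed fun i k => map_natCast _ _,
      twMul_of_fixed (b := wittLog n m K) fun i k => pow_ratCast _ _, ← Finset.Nat.sum_antidiagonal_swap]
    exact sum_congr rfl fun p _ => mul_comm _ _
  have h2 : twMul (wittFrob K) (wittSpecial n m K) (wittLog n m K) k
      = 2⁻¹ * (twMul (wittFrob K) twOne (wittLog n m K) k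
        + twMul (wittFrob K) (fun k => (binomCoeff m (orb n) k : 𝔼)) (wittLog n m K) k) := by
    simp only [twMul, wittSpecial, ← sum_add_distrib, mul_sum]
    exact sum_congr rfl fun p _ => by ring
  rw [h2, one_twMul, ← h1, h, ← mul_assoc, mul_comm (2⁻¹ : 𝔼), two_mul_half, one_mul]

lemma two_mul_wittSpecial_mem (k : ℕ) : 2 * wittSpecial n m K k ∈ wittInt K := by
  rw [wittSpecial, ← mul_assoc, two_mul_half, one_mul, twOne]
  refine add_mem ?_ (natCast_mem _ _)
  split_ifs
  exacts [one_mem _, zero_mem _]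

lemma two_pow_mul_wittLog_mem (hm : 1 ≤ m) (k : ℕ) : 2 ^ k * wittLog n m K k ∈ wittInt K := by
  obtain ⟨s, -, -, h⟩ := twMul_funEq (wittFrob K) (A := wittInt K)
    (fun a ha i => sigma_pow_mem wittFrob_spec i ha) two_mul_half
    (fun k => natCast_mem (wittInt K) (binomCoeff m (orb n) k))
    (by rw [binomCoeff_zero hm, Nat.cast_one]) (twMul_wittLog_add (n := n) hm)
  exact h k

variable (n m K) in
/-- The specialized formal group law over the Witt vectors. -/
noncomputable def wittFGL : FormalGroup (WittVector 2 K) := specialFGL n m (ZLoc2.toWitt K)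

variable (n m K) in
/-- The logarithm of `wittFGL`. -/
noncomputable def wittLogSeries : PowerSeries 𝔼 := typicalSeries (wittLog n m K)

lemma wittFGL_log : (wittLogSeries n m K).subst ((wittFGL n m K).map ι).toPowerSeries
    = (wittLogSeries n m K).subst (X 0 : MvPowerSeries (Fin 2) 𝔼)
      + (wittLogSeries n m K).subst (X 1 : MvPowerSeries (Fin 2) 𝔼) := by
  have := charZero_fractionRing_witt (K := K)
  rw [wittFGL, specialFGL_map]
  exact specialFGL_log n m _

lemma wittLogSeries_add {τ : Type*} {a b : MvPowerSeries τ 𝔼} (ha : constantCoeff a = 0)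
    (hb : constantCoeff b = 0) :
    (wittLogSeries n m K).subst (((wittFGL n m K).map ι).toPowerSeries.subst ![a, b])
      = (wittLogSeries n m K).subst a + (wittLogSeries n m K).subst b := by
  have hab : HasSubst ![a, b] := hasSubst_of_constantCoeff_nilpotent fun s => by
    fin_cases s <;> simp [ha, hb]
  have hFs := PowerSeries.HasSubst.of_constantCoeff_zero
    ((wittFGL n m K).map ι).zero_constantCoeff
  have hsub : ∀ i : Fin 2, ((wittLogSeries n m K).subst
      (X i : MvPowerSeries (Fin 2) 𝔼)).subst ![a, b] = (wittLogSeries n m K).subst (![a, b] i) :=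
    fun i => by
      rw [PowerSeries.subst, subst_comp_subst_apply
        (PowerSeries.HasSubst.of_constantCoeff_zero (constantCoeff_X i)).const hab]
      simp only [subst_X hab]
      rfl
  have h1 : (wittLogSeries n m K).subst (((wittFGL n m K).map ι).toPowerSeries.subst ![a, b])
      = ((wittLogSeries n m K).subst ((wittFGL n m K).map ι).toPowerSeries).subst ![a, b] := by
    rw [PowerSeries.subst, PowerSeries.subst, subst_comp_subst_apply hFs.const hab]
  rw [h1, wittFGL_log, subst_add hab, hsub, hsub]
  rfl

variable (n m) in
/-- An endomorphism of the reduction of `wittFGL`, from a solution `c` of the commutation relation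
with the special element. -/
theorem exists_endomorphism_of_twisted (hm : 1 ≤ m) (c : ℕ → WittVector 2 K) {c' : ℕ → 𝔼}
    (hc' : ∀ k, c' k ∈ wittInt K)
    (h : twMul (wittFrob K) (wittSpecial n m K) (fun k => ι (c k))
      = twMul (wittFrob K) c' (wittSpecial n m K)) :
    ∃ φ : PowerSeries K, φ.constantCoeff = 0 ∧ φ.coeff 1 = WittVector.constantCoeff (c 0) ∧
      φ.subst ((wittFGL n m K).map WittVector.constantCoeff).toPowerSeries
        = ((wittFGL n m K).map WittVector.constantCoeff).toPowerSeries.subst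
          ![φ.subst (X 0 : MvPowerSeries (Fin 2) K), φ.subst (X 1 : MvPowerSeries (Fin 2) K)] := by
  set f := wittLogSeries n m K with hf
  have hf0 : f.constantCoeff = 0 := constantCoeff_typicalSeries _
  have hf1 : f.coeff 1 = 1 := by rw [hf, wittLogSeries, coeff_one_typicalSeries, wittLog_zero]
  let _ : Invertible (f.coeff 1) := hf1 ▸ invertibleOne
  -- The candidate is `ψ = f⁻¹ ∘ g`, where `f` is the logarithm and `g` is the series of `c * λ`.
  set g := typicalSeries (twMul (wittFrob K) (fun k => ι (c k)) (wittLog n m K)) with hg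
  have hg0 : g.constantCoeff = 0 := constantCoeff_typicalSeries _
  have hgs := PowerSeries.HasSubst.of_constantCoeff_zero' hg0
  have his : PowerSeries.HasSubst f.substInv :=
    PowerSeries.HasSubst.of_constantCoeff_zero' (PowerSeries.constantCoeff_substInv f)
  set ψ : PowerSeries 𝔼 := f.substInv.subst g with hψ
  have hψ0 : ψ.constantCoeff = 0 :=
    PowerSeries.constantCoeff_subst_eq_zero hg0 _ (PowerSeries.constantCoeff_substInv f)
  have hψs := PowerSeries.HasSubst.of_constantCoeff_zero' hψ0
  have hfψ : f.subst ψ = g := by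
    rw [hψ, ← PowerSeries.subst_comp_subst_apply his hgs, PowerSeries.subst_substInv_right f hf0,
      PowerSeries.subst_X hgs]
  have hfψ' : ∀ {τ : Type} (a : MvPowerSeries τ 𝔼), constantCoeff a = 0 →
      f.subst (ψ.subst a) = g.subst a := fun a ha => by
    rw [← PowerSeries.subst_comp_subst_apply hψs (PowerSeries.HasSubst.of_constantCoeff_zero ha),
      hfψ]
  have hψa : ∀ {τ : Type} (a : MvPowerSeries τ 𝔼), constantCoeff a = 0 →
      constantCoeff (ψ.subst a) = 0 := fun a ha =>
    PowerSeries.constantCoeff_subst_eq_zero ha _ hψ0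
  have hq0 : ((binomCoeff m (orb n) 0 : ℕ) : 𝔼) = 1 := by rw [binomCoeff_zero hm, Nat.cast_one]
  -- Integrality of `ψ`: `w (c λ) = c' w λ = c' q`, and `c' q` is integral. The available criterion
  -- concerns two variables, so `ψ` is tested on `X 0`.
  have hint : ∀ r, ψ.subst (X 0 : MvPowerSeries (Fin 2) 𝔼) ∈ truncSubring (wittInt K) r := by
    refine mem_truncSubring_of_log wittFrob_spec two_mul_half two_mul_wittSpecial_mem
      (two_pow_mul_wittLog_mem hm) (twMul_wittSpecial (n := n) hm)
      (fun k => natCast_mem (wittInt K) _) hq0 (hψa _ (constantCoeff_X 0)) fun r k hrk => ?_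
    have e1 : (typicalSeries (wittLog n m K)).subst (ψ.subst (X 0 : MvPowerSeries (Fin 2) 𝔼))
        = g.subst (X 0 : MvPowerSeries (Fin 2) 𝔼) := hfψ' _ (constantCoeff_X 0)
    rw [e1, hg]
    have e2 := le_order_twisted_typicalSeries (σ := wittFrob K) (wittSpecial n m K)
      (twMul (wittFrob K) (fun k => ι (c k)) (wittLog n m K)) 0 k
    have e3 : twMul (wittFrob K) (wittSpecial n m K)
        (twMul (wittFrob K) (fun k => ι (c k)) (wittLog n m K))
        = twMul (wittFrob K) c' fun k => (binomCoeff m (orb n) k : 𝔼) := by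
      rw [← twMul_assoc, h, twMul_assoc]
      congr 1
      funext k
      exact twMul_wittSpecial hm k
    rw [e3] at e2
    have e4 := add_mem (mem_of_le_order (A := wittInt K) (le_trans (by exact_mod_cast hrk) e2))
      (typicalSeries_subst_mem (A := wittInt K) (l := twMul (wittFrob K) c'
        fun k => (binomCoeff m (orb n) k : 𝔼)) (fun k => sum_mem fun p _ => mul_mem (hc' _)
          (sigma_pow_mem wittFrob_spec _ (natCast_mem _ _))) (constantCoeff_X 0)
          (fun r => X_mem 0) r)
    rwa [sub_add_cancel] at e4
  have hcoef : ∀ d, ψ.coeff d ∈ wittInt K := fun d => by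
    have := hint (d + 1) (Finsupp.single 0 d) (by simp)
    rw [PowerSeries.coeff_subst_single] at this
    simpa using this
  choose p hp using hcoef
  set φ : PowerSeries (WittVector 2 K) := PowerSeries.mk p with hφ
  have hφψ : PowerSeries.map ι φ = ψ := by
    ext d
    rw [PowerSeries.coeff_map, hφ, PowerSeries.coeff_mk, hp]
  have hinj := IsFractionRing.injective (WittVector 2 K) 𝔼
  have hφ0 : φ.constantCoeff = 0 := hinj (by
    rw [← PowerSeries.coeff_zero_eq_constantCoeff_apply, ← PowerSeries.coeff_map, hφψ,
      PowerSeries.coeff_zero_eq_constantCoeff_apply, hψ0, map_zero])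
  refine ⟨PowerSeries.map WittVector.constantCoeff φ, ?_, ?_, ?_⟩
  · rw [← PowerSeries.coeff_zero_eq_constantCoeff_apply, PowerSeries.coeff_map,
      PowerSeries.coeff_zero_eq_constantCoeff_apply, hφ0, map_zero]
  · rw [PowerSeries.coeff_map]
    congr 1
    refine hinj ?_
    rw [← PowerSeries.coeff_map, hφψ]
    have e : PowerSeries.coeff 1 (f.subst ψ) = ψ.coeff 1 := by
      rw [coeff_one_subst _ hψ0, hf1, one_mul]
    rw [← e, hfψ, hg, coeff_one_typicalSeries, twMul_zero_apply, wittLog_zero, mul_one]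
  · set F := wittFGL n m K with hF
    have hF0 := F.zero_constantCoeff
    have hFs := PowerSeries.HasSubst.of_constantCoeff_zero hF0
    have hXs : ∀ i : Fin 2, PowerSeries.HasSubst (X i : MvPowerSeries (Fin 2) (WittVector 2 K)) :=
      fun i => PowerSeries.HasSubst.X i
    have hφX : ∀ i : Fin 2, constantCoeff
        (φ.subst (X i : MvPowerSeries (Fin 2) (WittVector 2 K))) = 0 :=
      fun i => PowerSeries.constantCoeff_subst_eq_zero (constantCoeff_X i) _ hφ0
    have hφXs : HasSubst ![φ.subst (X 0 : MvPowerSeries (Fin 2) (WittVector 2 K)),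
        φ.subst (X 1 : MvPowerSeries (Fin 2) (WittVector 2 K))] :=
      hasSubst_of_constantCoeff_zero fun s => by fin_cases s <;> simp [hφX]
    have hmap1 : ∀ {S : Type _} [CommRing S] (j : WittVector 2 K →+* S), MvPowerSeries.map j
        (φ.subst F.toPowerSeries) = (PowerSeries.map j φ).subst (F.map j).toPowerSeries :=
      fun j => PowerSeries.map_subst hFs _
    have hmap2 : ∀ {S : Type _} [CommRing S] (j : WittVector 2 K →+* S), MvPowerSeries.map j
        (F.toPowerSeries.subst ![φ.subst (X 0 : MvPowerSeries (Fin 2) (WittVector 2 K)),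
          φ.subst (X 1 : MvPowerSeries (Fin 2) (WittVector 2 K))])
        = (F.map j).toPowerSeries.subst ![(PowerSeries.map j φ).subst (X 0 : MvPowerSeries (Fin 2) S),
          (PowerSeries.map j φ).subst (X 1 : MvPowerSeries (Fin 2) S)] := fun j => by
      rw [map_subst hφXs]
      congr 1
      funext i
      fin_cases i
      · simp [PowerSeries.map_subst (hXs 0)]
      · simp [PowerSeries.map_subst (hXs 1)]
    rw [← hmap1, ← hmap2]
    -- The lift `φ` need not be an endomorphism over `W(K)`, since `g` involves the Frobenius twist.
    -- It is one modulo 2, because `g (F (x, y))` and `g x + g y` differ by twice an integral series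
    -- and congruences modulo 2 can be read through `f`.
    refine map_constantCoeff_eq_of_half_sub_mem two_mul_half ?_
    have hFE0 := (F.map ι).zero_constantCoeff
    refine half_sub_mem_of_log two_mul_half (two_pow_mul_wittLog_mem (n := n) hm) wittLog_zero
      ?_ ?_ (map_mem_truncSubring _) ?_
    · rw [hmap1, hφψ]; exact hψa _ hFE0
    · rw [hmap2, hφψ]
      refine constantCoeff_subst_eq_zero (hasSubst_of_constantCoeff_zero fun s => ?_)
        (fun s => ?_) hFE0
      · fin_cases s
        · exact hψa _ (constantCoeff_X 0)
        · exact hψa _ (constantCoeff_X 1)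
      · fin_cases s
        · exact hψa _ (constantCoeff_X 0)
        · exact hψa _ (constantCoeff_X 1)
    · rw [hmap1, hmap2, hφψ]
      have e1 : (typicalSeries (wittLog n m K)).subst (ψ.subst (F.map ι).toPowerSeries)
          = g.subst (F.map ι).toPowerSeries := hfψ' _ hFE0
      have e2 : (typicalSeries (wittLog n m K)).subst ((F.map ι).toPowerSeries.subst
          ![ψ.subst (X 0 : MvPowerSeries (Fin 2) 𝔼), ψ.subst (X 1 : MvPowerSeries (Fin 2) 𝔼)])
          = g.subst (X 0 : MvPowerSeries (Fin 2) 𝔼) + g.subst (X 1 : MvPowerSeries (Fin 2) 𝔼) := by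
        rw [← hfψ' _ (constantCoeff_X 0), ← hfψ' _ (constantCoeff_X 1)]
        exact wittLogSeries_add (hψa _ (constantCoeff_X 0)) (hψa _ (constantCoeff_X 1))
      rw [e1, e2]
      exact half_twisted_log_mem wittFrob_spec two_mul_half (fun k => ⟨c k, rfl⟩)
        (two_pow_mul_wittLog_mem hm) hFE0 (map_mem_truncSubring _) wittFGL_log

end Lift

/-! ### Solving `w c = φ ^ h (c) w` -/

section Twist
variable (n m : ℕ) {K : Type*} [Field K] [CharP K 2] [IsAlgClosed K]

local notation "𝔼" => FractionRing (WittVector 2 K)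
local notation "ι" => algebraMap (WittVector 2 K) (FractionRing (WittVector 2 K))
local notation "Φ" => (WittVector.frobenius : WittVector 2 K →+* WittVector 2 K)

/-- The coefficients below degree `h` of the special element `(1 + (1 + T ^ m) ^ N) / 2`. -/
noncomputable def specialNat (k : ℕ) : ℕ :=
  if k = 0 then 1 else if k < height n m then binomCoeff m (orb n) k / 2 else 0

variable {n m}

lemma one_le_height (hm : 1 ≤ m) : 1 ≤ height n m :=
  Nat.mul_pos (orb_pos n) hm

/-- The polynomial `q` has coefficient 1 in degrees 0 and `h` and even coefficients between, so `w`
is an integral polynomial of degree below `h` plus `T ^ h / 2`. -/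
lemma wittSpecial_eq (hm : 1 ≤ m) (k : ℕ) : wittSpecial n m K k
    = (specialNat n m k : 𝔼) + if k = height n m then 2⁻¹ else 0 := by
  have hh := one_le_height (n := n) hm
  have h2 := two_mul_half (K := K)
  rw [wittSpecial, specialNat, twOne]
  rcases eq_or_ne k 0 with rfl | hk0
  · rw [binomCoeff_zero hm, if_pos rfl, if_pos rfl, if_neg (by omega)]
    push_cast
    linear_combination h2
  rw [if_neg hk0, if_neg hk0]
  rcases lt_trichotomy k (height n m) with hk | hk | hk
  · obtain ⟨c, hc⟩ := two_dvd_binomCoeff hm hk0 (e := n - 1) hk.ne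
    rw [if_pos hk, if_neg hk.ne, hc, Nat.mul_div_cancel_left _ two_pos]
    push_cast
    linear_combination (c : 𝔼) * h2
  · rw [if_neg (by omega), if_pos hk, hk, height, binomCoeff_top hm]
    simp
  · rw [if_neg (by omega), if_neg (by omega), binomCoeff_of_lt hm hk]
    simp

variable (n m) in
/-- A solution of `w * c = φ ^ h (c) * w` with leading coefficient the Teichmüller lift of `x`. -/
noncomputable def twistSol (hm : 1 ≤ m) (x : K) : ℕ → WittVector 2 K
  | 0 => WittVector.teichmuller 2 x
  | k + 1 => (surjective_sub_frobenius_pow (one_le_height (n := n) hm)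
      (∑ j : Fin (k + 1), (specialNat n m (k + 1 - j) : WittVector 2 K)
        * ((Φ ^ height n m) (twistSol hm x j) - (Φ ^ (k + 1 - (j : ℕ))) (twistSol hm x j)))).choose

lemma twistSol_succ (hm : 1 ≤ m) (x : K) (k : ℕ) :
    twistSol n m hm x (k + 1) - (Φ ^ height n m) (twistSol n m hm x (k + 1))
      = ∑ j ∈ range (k + 1), (specialNat n m (k + 1 - j) : WittVector 2 K)
        * ((Φ ^ height n m) (twistSol n m hm x j) - (Φ ^ (k + 1 - j)) (twistSol n m hm x j)) := by
  rw [← Fin.sum_univ_eq_sum_range (fun j => (specialNat n m (k + 1 - j) : WittVector 2 K)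
        * ((Φ ^ height n m) (twistSol n m hm x j) - (Φ ^ (k + 1 - j)) (twistSol n m hm x j)))]
  conv_lhs => rw [twistSol]
  exact (surjective_sub_frobenius_pow (one_le_height (n := n) hm) _).choose_spec

lemma frobenius_pow_teichmuller (i : ℕ) (x : K) :
    (Φ ^ i) (WittVector.teichmuller 2 x) = WittVector.teichmuller 2 (x ^ 2 ^ i) := by
  induction i with
  | zero => simp
  | succ i ih =>
    rw [pow_succ', RingHom.mul_def, RingHom.comp_apply, ih, WittVector.frobenius_eq_map_frobenius,
      WittVector.map_teichmuller, frobenius_def, ← pow_mul, ← pow_succ]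

/-- As `w` has leading coefficient 1, degree `k` prescribes `c_k - φ ^ h (c_k)` in terms of earlier
coefficients, which is the recursion. In degree 0 it asks that `φ ^ h` fix `c_0`, true for the
Teichmüller lift of an element of `𝔽_{2 ^ h}`. -/
lemma twistSol_spec (hm : 1 ≤ m) {x : K} (hx : x ^ 2 ^ height n m = x) (k : ℕ) :
    ∑ p ∈ antidiagonal k, (specialNat n m p.1 : WittVector 2 K)
        * (Φ ^ p.1) (twistSol n m hm x p.2)
      = ∑ p ∈ antidiagonal k, (Φ ^ height n m) (twistSol n m hm x p.1)
        * (specialNat n m p.2 : WittVector 2 K) := by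
  rw [← Finset.Nat.sum_antidiagonal_swap, ← sub_eq_zero, ← sum_sub_distrib,
    Finset.Nat.sum_antidiagonal_eq_sum_range_succ_mk, sum_range_succ]
  have h0 : specialNat n m 0 = 1 := if_pos rfl
  simp only [Prod.fst_swap, Prod.snd_swap, Nat.sub_self, h0, Nat.cast_one, one_mul, mul_one,
    pow_zero, RingHom.one_def, RingHom.id_apply]
  rcases k with _ | k
  · rw [twistSol, frobenius_pow_teichmuller, hx]
    simp
  · rw [twistSol_succ, ← sum_add_distrib]
    exact sum_eq_zero fun j _ => by ring

lemma twMul_wittSpecial_twistSol (hm : 1 ≤ m) {x : K} (hx : x ^ 2 ^ height n m = x) :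
    twMul (wittFrob K) (wittSpecial n m K) (fun k => ι (twistSol n m hm x k))
      = twMul (wittFrob K) (fun k => ι ((Φ ^ height n m) (twistSol n m hm x k)))
        (wittSpecial n m K) := by
  have hfix : ∀ i k, (wittFrob K ^ i) (wittSpecial n m K k) = wittSpecial n m K k := fun i k => by
    simp only [wittSpecial, twOne, map_mul, map_inv₀, map_ofNat, map_add, map_natCast]
    split_ifs <;> simp
  funext k
  rw [twMul_of_fixed hfix]
  simp only [twMul, wittSpecial_eq hm, add_mul, mul_add, sum_add_distrib]
  congr 1
  · have h := congrArg ι (twistSol_spec hm hx k)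
    simpa only [map_sum, map_mul, map_natCast, wittFrob_pow_algebraMap] using h
  -- The non-integral part matches by itself, since `T ^ h c = φ ^ h (c) T ^ h`. This is why the
  -- right-hand factor is `φ ^ h (c)`.
  · rw [← Finset.Nat.sum_antidiagonal_swap]
    refine sum_congr rfl fun p _ => ?_
    simp only [Prod.fst_swap, Prod.snd_swap]
    split_ifs with h1
    · rw [h1, wittFrob_pow_algebraMap, mul_comm]
    · simp

variable (n) in
/-- Every element of `𝔽_{2 ^ h}` is the linear coefficient of an endomorphism. -/
theorem exists_endomorphism (hm : 1 ≤ m) {x : K} (hx : x ^ 2 ^ height n m = x) :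
    ∃ φ : PowerSeries K, φ.constantCoeff = 0 ∧ φ.coeff 1 = x ∧
      φ.subst ((wittFGL n m K).map WittVector.constantCoeff).toPowerSeries
        = ((wittFGL n m K).map WittVector.constantCoeff).toPowerSeries.subst
          ![φ.subst (X 0 : MvPowerSeries (Fin 2) K), φ.subst (X 1 : MvPowerSeries (Fin 2) K)] := by
  obtain ⟨φ, h0, h1, h2⟩ := exists_endomorphism_of_twisted n m hm (twistSol n m hm x)
    (fun k => ⟨_, rfl⟩) (twMul_wittSpecial_twistSol hm hx)
  refine ⟨φ, h0, ?_, h2⟩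
  rw [h1, twistSol]
  exact WittVector.teichmuller_coeff_zero 2 x

end Twist

/-! ### Points of formal group laws and the action of endomorphisms -/

section Points
variable {R S : Type*} [CommRing R] [CommRing S] {τ υ : Type*} (F : FormalGroup R)

lemma hasSubst_pair {a b : MvPowerSeries τ R} (ha : PowerSeries.HasSubst a)
    (hb : PowerSeries.HasSubst b) : HasSubst ![a, b] :=
  hasSubst_of_constantCoeff_nilpotent fun s => by fin_cases s; exacts [ha, hb]

lemma hasSubst_formalGroup : PowerSeries.HasSubst F.toPowerSeries :=
  PowerSeries.HasSubst.of_constantCoeff_zero F.zero_constantCoeff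

/-- Change of rings for points of a formal group law. -/
noncomputable def pointMap (f : R →+* S) : F.Point τ →+ (F.map f).Point τ where
  toFun a := ⟨MvPowerSeries.map f a.val, by
    have : IsNilpotent (constantCoeff a.val) := a.2
    change IsNilpotent _
    rw [constantCoeff_map]
    exact this.map f⟩
  map_zero' := Subtype.ext (map_zero _)
  map_add' a b := Subtype.ext (by
    change MvPowerSeries.map f (F.toPowerSeries.subst ![a.val, b.val])
      = (MvPowerSeries.map f F.toPowerSeries).subst
        ![MvPowerSeries.map f a.val, MvPowerSeries.map f b.val]
    rw [map_subst (hasSubst_pair a.2 b.2)]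
    congr 1
    funext i
    fin_cases i <;> rfl)

/-- Substituting a point into power series without constant term. -/
noncomputable def pointPull (a : F.Point υ) [Finite τ] : F.Point τ →+ F.Point υ where
  toFun b := ⟨b.val.subst fun _ : τ => a.val,
    IsNilpotent_subst (hasSubst_of_constantCoeff_nilpotent fun _ => a.2) b.2⟩
  map_zero' := Subtype.ext (by
    have h : HasSubst fun _ : τ => a.val := hasSubst_of_constantCoeff_nilpotent fun _ => a.2
    change (0 : MvPowerSeries τ R).subst _ = _
    rw [← coe_substAlgHom h, map_zero]; rfl)
  map_add' b c := Subtype.ext (by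
    have h : HasSubst fun _ : τ => a.val := hasSubst_of_constantCoeff_nilpotent fun _ => a.2
    change (F.toPowerSeries.subst ![b.val, c.val]).subst _ = F.toPowerSeries.subst ![_, _]
    rw [subst_comp_subst_apply (hasSubst_pair b.2 c.2) h]
    congr 1
    funext i
    fin_cases i <;> rfl)

/-- `φ` is an endomorphism of `F`. -/
structure IsEndo (φ : PowerSeries R) : Prop where
  constantCoeff_eq : φ.constantCoeff = 0
  subst_eq : φ.subst F.toPowerSeries = F.toPowerSeries.subst
    ![φ.subst (X 0 : MvPowerSeries (Fin 2) R), φ.subst (X 1 : MvPowerSeries (Fin 2) R)]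

variable {F}

lemma subst_isNilpotent {φ : PowerSeries R} (h : φ.constantCoeff = 0) {a : MvPowerSeries τ R}
    (ha : PowerSeries.HasSubst a) : PowerSeries.HasSubst (φ.subst a) :=
  IsNilpotent_subst ha.const (by
    change IsNilpotent φ.constantCoeff
    rw [h]; exact IsNilpotent.zero)

/-- The action of an endomorphism on points. -/
noncomputable def IsEndo.onPoints {φ : PowerSeries R} (h : IsEndo F φ) :
    AddMonoid.End (F.Point τ) where
  toFun a := ⟨φ.subst a.val, subst_isNilpotent h.1 a.2⟩
  map_zero' := Subtype.ext (PowerSeries.subst_zero_of_constantCoeff_zero h.1)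
  map_add' a b := Subtype.ext (by
    have hab := hasSubst_pair a.2 b.2
    change φ.subst (F.toPowerSeries.subst ![a.val, b.val]) = F.toPowerSeries.subst ![_, _]
    have hX : ∀ i : Fin 2, PowerSeries.HasSubst (φ.subst (X i : MvPowerSeries (Fin 2) R)) :=
      fun i => subst_isNilpotent h.1 (PowerSeries.HasSubst.X i)
    have e : φ.subst (F.toPowerSeries.subst ![a.val, b.val])
        = (φ.subst F.toPowerSeries).subst ![a.val, b.val] := by
      rw [PowerSeries.subst, PowerSeries.subst,
        subst_comp_subst_apply (hasSubst_formalGroup F).const hab]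
    have hsub : ∀ i : Fin 2, (φ.subst (X i : MvPowerSeries (Fin 2) R)).subst ![a.val, b.val]
        = φ.subst (![a.val, b.val] i) := fun i => by
      rw [PowerSeries.subst, subst_comp_subst_apply (PowerSeries.HasSubst.X i).const hab]
      simp only [subst_X hab]
      rfl
    rw [e, h.2, subst_comp_subst_apply (hasSubst_pair (hX 0) (hX 1)) hab]
    congr 1
    funext i
    fin_cases i
    · exact hsub 0
    · exact hsub 1)

lemma IsEndo.onPoints_val {φ : PowerSeries R} (h : IsEndo F φ) (a : F.Point τ) :
    (h.onPoints a).val = φ.subst a.val := rfl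

lemma isComm_map [F.IsComm] (f : R →+* S) : (F.map f).IsComm where
  comm := by
    have h := congrArg (MvPowerSeries.map f) (FormalGroup.IsComm.comm (F := F))
    rw [map_subst HasSubst.X_X] at h
    refine h.trans ?_
    congr 1
    funext i
    fin_cases i <;> simp

lemma isComm_of_map {f : R →+* S} (hf : Function.Injective f) [(F.map f).IsComm] : F.IsComm where
  comm := by
    refine map_injective_of_injective hf ?_
    rw [map_subst HasSubst.X_X]
    refine (FormalGroup.IsComm.comm (F := F.map f)).trans ?_
    congr 1
    funext i
    fin_cases i <;> simp

end Points

/-! ### The Frobenius endomorphism -/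

section Frobenius
variable (n m : ℕ) {K : Type*} [Field K] [CharP K 2] {τ : Type*}

/-- The coefficients come from `ℤ_(2)`, hence lie in the prime field, and squaring acts only on the
variables. -/
lemma specialFGL_toPowerSeries_sq (j : ZLoc2 →+* K) :
    (specialFGL n m j).toPowerSeries ^ 2 = expand 2 two_ne_zero (specialFGL n m j).toPowerSeries := by
  rw [← map_frobenius_expand 2 two_ne_zero, map_expand]
  congr 1
  change ((specialFGL n m j).map _).toPowerSeries = _
  rw [specialFGL_map, Subsingleton.elim ((frobenius K 2).comp j) j]

/-- The Frobenius on the points of a formal group law defined over the prime field. -/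
noncomputable def pointFrob (j : ZLoc2 →+* K) :
    AddMonoid.End ((specialFGL n m j).Point τ) where
  toFun a := ⟨a.val ^ 2, by
    have h : IsNilpotent (constantCoeff a.val) := a.2
    change IsNilpotent _
    rw [map_pow]
    exact h.pow_succ 1⟩
  map_zero' := Subtype.ext (by simp)
  map_add' a b := Subtype.ext (by
    have hab := hasSubst_pair a.2 b.2
    change ((specialFGL n m j).toPowerSeries.subst ![a.val, b.val]) ^ 2
      = (specialFGL n m j).toPowerSeries.subst ![a.val ^ 2, b.val ^ 2]
    rw [← subst_pow hab, specialFGL_toPowerSeries_sq, expand, coe_substAlgHom,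
      subst_comp_subst_apply (HasSubst.X_pow two_ne_zero) hab]
    congr 1
    funext i
    rw [subst_pow hab, subst_X hab]
    fin_cases i <;> rfl)

variable {n m}

lemma pointFrob_pow_val (j : ZLoc2 →+* K) (i : ℕ) (a : (specialFGL n m j).Point τ) :
    ((pointFrob n m j ^ i) a).val = a.val ^ 2 ^ i := by
  induction i with
  | zero => simp
  | succ i ih =>
    rw [pow_succ', pow_succ 2, pow_mul, ← ih]
    rfl

end Frobenius

/-! ### The polynomial equation of Frobenius -/

section Relation
variable (n m : ℕ) {K : Type*} [Field K] [CharP K 2] [IsAlgClosed K] {τ : Type*}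

local notation "𝔼" => FractionRing (WittVector 2 K)
local notation "ι" => algebraMap (WittVector 2 K) (FractionRing (WittVector 2 K))

/-- The logarithm turns the law into addition over the fraction field, where it determines its
argument. Commutativity then descends to `W(K)`. -/
instance isComm_wittFGL : (wittFGL n m K).IsComm := by
  have : ((wittFGL n m K).map ι).IsComm := ⟨by
    have h0 := ((wittFGL n m K).map ι).zero_constantCoeff
    have hX : HasSubst ![(X 1 : MvPowerSeries (Fin 2) 𝔼), X 0] := HasSubst.X_X
    refine subst_injective_of_log (f := wittLogSeries n m K) (constantCoeff_typicalSeries _)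
      (by rw [wittLogSeries, coeff_one_typicalSeries, wittLog_zero]) h0
      (constantCoeff_subst_eq_zero hX (fun s => by fin_cases s <;> simp) h0) ?_
    rw [wittLogSeries_add (constantCoeff_X 1) (constantCoeff_X 0), wittFGL_log, add_comm]⟩
  exact isComm_of_map (IsFractionRing.injective (WittVector 2 K) 𝔼)

instance isComm_wittFGL_map {S : Type*} [CommRing S] (f : WittVector 2 K →+* S) :
    ((wittFGL n m K).map f).IsComm := isComm_map f

instance isComm_specialFGL (j : ZLoc2 →+* K) : (specialFGL n m j).IsComm := by
  have h : specialFGL n m j = (wittFGL n m K).map WittVector.constantCoeff := by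
    rw [wittFGL, specialFGL_map]
    congr 1
    exact Subsingleton.elim _ _
  rw [h]
  infer_instance

variable {n m}

/-- The logarithm on the points of `wittFGL`. -/
noncomputable def wittLogHom : (wittFGL n m K).Point τ →+ MvPowerSeries τ 𝔼 where
  toFun a := (wittLogSeries n m K).subst (MvPowerSeries.map ι a.val)
  map_zero' := by
    change (wittLogSeries n m K).subst (MvPowerSeries.map ι 0) = 0
    rw [map_zero]
    exact PowerSeries.subst_zero_of_constantCoeff_zero (constantCoeff_typicalSeries _)
  map_add' a b := by
    have h : ∀ a : (wittFGL n m K).Point τ, constantCoeff (MvPowerSeries.map ι a.val) = 0 :=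
      fun a => by
        have : IsNilpotent (constantCoeff a.val) := a.2
        rw [constantCoeff_map, isNilpotent_iff_eq_zero.1 this, map_zero]
    rw [← wittLogSeries_add (h a) (h b)]
    have := congrArg Subtype.val (map_add (pointMap (τ := τ) (wittFGL n m K) ι) a b)
    exact congrArg (fun x => (wittLogSeries n m K).subst x) this

lemma wittLogHom_apply (a : (wittFGL n m K).Point τ) :
    wittLogHom a = (wittLogSeries n m K).subst (MvPowerSeries.map ι a.val) := rfl

lemma eq_of_forall_le_order {R : Type*} [CommRing R] {a b : MvPowerSeries τ R}
    (h : ∀ r : ℕ, (r : ℕ∞) ≤ (a - b).order) : a = b := by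
  ext d
  rw [← sub_eq_zero, ← map_sub]
  exact coeff_of_lt_order (lt_of_lt_of_le (by exact_mod_cast Nat.lt_succ_self _) (h (d.degree + 1)))

/-- The logarithm has rational coefficients, so only the variable is changed. -/
lemma frobLift_pow_wittLogSeries (i : ℕ) : (frobLift (wittFrob K) ^ i)
    ((wittLogSeries n m K).subst (X 0 : MvPowerSeries (Fin 2) 𝔼))
      = (wittLogSeries n m K).subst ((X 0 : MvPowerSeries (Fin 2) 𝔼) ^ 2 ^ i) := by
  refine eq_of_forall_le_order fun r => ?_
  have hr : r ≤ 2 ^ r := (Nat.lt_two_pow_self (n := r)).le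
  have h1 := le_order_frobLift_pow (σ := wittFrob K) i
    (le_order_subst_typicalSeries (wittLog n m K) r (constantCoeff_X 0))
  have h2 := le_order_subst_typicalSeries (wittLog n m K) r
    (h := (X 0 : MvPowerSeries (Fin 2) 𝔼) ^ 2 ^ i) (by simp)
  have h3 := le_order_sub (le_trans (Nat.cast_le.2 (hr.trans
    (Nat.le_mul_of_pos_left _ (by positivity)))) h1) (le_trans (Nat.cast_le.2 hr) h2)
  convert h3 using 2
  simp only [map_sub, map_sum, map_mul, map_pow, frobLift_pow_C, frobLift_pow_X, wittLog,
    pow_ratCast, wittLogSeries]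
  simp only [sub_sub_sub_cancel_right]

/-- The polynomial `1 + (1 + T ^ m) ^ N`. -/
noncomputable def relationPoly (n m : ℕ) : Polynomial ℕ := 1 + (1 + Polynomial.X ^ m) ^ orb n

lemma relationPoly_coeff (k : ℕ) :
    (((relationPoly n m).coeff k : ℕ) : 𝔼) = 2 * wittSpecial n m K k := by
  rw [wittSpecial, ← mul_assoc, two_mul_half, one_mul, relationPoly, Polynomial.coeff_add,
    Polynomial.coeff_one, twOne, binomCoeff]
  push_cast
  rfl

/-- The point `x ^ (2 ^ i)`. -/
noncomputable def pointXPow {R : Type*} [CommRing R] (F : FormalGroup R) (i : ℕ) :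
    F.Point (Fin 2) :=
  ⟨X 0 ^ 2 ^ i, PowerSeries.HasSubst.of_constantCoeff_zero (by simp)⟩

/-- The coefficients of `relationPoly` are those of `2 w`. The logarithm of the combination of the
points `x ^ (2 ^ a)` is therefore the series of `2 w λ = 2 q`. -/
lemma wittLogHom_relation (hm : 1 ≤ m) :
    wittLogHom (∑ a ∈ range ((relationPoly n m).natDegree + 1),
      (relationPoly n m).coeff a • pointXPow (wittFGL n m K) a)
    = (typicalSeries fun k => 2 * (binomCoeff m (orb n) k : 𝔼)).subst
      (X 0 : MvPowerSeries (Fin 2) 𝔼) := by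
  set s : ℕ → 𝔼 := fun a => ((relationPoly n m).coeff a : 𝔼) with hs
  have e1 : wittLogHom (∑ a ∈ range ((relationPoly n m).natDegree + 1),
      (relationPoly n m).coeff a • pointXPow (wittFGL n m K) a)
      = ∑ a ∈ range ((relationPoly n m).natDegree + 1), C (s a) *
        (frobLift (wittFrob K) ^ a)
          ((wittLogSeries n m K).subst (X 0 : MvPowerSeries (Fin 2) 𝔼)) := by
    rw [map_sum]
    refine sum_congr rfl fun a _ => ?_
    rw [map_nsmul, wittLogHom_apply, frobLift_pow_wittLogSeries, nsmul_eq_mul]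
    simp [s, pointXPow]
  -- Padding by zero coefficients, so that the truncated product formula can be used to any
  -- precision.
  have e2 : ∀ r, ∑ a ∈ range ((relationPoly n m).natDegree + 1), C (s a) *
        (frobLift (wittFrob K) ^ a)
          ((wittLogSeries n m K).subst (X 0 : MvPowerSeries (Fin 2) 𝔼))
      = ∑ a ∈ range ((relationPoly n m).natDegree + 1 + r), C (s a) *
        (frobLift (wittFrob K) ^ a)
          ((wittLogSeries n m K).subst (X 0 : MvPowerSeries (Fin 2) 𝔼)) := by
    intro r
    refine sum_subset (range_mono (by omega)) fun a _ ha => ?_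
    rw [mem_range, not_lt] at ha
    rw [hs]
    simp only
    rw [Polynomial.coeff_eq_zero_of_natDegree_lt (by omega)]
    simp
  have e3 : twMul (wittFrob K) s (wittLog n m K)
      = fun k => 2 * (binomCoeff m (orb n) k : 𝔼) := by
    funext k
    rw [← twMul_wittSpecial (n := n) hm]
    simp only [twMul, mul_sum, hs, relationPoly_coeff, mul_assoc]
  rw [e1]
  refine eq_of_forall_le_order fun r => ?_
  rw [e2 r, ← e3]
  refine le_trans ?_ (le_order_twisted_typicalSeries _ _ _ _)
  exact_mod_cast le_trans (by omega)
    (Nat.lt_two_pow_self (n := (relationPoly n m).natDegree + 1 + r)).le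

/-- The lift of this point has logarithm `2 q`, twice an integral series. It is thus congruent to 0
modulo 2 and its reduction vanishes. -/
lemma sum_relationPoly_eq_zero (hm : 1 ≤ m) (G : FormalGroup K) [G.IsComm]
    (hG : G = (wittFGL n m K).map (WittVector.constantCoeff : WittVector 2 K →+* K)) :
    ∑ a ∈ range ((relationPoly n m).natDegree + 1), (relationPoly n m).coeff a •
      pointXPow G a = 0 := by
  subst hG
  set y := ∑ a ∈ range ((relationPoly n m).natDegree + 1),
      (relationPoly n m).coeff a • pointXPow (wittFGL n m K) a with hy
  have h1 : pointMap (wittFGL n m K) WittVector.constantCoeff y = 0 := by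
    refine Subtype.ext ?_
    have hy0 : constantCoeff (MvPowerSeries.map ι y.val) = 0 := by
      have : IsNilpotent (constantCoeff y.val) := y.2
      rw [constantCoeff_map, isNilpotent_iff_eq_zero.1 this, map_zero]
    have h2 : MvPowerSeries.map (WittVector.constantCoeff : WittVector 2 K →+* K) y.val
        = MvPowerSeries.map WittVector.constantCoeff
          (0 : MvPowerSeries (Fin 2) (WittVector 2 K)) := by
      refine map_constantCoeff_eq_of_half_sub_mem two_mul_half ?_
      rw [map_zero]
      refine half_sub_mem_of_log two_mul_half (two_pow_mul_wittLog_mem (n := n) hm) wittLog_zero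
        hy0 (map_zero _) (fun r => zero_mem _) fun r => ?_
      have h3 := wittLogHom_relation (n := n) (K := K) hm
      rw [← hy, wittLogHom_apply, wittLogSeries] at h3
      rw [h3, PowerSeries.subst_zero_of_constantCoeff_zero (constantCoeff_typicalSeries _), sub_zero]
      have h4 : (typicalSeries fun k => 2 * (binomCoeff m (orb n) k : 𝔼))
          = (2 : 𝔼) • typicalSeries fun k => (binomCoeff m (orb n) k : 𝔼) := by
        ext d
        simp only [typicalSeries, PowerSeries.coeff_mk, map_smul, smul_eq_mul]
        split_ifs <;> simp
      rw [h4, PowerSeries.subst_smul (PowerSeries.HasSubst.X 0), smul_eq_C_mul, ← mul_assoc,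
        ← map_mul, mul_comm (2⁻¹ : 𝔼), two_mul_half, map_one, one_mul]
      exact typicalSeries_subst_mem (fun k => natCast_mem _ _) (constantCoeff_X 0)
        (fun r => X_mem 0) r
    rw [map_zero] at h2
    exact h2
  rw [← h1, hy, map_sum]
  refine sum_congr rfl fun a _ => ?_
  rw [map_nsmul]
  congr 1
  refine Subtype.ext ?_
  change _ = MvPowerSeries.map _ (X 0 ^ 2 ^ a)
  rw [map_pow, map_X]
  rfl

/-- The Frobenius satisfies the equation `1 + (1 + S ^ m) ^ N = 0`. -/
theorem aeval_pointFrob_relationPoly (hm : 1 ≤ m) (j : ZLoc2 →+* K) :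
    Polynomial.aeval (pointFrob (τ := τ) n m j) (relationPoly n m) = 0 := by
  obtain rfl : j = WittVector.constantCoeff.comp (ZLoc2.toWitt K) := Subsingleton.elim _ _
  set j := (WittVector.constantCoeff : WittVector 2 K →+* K).comp (ZLoc2.toWitt K)
  have h0 := sum_relationPoly_eq_zero (n := n) hm (specialFGL n m j)
    (by rw [wittFGL, specialFGL_map])
  refine AddMonoidHom.ext fun a => ?_
  -- The relation holds for the coordinate `X 0`; substituting `a` transports it to an arbitrary
  -- point.
  have h1 := congrArg (pointPull (specialFGL n m j) a) h0
  rw [map_zero, map_sum] at h1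
  rw [Polynomial.aeval_eq_sum_range]
  refine Eq.trans ?_ h1
  refine (AddMonoidHom.finsetSum_apply _ _ _).trans (sum_congr rfl fun i _ => ?_)
  rw [map_nsmul]
  change (relationPoly n m).coeff i • ((pointFrob n m j ^ i) a) = _
  congr 1
  refine Subtype.ext ?_
  rw [pointFrob_pow_val]
  change _ = (X 0 ^ 2 ^ i : MvPowerSeries (Fin 2) K).subst fun _ => a.val
  have h : HasSubst fun _ : Fin 2 => a.val := hasSubst_of_constantCoeff_nilpotent fun _ => a.2
  rw [subst_pow h, subst_X h]

end Relation

/-! ### Descent of automorphisms to a finite field -/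

section Descent
variable {k : Type*} [Field k] [Finite k]

/-- Over `k` the polynomial `X ^ |k| - X` is the product of the `X - a`, so it has no further roots
in an extension. -/
lemma mem_range_algebraMap_of_pow_card {L : Type*} [Field L] [Algebra k L] {x : L}
    (hx : x ^ Nat.card k = x) : x ∈ (algebraMap k L).range := by
  have := Fintype.ofFinite k
  rw [Nat.card_eq_fintype_card] at hx
  have h1 := FiniteField.X_pow_card_sub_X_natDegree_eq k (Fintype.one_lt_card (α := k))
  have hm : (Polynomial.X ^ Fintype.card k - Polynomial.X : Polynomial k).Monic :=
    Polynomial.monic_X_pow_sub (by rw [Polynomial.degree_X]; exact_mod_cast Fintype.one_lt_card)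
  have h2 := Polynomial.prod_multiset_X_sub_C_of_monic_of_roots_card_eq hm (by
    rw [FiniteField.roots_X_pow_card_sub_X, h1]; rfl)
  rw [FiniteField.roots_X_pow_card_sub_X] at h2
  have h3 := congrArg (Polynomial.aeval x) h2
  have h4 : ∏ a : k, (x - algebraMap k L a) = 0 := by
    have e : (Multiset.map (fun a => Polynomial.X - Polynomial.C a) (univ : Finset k).val).prod
        = ∏ a : k, (Polynomial.X - Polynomial.C a) := rfl
    rw [e, map_prod] at h3
    simpa [hx] using h3
  obtain ⟨a, -, ha⟩ := prod_eq_zero_iff.1 h4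
  exact ⟨a, (sub_eq_zero.1 ha).symm⟩

lemma FGLAut.series_injective {R : Type*} [CommRing R] {F : FormalGroup R} :
    Function.Injective (FGLAut.series : FGLAut F → PowerSeries R) := by
  rintro ⟨a, _, _, _⟩ ⟨b, _, _, _⟩ (rfl : a = b)
  rfl

/-- All automorphisms are defined over the finite field `k` if and only if their coefficients are
fixed by the Frobenius of `k`. -/
lemma hasAllAutomorphisms_iff (F : FormalGroup k) : HasAllAutomorphisms F ↔
    ∀ φ : FGLAut (F.map (algebraMap k (AlgebraicClosure k))), ∀ d,
      φ.series.coeff d ^ Nat.card k = φ.series.coeff d := by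
  have hinj : Function.Injective (algebraMap k (AlgebraicClosure k)) := RingHom.injective _
  refine ⟨fun h φ d => ?_, fun h => ⟨fun a b hab => ?_, fun φ => ?_⟩⟩
  · obtain ⟨ψ, rfl⟩ := h.2 φ
    have := Fintype.ofFinite k
    rw [FGLAut.baseChange, PowerSeries.coeff_map, ← map_pow, Nat.card_eq_fintype_card,
      FiniteField.pow_card]
  · have h1 := congrArg FGLAut.series hab
    refine FGLAut.series_injective ?_
    exact map_injective_of_injective hinj h1
  · choose p hp using fun d => mem_range_algebraMap_of_pow_card (h φ d)
    have hφ : PowerSeries.map (algebraMap k (AlgebraicClosure k)) (PowerSeries.mk p) = φ.series := by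
      ext d
      rw [PowerSeries.coeff_map, PowerSeries.coeff_mk, hp]
    have h0 : (PowerSeries.mk p).constantCoeff = 0 := hinj (by
      rw [← PowerSeries.coeff_zero_eq_constantCoeff_apply, ← PowerSeries.coeff_map, hφ,
        PowerSeries.coeff_zero_eq_constantCoeff_apply, φ.constantCoeff_series, map_zero])
    refine ⟨⟨PowerSeries.mk p, h0, ?_, ?_⟩, ?_⟩
    · rw [isUnit_iff_ne_zero]
      intro h1
      have h2 := φ.isUnit_coeff_one
      rw [← hφ, PowerSeries.coeff_map, h1, map_zero] at h2
      exact not_isUnit_zero h2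
    · refine map_injective_of_injective hinj ?_
      have hX : ∀ i : Fin 2, PowerSeries.HasSubst (X i : MvPowerSeries (Fin 2) k) :=
        fun i => PowerSeries.HasSubst.X i
      rw [PowerSeries.map_subst (hasSubst_formalGroup F), map_subst (hasSubst_pair
        (subst_isNilpotent h0 (hX 0)) (subst_isNilpotent h0 (hX 1))), hφ]
      refine φ.subst_series.trans ?_
      congr 1
      funext i
      fin_cases i
      · simp [PowerSeries.map_subst (hX 0), hφ]
      · simp [PowerSeries.map_subst (hX 1), hφ]
    · exact FGLAut.series_injective hφ

lemma FGLAut.isEndo {R : Type*} [CommRing R] {F : FormalGroup R} (φ : FGLAut F) :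
    IsEndo F φ.series := ⟨φ.constantCoeff_series, φ.subst_series⟩

end Descent

/-! ### The endomorphism ring and small powers of Frobenius -/

section Group
variable {n m : ℕ} [Fact (1 ≤ m)] {K : Type*} [Field K] [CharP K 2] [IsAlgClosed K] {τ : Type*}
  {j : ZLoc2 →+* K}

lemma one_add_pointFrob (a : (specialFGL n m j).Point τ) :
    a + ((1 + pointFrob n m j ^ m) ^ orb n) a = 0 := by
  have h := aeval_pointFrob_relationPoly (n := n) (τ := τ) (Fact.out : 1 ≤ m) j
  rw [relationPoly] at h
  simp only [map_add, map_one, map_pow, Polynomial.aeval_X] at h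
  exact DFunLike.congr_fun h a

/-- The relation itself supplies inverses: `a + (1 + S ^ m) ^ N a = 0`. This is why it was stated
with natural coefficients. -/
noncomputable instance pointNeg : Neg ((specialFGL n m j).Point τ) :=
  ⟨fun a => ((1 + pointFrob n m j ^ m) ^ orb n) a⟩

noncomputable instance pointGroup : AddCommGroup ((specialFGL n m j).Point τ) where
  neg_add_cancel a := by
    rw [add_comm]
    exact one_add_pointFrob a
  zsmul := zsmulRec
  add_comm := add_comm

/-- So `1 + S ^ m` satisfies the equation of a root of unity of order `2 ^ n`. -/
lemma one_add_frob_pow : (1 + pointFrob (τ := τ) n m j ^ m) ^ orb n = -1 := by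
  refine eq_neg_of_add_eq_zero_right ?_
  have h := aeval_pointFrob_relationPoly (n := n) (τ := τ) (Fact.out : 1 ≤ m) j
  rw [relationPoly] at h
  simpa only [map_add, map_one, map_pow, Polynomial.aeval_X] using h

/-- The coordinate, as a point over the power series ring in one variable. -/
noncomputable def coordPoint {R : Type*} [CommRing R] (F : FormalGroup R) : F.Point Unit :=
  ⟨PowerSeries.X, PowerSeries.HasSubst.X'⟩

lemma coeff_pow_mul {r : ℕ} (f : PowerSeries K) (d : ℕ) :
    (f ^ 2 ^ r).coeff (d * 2 ^ r) = f.coeff d ^ 2 ^ r := by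
  have h := congrArg (MvPowerSeries.coeff (Finsupp.single () (d * 2 ^ r)))
    (map_iterateFrobenius_expand 2 two_ne_zero f r)
  rw [coeff_map] at h
  have e : Finsupp.single () (d * 2 ^ r) = 2 ^ r • Finsupp.single () d := by
    rw [Finsupp.smul_single, smul_eq_mul, mul_comm]
  refine h.symm.trans ?_
  rw [e, coeff_expand_smul, iterateFrobenius_def]
  rfl

/-- Applied to the coordinate, commutation reads `φ (x ^ (2 ^ r)) = φ (x) ^ (2 ^ r)`. The
coefficients in degree `d 2 ^ r` are compared. -/
lemma commute_iff_coeff_pow {φ : PowerSeries K} (hφ : IsEndo (specialFGL n m j) φ) (r : ℕ)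
    (h : Commute (hφ.onPoints (τ := Unit))
      (pointFrob n m j ^ r)) (d : ℕ) : φ.coeff d ^ 2 ^ r = φ.coeff d := by
  have h1 := congrArg Subtype.val (DFunLike.congr_fun h.eq (coordPoint (specialFGL n m j)))
  have h2 : φ.subst (PowerSeries.X ^ 2 ^ r : PowerSeries K) = φ ^ 2 ^ r := by
    have e1 : (hφ.onPoints ((pointFrob n m j ^ r) (coordPoint (specialFGL n m j)))).val
      = φ.subst (PowerSeries.X ^ 2 ^ r : PowerSeries K) := by
      rw [IsEndo.onPoints_val, pointFrob_pow_val]; rfl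
    have e2 : ((pointFrob n m j ^ r) (hφ.onPoints (coordPoint (specialFGL n m j)))).val
      = φ ^ 2 ^ r := by
      rw [pointFrob_pow_val, IsEndo.onPoints_val]
      exact congrArg (· ^ 2 ^ r) (PowerSeries.X_subst φ)
    rw [← e1, ← e2]
    exact h1
  rw [← coeff_pow_mul, ← h2, mul_comm, PowerSeries.coeff_subst_X_pow (by positivity)]
  simp

lemma frob_pow_of_one (hn : n = 1) : pointFrob (τ := τ) n m j ^ m = ((-2 : ℤ) : AddMonoid.End _) := by
  have h := one_add_frob_pow (n := n) (m := m) (τ := τ) (j := j)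
  subst hn
  rw [orb, Nat.sub_self, pow_zero, pow_one] at h
  rw [eq_sub_of_add_eq' h]
  norm_num

lemma frob_pow_of_two (hn : n = 2) :
    pointFrob (τ := τ) n m j ^ (4 * m) = ((-4 : ℤ) : AddMonoid.End _) := by
  have h := one_add_frob_pow (n := n) (m := m) (τ := τ) (j := j)
  subst hn
  have e : orb 2 = 2 := rfl
  rw [e] at h
  rw [mul_comm, pow_mul]
  generalize pointFrob (τ := τ) 2 m j ^ m = P at h
  -- `P` plays the role of `i - 1`, whose fourth power is `-4`; the second factor is its minimal
  -- polynomial.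
  have h1 := congrArg (Polynomial.aeval P) (show (Polynomial.X ^ 4 + 4 : Polynomial ℤ)
    = (Polynomial.X ^ 2 - 2 * Polynomial.X + 2) * ((1 + Polynomial.X) ^ 2 + 1) by ring)
  simp only [map_mul, map_add, map_pow, map_one, Polynomial.aeval_X, h, neg_add_cancel,
    mul_zero, map_ofNat] at h1
  rw [eq_neg_of_add_eq_zero_left h1]
  norm_num

end Group

/-! ### The criterion for having all automorphisms -/

section Small
variable {n m : ℕ} {k : Type*} [Field k] [CharP k 2]

lemma gammaFGL_map (hm : 1 ≤ m) {L : Type*} [Field L] (f : k →+* L) : (gammaFGL k n m).map f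
    = specialFGL n m (f.comp (WittVector.constantCoeff.comp (ZLoc2.toWitt k))) := by
  rw [gammaFGL_eq n m k hm, specialFGL_map]

/-- Integers are central among endomorphisms, so `S ^ r` commutes with every automorphism and all
coefficients lie in the field with `2 ^ r` elements. -/
lemma hasAllAutomorphisms_of_frob_pow (hm : 1 ≤ m) {r : ℕ} {z : ℤ} (hk : Nat.card k = 2 ^ r)
    (h : ∀ [Fact (1 ≤ m)] (j : ZLoc2 →+* AlgebraicClosure k),
      pointFrob (τ := Unit) n m j ^ r = (z : AddMonoid.End _)) :
    HasAllAutomorphisms (gammaFGL k n m) := by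
  have := Fact.mk hm
  have : Finite k := Nat.finite_of_card_ne_zero (by rw [hk]; positivity)
  rw [hasAllAutomorphisms_iff, gammaFGL_map hm]
  intro φ d
  rw [hk]
  refine commute_iff_coeff_pow φ.isEndo r ?_ d
  rw [h]
  exact Int.commute_cast _ _

end Small

/-! ### Arithmetic of `ℤ[X] / ((1 + X) ^ N + 1)` -/

section IntPoly

/-- The polynomial is Eisenstein at 2: the middle coefficients are even and the constant term is
exactly 2. Modulo it, `X ^ (2 ^ e)` is 2 times an element with constant term `-1`. -/
lemma exists_relation_decomposition (e : ℕ) : ∃ v : Polynomial ℤ,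
    (1 + Polynomial.X) ^ 2 ^ e + 1 = Polynomial.X ^ 2 ^ e + 2 * (1 + Polynomial.X * v) := by
  have hpos : 0 < 2 ^ e := by positivity
  obtain ⟨w, hw⟩ : Polynomial.C (2 : ℤ) ∣
      (1 + Polynomial.X) ^ 2 ^ e + 1 - Polynomial.X ^ 2 ^ e := by
    rw [Polynomial.C_dvd_iff_dvd_coeff]
    intro i
    rw [Polynomial.coeff_sub, Polynomial.coeff_add, Polynomial.coeff_one_add_X_pow,
      Polynomial.coeff_one, Polynomial.coeff_X_pow]
    rcases eq_or_ne i 0 with rfl | h0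
    · rw [if_pos rfl, if_neg hpos.ne]; simp
    rcases eq_or_ne i (2 ^ e) with rfl | h1
    · rw [if_neg h0, if_pos rfl]; simp
    · rw [if_neg h0, if_neg h1]
      simpa using Int.natCast_dvd_natCast.2 (Nat.prime_two.dvd_choose_pow (n := e) h0 h1)
  have hw0 : w.coeff 0 = 1 := by
    have := congrArg (Polynomial.coeff · 0) hw
    simp only [Polynomial.coeff_sub, Polynomial.coeff_add, Polynomial.coeff_one_add_X_pow,
      Polynomial.coeff_one, Polynomial.coeff_X_pow, Polynomial.coeff_C_mul, if_neg hpos.ne] at this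
    simp only [Nat.choose_zero_right, Nat.cast_one, if_true, sub_zero] at this
    omega
  refine ⟨w.divX, ?_⟩
  have h1 := w.X_mul_divX_add
  rw [hw0, map_one] at h1
  rw [add_comm 1 (Polynomial.X * _), h1]
  have h2 : (Polynomial.C (2 : ℤ)) = 2 := rfl
  rw [h2] at hw
  linear_combination hw

/-- No power of `ζ - 1` is an integer, for `ζ` a root of unity of order `2 ^ n ≥ 8`. -/
lemma not_dvd_X_pow_sub_C {N M : ℕ} (hN : 4 ∣ N) (hN0 : N ≠ 0) (hM : M ≠ 0) (a : ℤ) :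
    ¬ ((1 + Polynomial.X) ^ N + 1 : Polynomial ℤ) ∣ Polynomial.X ^ M - Polynomial.C a := by
  rintro ⟨Q, hQ⟩
  obtain ⟨z, hz⟩ := IsAlgClosed.exists_pow_nat_eq (-1 : ℂ) (Nat.pos_of_ne_zero hN0)
  have key : ∀ y : ℂ, y ^ N = -1 → (y - 1) ^ M = a := by
    intro y hy
    have h := congrArg (Polynomial.aeval (y - 1)) hQ
    simp only [map_sub, map_mul, map_add, map_pow, map_one, Polynomial.aeval_X,
      Polynomial.aeval_C, add_sub_cancel, hy, neg_add_cancel, zero_mul] at h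
    simpa [sub_eq_zero] using h
  have h4 : ∀ y : ℂ, y ^ 4 = 1 → y ^ N = 1 := by
    obtain ⟨c, rfl⟩ := hN
    intro y hy
    rw [pow_mul, hy, one_pow]
  have hne : ∀ y : ℂ, y ^ 4 = 1 → y ≠ z := by
    rintro y hy rfl
    rw [h4 y hy] at hz
    norm_num at hz
  -- Since `z ^ 3` is a conjugate of `z`, the numbers `z - 1` and `z ^ 3 - 1` would have the same
  -- `M`-th power, hence the same absolute value. This forces `|z ^ 2 + z + 1| = 1`.
  have h3 : (z ^ 3) ^ N = -1 := by
    rw [← pow_mul, mul_comm, pow_mul, hz]; norm_num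
  have e1 := congrArg norm ((key _ h3).trans (key z hz).symm)
  rw [norm_pow, norm_pow] at e1
  have e2 := (pow_left_inj₀ (norm_nonneg _) (norm_nonneg _) hM).1 e1
  have e3 : z ^ 3 - 1 = (z - 1) * (z ^ 2 + z + 1) := by ring
  have hz1 : ‖z - 1‖ ≠ 0 := by
    rw [norm_ne_zero_iff, sub_ne_zero]
    exact (hne 1 (by norm_num)).symm
  rw [e3, norm_mul] at e2
  have e4 : ‖z ^ 2 + z + 1‖ = 1 := mul_left_cancel₀ hz1 (by rw [e2, mul_one])
  have hzn : ‖z‖ = 1 := by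
    have := congrArg norm hz
    rw [norm_pow, norm_neg, norm_one] at this
    exact (pow_eq_one_iff_of_nonneg (norm_nonneg _) hN0).1 this
  have hre : z.re * z.re + z.im * z.im = 1 := by
    rw [← Complex.normSq_apply, Complex.normSq_eq_norm_sq, hzn, one_pow]
  have e5 : (z.re * z.re - z.im * z.im + z.re + 1) * (z.re * z.re - z.im * z.im + z.re + 1)
      + (2 * z.re * z.im + z.im) * (2 * z.re * z.im + z.im) = 1 := by
    have : Complex.normSq (z ^ 2 + z + 1) = 1 := by
      rw [Complex.normSq_eq_norm_sq, e4, one_pow]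
    rw [Complex.normSq_apply] at this
    simp only [pow_two, Complex.add_re, Complex.mul_re, Complex.one_re, Complex.add_im,
      Complex.mul_im, Complex.one_im] at this
    linear_combination this
  -- On the unit circle `|z ^ 2 + z + 1| = |2 Re z + 1|`. The value 1 occurs only for `Re z = 0` or
  -- `Re z = -1`, that is for fourth roots of unity, excluded by `4 ∣ N`.
  have e6 : z.re * (z.re + 1) = 0 := by
    have hi : z.im * z.im = 1 - z.re * z.re := by linear_combination hre
    have : 4 * (z.re * (z.re + 1)) = 0 := by
      linear_combination e5 - (z.im * z.im + z.re * z.re + 2 * z.re) * hre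
    linarith
  rcases mul_eq_zero.1 e6 with h | h
  · have h1 : z ^ 2 = -1 := by
      apply Complex.ext
      · simp only [pow_two, Complex.mul_re, Complex.neg_re, Complex.one_re]
        rw [h] at hre ⊢; linarith
      · simp [pow_two, h]
    exact hne z (by linear_combination (z ^ 2 - 1) * h1) rfl
  · have h0 : z.re = -1 := by linarith
    have him : z.im = 0 := by
      rw [h0] at hre
      have : z.im * z.im = 0 := by linarith
      simpa using this
    have h1 : z = -1 := Complex.ext (by simp [h0]) (by simp [him])
    exact hne z (by rw [h1]; norm_num) rfl

/-- A power of `X` is congruent to `a + 2 ^ j g` modulo `1 + (1 + X) ^ N`, where `g` begins with an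
odd coefficient (up to even ones) in a degree strictly between `0` and `N`. -/
lemma exists_X_pow_decomposition {N M : ℕ} (hN : 4 ∣ N) (hN0 : N ≠ 0) (hM : M ≠ 0) :
    ∃ (a : ℤ) (j i : ℕ) (B D Q : Polynomial ℤ), 0 < i ∧ i < N ∧
      Polynomial.X ^ M = Polynomial.C a
        + 2 ^ j * (Polynomial.X ^ i + Polynomial.X ^ (i + 1) * B + 2 * D)
        + ((1 + Polynomial.X) ^ N + 1) * Q := by
  set u : Polynomial ℤ := (1 + Polynomial.X) ^ N + 1 with hu
  have hd : ((1 + Polynomial.X) ^ N : Polynomial ℤ).natDegree = N := by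
    rw [add_comm, ← Polynomial.C_1, Polynomial.natDegree_pow, Polynomial.natDegree_X_add_C, mul_one]
  have hmon : ((1 + Polynomial.X) ^ N : Polynomial ℤ).Monic := by
    rw [add_comm, ← Polynomial.C_1]; exact (Polynomial.monic_X_add_C 1).pow N
  have hlt : (1 : Polynomial ℤ).degree < ((1 + Polynomial.X) ^ N : Polynomial ℤ).degree := by
    rw [Polynomial.degree_one, Polynomial.degree_eq_natDegree hmon.ne_zero, hd]
    exact_mod_cast Nat.pos_of_ne_zero hN0
  have hum : u.Monic := hmon.add_of_left hlt
  have hud : u.natDegree = N := by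
    rw [← hd]; exact Polynomial.natDegree_eq_of_degree_eq (Polynomial.degree_add_eq_left_of_degree_lt hlt)
  set r := (Polynomial.X ^ M : Polynomial ℤ) %ₘ u with hr
  have hrd : r.natDegree < N := by
    rw [← hud]
    refine Polynomial.natDegree_modByMonic_lt _ hum fun h => hN0 ?_
    rw [← hud, h, Polynomial.natDegree_one]
  have hdiv := Polynomial.modByMonic_add_div (Polynomial.X ^ M : Polynomial ℤ) u
  -- The remainder is not constant, as otherwise `X ^ M` would be congruent to an integer.
  have hne : r - Polynomial.C (r.coeff 0) ≠ 0 := fun h0 => by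
    refine not_dvd_X_pow_sub_C hN hN0 hM (r.coeff 0)
      ⟨(Polynomial.X ^ M : Polynomial ℤ) /ₘ u, ?_⟩
    rw [← sub_eq_zero.1 h0]
    linear_combination -hdiv
  have h2 : ¬ IsUnit (Polynomial.C (2 : ℤ)) := by
    rw [Polynomial.isUnit_C]; decide
  obtain ⟨j, g, hg, hrg⟩ := WfDvdMonoid.max_power_factor' hne h2
  have hC2 : (Polynomial.C (2 : ℤ)) = 2 := rfl
  rw [Polynomial.C_dvd_iff_dvd_coeff] at hg
  push Not at hg
  classical
  -- The first odd coefficient of `g`. It is not the constant one, which was subtracted, and it lies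
  -- below the degree `N` of the modulus.
  set i := Nat.find hg with hi
  have hcoef : ∀ d, (r - Polynomial.C (r.coeff 0)).coeff d = 2 ^ j * g.coeff d := fun d => by
    rw [hrg, ← map_pow, Polynomial.coeff_C_mul]
  have hiodd : ¬ 2 ∣ g.coeff i := Nat.find_spec hg
  have hi0 : i ≠ 0 := fun h => hiodd (by
    have h1 := hcoef 0
    rw [Polynomial.coeff_sub, Polynomial.coeff_C_zero, sub_self] at h1
    rw [h, (mul_eq_zero.1 h1.symm).resolve_left (by positivity)]
    exact dvd_zero _)
  have hiN : i < N := by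
    by_contra hc
    refine hiodd ?_
    have h1 := hcoef i
    rw [Polynomial.coeff_sub, Polynomial.coeff_eq_zero_of_natDegree_lt (by omega),
      Polynomial.coeff_C_of_ne_zero hi0, sub_zero] at h1
    rw [(mul_eq_zero.1 h1.symm).resolve_left (by positivity)]
    exact dvd_zero _
  obtain ⟨b, hb⟩ : ∃ b, g.coeff i = 1 + 2 * b := ⟨g.coeff i / 2, by omega⟩
  obtain ⟨D, hD⟩ : Polynomial.C (2 : ℤ) ∣ g - Polynomial.X ^ i
      - Polynomial.X ^ (i + 1) * (Polynomial.divX^[i + 1] g) := by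
    rw [Polynomial.C_dvd_iff_dvd_coeff]
    intro d
    have hdx : ∀ (e : ℕ) (p : Polynomial ℤ) (c : ℕ),
        (Polynomial.divX^[e] p).coeff c = p.coeff (c + e) := by
      intro e
      induction e with
      | zero => intro p c; rfl
      | succ e ih => intro p c; rw [Function.iterate_succ_apply, ih, Polynomial.coeff_divX]; rfl
    rw [Polynomial.coeff_sub, Polynomial.coeff_sub, Polynomial.coeff_X_pow,
      Polynomial.coeff_X_pow_mul', hdx]
    rcases lt_trichotomy d i with h | h | h
    · rw [if_neg h.ne, if_neg (by omega), sub_zero, sub_zero]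
      exact not_not.1 (Nat.find_min hg h)
    · rw [if_pos h, if_neg (by omega), h, hb]
      exact ⟨b, by ring⟩
    · rw [if_neg h.ne', if_pos (by omega), Nat.sub_add_cancel (by omega)]
      simp
  refine ⟨r.coeff 0, j, i, Polynomial.divX^[i + 1] g, D, (Polynomial.X ^ M : Polynomial ℤ) /ₘ u,
    Nat.pos_of_ne_zero hi0, hiN, ?_⟩
  rw [hC2] at hD hrg
  linear_combination -hdiv + hrg + 2 ^ j * hD

end IntPoly

/-! ### The filtration of points by order of vanishing -/

section Filtration
variable {n m : ℕ} {K : Type*} [Field K] [CharP K 2] {j : ZLoc2 →+* K}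

/-- `X ^ t` divides the point `a`. -/
def PointDvd {R : Type*} [CommRing R] {F : FormalGroup R} (t : ℕ) (a : F.Point Unit) : Prop :=
  (PowerSeries.X : PowerSeries R) ^ t ∣ a.val

lemma PointDvd.mono {R : Type*} [CommRing R] {F : FormalGroup R} {s t : ℕ} (h : s ≤ t)
    {a : F.Point Unit} (ha : PointDvd t a) : PointDvd s a := (pow_dvd_pow _ h).trans ha

lemma pointDvd_one {F : FormalGroup K} (a : F.Point Unit) : PointDvd 1 a := by
  have : IsNilpotent (PowerSeries.constantCoeff (R := K) a.val) := a.2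
  rw [PointDvd, pow_one, PowerSeries.X_dvd_iff]
  exact isNilpotent_iff_eq_zero.1 this

/-- Every monomial of `F (a, b)` containing `b` is divisible by `X ^ t`; the rest is `F (a, 0) = a`.
-/
lemma coeff_add_of_pointDvd {R : Type*} [CommRing R] {F : FormalGroup R} {t : ℕ}
    (a : F.Point Unit) {b : F.Point Unit} (hb : PointDvd t b) {d : ℕ} (hd : d < t) :
    PowerSeries.coeff (R := R) d (a + b).val = PowerSeries.coeff (R := R) d a.val := by
  conv_rhs => rw [← add_zero a]
  have h0 : ∀ c : F.Point Unit, PowerSeries.coeff (R := R) d (a + c).val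
      = ∑ᶠ e : Fin 2 →₀ ℕ, coeff e F.toPowerSeries •
        PowerSeries.coeff (R := R) d ((a.val : PowerSeries R) ^ e 0 * (c.val : PowerSeries R) ^ e 1) := by
    intro c
    refine (coeff_subst (hasSubst_pair a.2 c.2) F.toPowerSeries (Finsupp.single () d)).trans ?_
    refine finsum_congr fun e => ?_
    rw [Finsupp.prod_fintype _ _ (fun i => pow_zero _), Fin.prod_univ_two]
    rfl
  rw [h0, h0]
  refine finsum_congr fun e => ?_
  congr 1
  rcases eq_or_ne (e 1) 0 with h1 | h1
  · rw [h1, pow_zero, pow_zero]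
  · have h2 : (PowerSeries.X : PowerSeries R) ^ t ∣ (a.val : PowerSeries R) ^ e 0 *
        (b.val : PowerSeries R) ^ e 1 := (hb.trans (dvd_pow_self _ h1)).trans (dvd_mul_left _ _)
    have h3 : ((0 : F.Point Unit).val : PowerSeries R) ^ e 1 = 0 := zero_pow h1
    rw [PowerSeries.X_pow_dvd_iff.1 h2 d hd, h3, mul_zero, map_zero]

lemma PointDvd.add {R : Type*} [CommRing R] {F : FormalGroup R} {t : ℕ} {a b : F.Point Unit}
    (ha : PointDvd t a) (hb : PointDvd t b) : PointDvd t (a + b) :=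
  PowerSeries.X_pow_dvd_iff.2 fun d hd => by
    rw [coeff_add_of_pointDvd a hb hd]
    exact PowerSeries.X_pow_dvd_iff.1 ha d hd

lemma pointDvd_frob_pow (i : ℕ) {t : ℕ} {a : (specialFGL n m j).Point Unit} (ha : PointDvd t a) :
    PointDvd (t * 2 ^ i) ((pointFrob n m j ^ i) a) := by
  rw [PointDvd, pointFrob_pow_val, pow_mul]
  exact pow_dvd_pow_of_dvd ha _

lemma pointDvd_endo {φ : PowerSeries K} (hφ : IsEndo (specialFGL n m j) φ) {t : ℕ}
    {a : (specialFGL n m j).Point Unit} (ha : PointDvd t a) : PointDvd t (hφ.onPoints a) := by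
  obtain ⟨ψ, rfl⟩ := PowerSeries.X_dvd_iff.2 hφ.constantCoeff_eq
  rw [PointDvd, IsEndo.onPoints_val]
  refine ha.trans ?_
  rw [PowerSeries.subst_mul a.2, PowerSeries.subst_X a.2]
  exact dvd_mul_right _ _

/-- The converse of `commute_iff_coeff_pow`: with coefficients fixed by the `2 ^ r`-th power map, `φ
^ (2 ^ r)` is `φ (x ^ (2 ^ r))`. -/
lemma commute_of_coeff_pow {φ : PowerSeries K} (hφ : IsEndo (specialFGL n m j) φ) (r : ℕ)
    (h : ∀ d, φ.coeff d ^ 2 ^ r = φ.coeff d) {τ : Type*} :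
    Commute (hφ.onPoints (τ := τ)) (pointFrob n m j ^ r) := by
  have h1 : φ ^ 2 ^ r = expand (2 ^ r) (pow_ne_zero r two_ne_zero) φ := by
    have h2 := map_iterateFrobenius_expand 2 two_ne_zero φ r
    rw [map_expand] at h2
    rw [← h2]
    congr 1
    ext d
    refine (PowerSeries.coeff_map (iterateFrobenius K 2 r) d φ).trans ?_
    rw [iterateFrobenius_def, h]
  refine AddMonoidHom.ext fun a => Subtype.ext ?_
  have e1 : (hφ.onPoints ((pointFrob n m j ^ r) a)).val = φ.subst (a.val ^ 2 ^ r) := by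
    rw [IsEndo.onPoints_val, pointFrob_pow_val]
  have e2 : ((pointFrob n m j ^ r) (hφ.onPoints a)).val = φ.subst a.val ^ 2 ^ r := by
    rw [pointFrob_pow_val, IsEndo.onPoints_val]
  refine e1.trans (Eq.trans ?_ e2.symm)
  have ha : HasSubst fun _ : Unit => a.val := PowerSeries.HasSubst.const a.2
  rw [← PowerSeries.subst_pow a.2, h1, expand, coe_substAlgHom, PowerSeries.subst,
    PowerSeries.subst, subst_comp_subst_apply (HasSubst.X_pow (pow_ne_zero r two_ne_zero)) ha]
  congr 1
  funext i
  rw [subst_pow ha, subst_X ha]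

end Filtration

/-! ### Multiplication by 2, and the constraint on linear coefficients -/

section Torsion
variable {n m : ℕ} [Fact (1 ≤ m)] {K : Type*} [Field K] [CharP K 2] [IsAlgClosed K]
  {j : ZLoc2 →+* K}

lemma PointDvd.neg {t : ℕ} {a : (specialFGL n m j).Point Unit} (ha : PointDvd t a) :
    PointDvd t (-a) := by
  refine PowerSeries.X_pow_dvd_iff.2 fun d hd => ?_
  rw [← coeff_add_of_pointDvd (-a) ha hd, neg_add_cancel]
  exact map_zero _

/-- The Eisenstein form of the relation evaluated at `S ^ m`: up to sign, `S ^ h` is 2 times an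
operator congruent to 1 modulo `S ^ m`. -/
lemma exists_two_mul_eq : ∃ v : Polynomial ℤ,
    2 * (1 + pointFrob (τ := Unit) n m j ^ m * Polynomial.aeval (pointFrob n m j ^ m) v)
      = -(pointFrob n m j ^ m) ^ orb n := by
  obtain ⟨v, hv⟩ := exists_relation_decomposition (n - 1)
  refine ⟨v, ?_⟩
  have h := congrArg (Polynomial.aeval (pointFrob (τ := Unit) n m j ^ m)) hv
  have h1 := one_add_frob_pow (n := n) (m := m) (τ := Unit) (j := j)
  simp only [map_mul, map_add, map_pow, map_one, Polynomial.aeval_X, map_ofNat] at h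
  rw [orb] at h1 ⊢
  rw [h1, neg_add_cancel] at h
  exact (neg_eq_of_add_eq_zero_right h.symm).symm

/-- If `2 a = 0` then `S ^ h a = 0`, that is `a ^ (2 ^ h) = 0` in a domain. -/
lemma eq_zero_of_two_nsmul {a : (specialFGL n m j).Point Unit} (h : (2 : ℕ) • a = 0) : a = 0 := by
  obtain ⟨v, hv⟩ := exists_two_mul_eq (n := n) (m := m) (j := j)
  set W := 1 + pointFrob (τ := Unit) n m j ^ m * Polynomial.aeval (pointFrob n m j ^ m) v
  have h1 : ((2 : AddMonoid.End ((specialFGL n m j).Point Unit)) * W) a = 0 := by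
    have : (2 : AddMonoid.End ((specialFGL n m j).Point Unit)) * W = W * 2 := by
      rw [two_mul, mul_two]
    rw [this]
    change W ((2 : AddMonoid.End ((specialFGL n m j).Point Unit)) a) = 0
    have h2 : (2 : AddMonoid.End ((specialFGL n m j).Point Unit)) a = (2 : ℕ) • a := by
      rw [← one_add_one_eq_two, two_nsmul]; rfl
    rw [h2, h, map_zero]
  rw [hv, ← pow_mul] at h1
  have h2 : (pointFrob n m j ^ (m * orb n)) a = 0 := neg_eq_zero.1 h1
  refine Subtype.ext ?_
  have h3 := congrArg Subtype.val h2
  rw [pointFrob_pow_val] at h3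
  have h4 : (a.val : PowerSeries K) = 0 := eq_zero_of_pow_eq_zero (R := PowerSeries K) h3
  exact h4

lemma pointDvd_two_nsmul (t : ℕ) (ht : t ≤ 2 ^ height n m) (a : (specialFGL n m j).Point Unit) :
    PointDvd t ((2 : ℕ) • a) := by
  induction t generalizing a with
  | zero => exact (pointDvd_one _).mono (by omega)
  | succ t ih =>
    rcases Nat.eq_zero_or_pos t with rfl | ht0
    · exact pointDvd_one _
    obtain ⟨v, hv⟩ := exists_two_mul_eq (n := n) (m := m) (j := j)
    set V := Polynomial.aeval (pointFrob (τ := Unit) n m j ^ m) v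
    have h1 := DFunLike.congr_fun hv a
    -- Solving for `2 a`: the term `S ^ h a` has order at least `2 ^ h`, and `S ^ m` at least
    -- doubles the order already known for `2 V a`.
    have h2 : (2 : ℕ) • a = -(pointFrob n m j ^ (m * orb n)) a
        + -(pointFrob n m j ^ m) ((2 : ℕ) • V a) := by
      rw [two_mul, ← pow_mul] at h1
      have h3 : (a + (pointFrob n m j ^ m) (V a)) + (a + (pointFrob n m j ^ m) (V a))
        = -(pointFrob n m j ^ (m * orb n)) a := h1
      rw [← h3, map_nsmul, two_nsmul, two_nsmul]
      abel
    rw [h2]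
    have hm : 1 ≤ m := Fact.out
    refine PointDvd.add ((pointDvd_frob_pow (m * orb n) (pointDvd_one a)).neg.mono ?_)
      ((pointDvd_frob_pow m (ih (by omega) (V a))).neg.mono ?_)
    · rw [one_mul, mul_comm]; exact ht
    · have : 2 ^ 1 ≤ 2 ^ m := Nat.pow_le_pow_right two_pos hm
      nlinarith

/-- If all powers of the Frobenius commute with `φ` then the linear coefficient of `φ` lies in a
proper subfield of `𝔽_{2 ^ h}`, which does not depend on `φ`. -/
lemma exists_pow_eq_of_commute (hn : 2 < n) {r : ℕ} (hr : r ≠ 0) : ∃ i, 0 < i ∧ i < orb n ∧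
    ∀ φ : PowerSeries K, ∀ hφ : IsEndo (specialFGL n m j) φ,
      Commute (hφ.onPoints (τ := Unit)) (pointFrob n m j ^ (m * (orb n * r))) →
      φ.coeff 1 ^ 2 ^ (m * i) = φ.coeff 1 := by
  have hN4 : 4 ∣ orb n := by
    obtain ⟨c, rfl⟩ : ∃ c, n = c + 3 := ⟨n - 3, by omega⟩
    exact ⟨2 ^ c, by rw [orb, show c + 3 - 1 = 2 + c by omega, pow_add]; norm_num⟩
  have hN0 : orb n ≠ 0 := (orb_pos n).ne'
  have hm : 1 ≤ m := Fact.out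
  obtain ⟨a, e, i, B, D, Q, hi0, hiN, h⟩ := exists_X_pow_decomposition hN4 hN0
    (Nat.mul_ne_zero hN0 hr)
  refine ⟨i, hi0, hiN, fun φ hφ hc => ?_⟩
  set S := pointFrob (τ := Unit) n m j ^ m with hS
  set T := hφ.onPoints (τ := Unit) with hT
  have h1 := congrArg (Polynomial.aeval S) h
  have hu : (1 + S) ^ orb n = -1 := one_add_frob_pow
  simp only [map_mul, map_add, map_pow, map_one, Polynomial.aeval_X, map_ofNat, hu,
    neg_add_cancel, zero_mul, add_zero, Polynomial.aeval_C] at h1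
  set A := S ^ i + S ^ (i + 1) * Polynomial.aeval S B + 2 * Polynomial.aeval S D with hA
  -- `2 ^ e A` is a power of `S ^ m` minus a central integer.
  have hc1 : Commute T (2 ^ e * A) := by
    have h2 : 2 ^ e * A = S ^ (orb n * r) - algebraMap ℤ _ a := by rw [h1]; abel
    rw [h2, hS, ← pow_mul]
    exact hc.sub_right (Algebra.commutes a T).symm
  set x := coordPoint (specialFGL n m j) with hx
  -- The factor `2 ^ e` is cancelled on points, which have no 2-torsion.
  have hc2 : T (A x) = A (T x) := by
    have h3 : ∀ (f : ℕ) (y : (specialFGL n m j).Point Unit),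
        ((2 : AddMonoid.End ((specialFGL n m j).Point Unit)) ^ f) y = (2 ^ f : ℕ) • y := by
      intro f y
      have : (2 : AddMonoid.End ((specialFGL n m j).Point Unit)) ^ f = ((2 ^ f : ℕ) : _) := by
        push_cast; rfl
      rw [this, AddMonoid.End.natCast_apply]
    have h4 : ∀ (f : ℕ) (y : (specialFGL n m j).Point Unit), (2 ^ f : ℕ) • y = 0 → y = 0 := by
      intro f
      induction f with
      | zero => intro y hy; simpa using hy
      | succ f ih => intro y hy; exact eq_zero_of_two_nsmul (ih _ (by rw [smul_smul, ← pow_succ, hy]))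
    have h5 : T ((2 ^ e : AddMonoid.End ((specialFGL n m j).Point Unit)) (A x))
      = (2 ^ e : AddMonoid.End ((specialFGL n m j).Point Unit)) (A (T x)) :=
      DFunLike.congr_fun hc1.eq x
    rw [h3, h3, map_nsmul] at h5
    refine sub_eq_zero.1 (h4 e _ ?_)
    rw [nsmul_sub, h5, sub_self]
  set t := 2 ^ (m * i) with ht
  -- Beyond `S ^ (m i)`, the remaining terms of `A` have order above `t`: one contains `S ^ (m (i +
  -- 1))`, the other a factor 2, of order at least `2 ^ h > t` since `i < N`.
  have hlead : ∀ y : (specialFGL n m j).Point Unit, ∃ z, PointDvd (t + 1) z ∧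
      A y = (pointFrob n m j ^ (m * i)) y + z := by
    intro y
    refine ⟨(pointFrob n m j ^ (m * (i + 1))) ((Polynomial.aeval S B) y)
      + (2 : ℕ) • (Polynomial.aeval S D) y, PointDvd.add
        ((pointDvd_frob_pow _ (pointDvd_one _)).mono ?_) (pointDvd_two_nsmul _ ?_ _), ?_⟩
    · rw [one_mul]
      exact Nat.pow_lt_pow_right one_lt_two (Nat.mul_lt_mul_of_pos_left (Nat.lt_succ_self i) hm)
    · refine Nat.pow_lt_pow_right one_lt_two ?_
      rw [height, mul_comm m]
      exact Nat.mul_lt_mul_of_pos_right hiN hm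
    · rw [hA, hS, ← pow_mul, ← pow_mul, ← add_assoc, two_nsmul, two_mul]
      rfl
  obtain ⟨z₁, hz₁, e1⟩ := hlead x
  obtain ⟨z₂, hz₂, e2⟩ := hlead (T x)
  rw [e1, e2, map_add] at hc2
  -- In degree `t`, `T (A x)` has the coefficient `φ_1` and `A (T x)` has `φ_1 ^ t`.
  have h6 := congrArg (fun y : (specialFGL n m j).Point Unit =>
    PowerSeries.coeff (R := K) t y.val) hc2
  rw [coeff_add_of_pointDvd _ (pointDvd_endo hφ hz₁) (Nat.lt_succ_self t),
    coeff_add_of_pointDvd _ hz₂ (Nat.lt_succ_self t), IsEndo.onPoints_val, pointFrob_pow_val,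
    pointFrob_pow_val, IsEndo.onPoints_val] at h6
  have h7 : φ.subst (x.val : PowerSeries K) = φ := PowerSeries.X_subst φ
  have h8 := coeff_pow_mul (r := m * i) φ 1
  rw [one_mul] at h8
  rw [← h8]
  have h9 : PowerSeries.coeff t (φ.subst (PowerSeries.X ^ t : PowerSeries K)) = φ.coeff 1 := by
    have ht0 : 0 < t := by positivity
    rw [PowerSeries.coeff_subst_X_pow ht0.ne', if_pos dvd_rfl, Nat.div_self ht0]
    simp
  rw [← h9]
  refine Eq.trans ?_ h6.symm
  exact congrArg (fun f : PowerSeries K => PowerSeries.coeff t (f ^ t)) h7.symm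

end Torsion

/-! ### Failure for `n > 2` and conclusion -/

lemma exists_pow_ne {K : Type*} [Field K] [CharP K 2] [IsAlgClosed K] {h s : ℕ} (hs : 0 < s)
    (hsh : s < h) : ∃ x : K, x ^ 2 ^ h = x ∧ x ^ 2 ^ s ≠ x := by
  by_contra! hc
  have h1 : (Polynomial.X ^ 2 ^ s - Polynomial.X : Polynomial K) ≠ 0 :=
    FiniteField.X_pow_card_pow_sub_X_ne_zero K hs.ne' one_lt_two
  have h2 : (Polynomial.X ^ 2 ^ h - Polynomial.X : Polynomial K) ≠ 0 :=
    FiniteField.X_pow_card_pow_sub_X_ne_zero K (by omega) one_lt_two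
  have h3 : (Polynomial.X ^ 2 ^ h - Polynomial.X : Polynomial K).Separable :=
    galois_poly_separable 2 _ (dvd_pow_self 2 (by omega))
  have hsub : (Polynomial.X ^ 2 ^ h - Polynomial.X : Polynomial K).roots ⊆
      (Polynomial.X ^ 2 ^ s - Polynomial.X : Polynomial K).roots := fun x hx => by
    rw [Polynomial.mem_roots h2] at hx
    rw [Polynomial.mem_roots h1]
    simp only [Polynomial.IsRoot, Polynomial.eval_sub, Polynomial.eval_pow, Polynomial.eval_X,
      sub_eq_zero] at hx ⊢
    exact hc x hx
  -- Separability gives `2 ^ h` distinct roots, too many for a polynomial of degree `2 ^ s`.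
  have h4 := Multiset.card_le_card
    ((Multiset.le_iff_subset (Polynomial.nodup_roots h3)).2 hsub)
  rw [← (IsAlgClosed.splits _).natDegree_eq_card_roots] at h4
  have h5 := h4.trans (Polynomial.card_roots' _)
  rw [FiniteField.X_pow_card_pow_sub_X_natDegree_eq K (by omega) one_lt_two,
    FiniteField.X_pow_card_pow_sub_X_natDegree_eq K hs.ne' one_lt_two] at h5
  exact absurd ((Nat.pow_le_pow_iff_right one_lt_two).1 h5) (by omega)

lemma not_hasAllAutomorphisms {n m : ℕ} (hm : 1 ≤ m) {k : Type*} [Field k] [CharP k 2]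
    (hn : 2 < n) {r : ℕ} (hk : Nat.card k = 2 ^ r) :
    ¬ HasAllAutomorphisms (gammaFGL k n m) := by
  have := Fact.mk hm
  have : Finite k := Nat.finite_of_card_ne_zero (by rw [hk]; positivity)
  have hr : r ≠ 0 := by
    rintro rfl
    exact (Finite.one_lt_card (α := k)).ne' hk
  rw [hasAllAutomorphisms_iff, gammaFGL_map hm]
  intro hall
  set j := (algebraMap k (AlgebraicClosure k)).comp
    (WittVector.constantCoeff.comp (ZLoc2.toWitt k)) with hj
  obtain ⟨i, hi0, hiN, hcomm⟩ := exists_pow_eq_of_commute (n := n) (m := m) (j := j) hn hr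
  have hih : m * i < height n m := by
    rw [height, mul_comm m]
    exact Nat.mul_lt_mul_of_pos_right hiN hm
  -- An element of `𝔽_{2 ^ h}` outside the constraint: it is the linear coefficient of an
  -- automorphism, whereas commutation with Frobenius would force `x ^ (2 ^ (m i)) = x`.
  obtain ⟨x, hx, hxi⟩ := exists_pow_ne (K := AlgebraicClosure k)
    (Nat.mul_pos hm hi0 : 0 < m * i) hih
  obtain ⟨φ, h0, h1, h2⟩ := exists_endomorphism n hm hx
  have hG : (wittFGL n m (AlgebraicClosure k)).map WittVector.constantCoeff
      = specialFGL n m j := by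
    rw [wittFGL, specialFGL_map]
    exact congrArg _ (Subsingleton.elim _ _)
  rw [hG] at h2
  have hx0 : x ≠ 0 := by
    rintro rfl
    exact hxi (zero_pow (by positivity))
  have hφ : IsEndo (specialFGL n m j) φ := ⟨h0, h2⟩
  have hfix := hall ⟨φ, h0, by rw [h1]; exact isUnit_iff_ne_zero.2 hx0, h2⟩
  have h3 := hcomm φ hφ (commute_of_coeff_pow hφ _ fun d => ?_)
  · rw [h1] at h3
    exact hxi h3
  · have h4 : φ.coeff d ^ 2 ^ r = φ.coeff d := by rw [← hk]; exact hfix d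
    rw [← mul_assoc, mul_comm]
    generalize m * orb n = e
    induction e with
    | zero => simp
    | succ e ih => rw [mul_add, mul_one, pow_add, pow_mul, ih, h4]

end RealBordism

/-- A finite field is determined by its cardinality, so `𝔽_{2 ^ r}` enters as any field with `2 ^ r`
elements. -/
theorem mainTheorem8 (n m : ℕ) (hm : 1 ≤ m) (k : Type*) [Field k] [CharP k 2] :
    (n = 1 → Nat.card k = 2 ^ RealBordism.height n m →
      RealBordism.HasAllAutomorphisms (RealBordism.gammaFGL k n m)) ∧
    (n = 2 → Nat.card k = 2 ^ (2 * RealBordism.height n m) →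
      RealBordism.HasAllAutomorphisms (RealBordism.gammaFGL k n m)) ∧
    (2 < n → ∀ r : ℕ, Nat.card k = 2 ^ r →
      ¬ RealBordism.HasAllAutomorphisms (RealBordism.gammaFGL k n m)) := by
  refine ⟨fun hn hk => ?_, fun hn hk => ?_, fun hn r hk =>
    RealBordism.not_hasAllAutomorphisms hm hn hk⟩
  · refine RealBordism.hasAllAutomorphisms_of_frob_pow hm (z := -2) hk fun j => ?_
    rw [RealBordism.height, hn, Nat.sub_self, pow_zero, one_mul]
    exact RealBordism.frob_pow_of_one rfl
  · refine RealBordism.hasAllAutomorphisms_of_frob_pow hm (z := -4) hk fun j => ?_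
    have e : 2 * RealBordism.height n m = 4 * m := by
      rw [RealBordism.height, hn]; ring
    rw [e]
    exact RealBordism.frob_pow_of_two hn
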